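/- **Setting.** Let $H$ be a real separable Hilbert space and $\mathcal A^{-1}:H\to H$ a compact, self-adjoint, positive definite operator (not necessarily of trace class); let $V=D(\mathcal A^{1/2})$ and $a(u,v)=\langle\mathcal A^{1/2}u,\mathcal A^{1/2}v\rangle_H$. Let $\mathcal B:H\to\mathbb R^\beta$ be bounded and linear, $\Gamma\in\mathbb R^{\beta\times\beta}$ symmetric positive definite, $y\in\mathbb R^\beta$, and let $\mathcal F:H\to\mathbb R$ be a bounded linear functional. Let $V_0\subset V_1\subset\dots\subset V$ be finite-dimensional subspaces with bases $\{\phi^\ell_j\}_{j=1}^{n_\ell}$, and put $$(A_\ell)_{jk}=a(\phi^\ell_j,\phi^\ell_k),\quad (B_\ell)_{jk}=(\mathcal B\phi^\ell_j)_k,\quad \widetilde A_\ell=A_\ell+B_\ell\Gamma^{-1}B_\ell^\top,\quad (f_\ell)_j=y^\top\Gamma^{-1}\mathcal B\phi^\ell_j,\quad (F_\ell)_j=\mathcal F(\phi^\ell_j).$$ Let $I_{\ell-1}^\ell\in\mathbb R^{n_\ell\times n_{\ell-1}}$ be the matrix of the inclusion $V_{\ell-1}\subset V_\ell$ in these bases,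 and $I_\ell^{\ell-1}=(I_{\ell-1}^\ell)^\top$. **Algorithm.** One smoothing step with splitting matrix $M$ on level $\ell$ is $\theta\mapsto\theta+M^{-1}(f+\xi-\widetilde A_\ell\theta)$ with a fresh $\xi\sim\mathcal N(0,M+M^\top-\widetilde A_\ell)$. The update $\mathrm{MGMC}_\ell(f,\theta)$ ($V$-cycle) returns for $\ell=0$ an exact sample of $\mathcal N(\widetilde A_0^{-1}f,\widetilde A_0^{-1})$. For $\ell\ge1$ it performs $\nu/2$ smoothing steps with splitting matrix $M_\ell$, giving $\theta'$; it adds $I_{\ell-1}^\ell\psi$ with $\psi=\mathrm{MGMC}_{\ell-1}(I_\ell^{\ell-1}(f-\widetilde A_\ell\theta'),0)$; and it performs $\nu/2$ further smoothing steps with $M_\ell$. Here $\nu>0$ is even. The states $\theta_L^{(0)},\theta_L^{(1)},\dots$ form a Markov chain on $\mathbb R^{n_L}$ with $\theta_L^{(m+1)}=\mathrm{MGMC}_L(f_L,\theta_L^{(m)})$. **Assumptions.** For all $\ell\ge1$ the matrix $M_\ell$ is symmetric, $0<\widetilde A_\ell\le M_\ell$ (smoothing property), and $$\big\|M_\ell^{1/2}\big(\widetilde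 A_\ell^{-1}-I_{\ell-1}^\ell\widetilde A_{\ell-1}^{-1}I_\ell^{\ell-1}\big)M_\ell^{1/2}\big\|_2\le C_A$$ with a constant $C_A>0$ independent of $\ell$ (approximation property). The initial state $\theta_L^{(0)}$ is (possibly degenerate) multivariate normal with $$\max\big\{\|\widetilde A_L^{1/2}\,\mathbb E[\theta_L^{(0)}]\|_2,\ \|\widetilde A_L^{1/2}\,\mathrm{Cov}(\theta_L^{(0)})\,\widetilde A_L^{1/2}\|_2\big\}\le C_0,$$ with $C_0$ independent of $L$. **Theorem.** MGMC is near-optimal as $n_L\to\infty$, in the following sense. 1. *(Cost.)* Suppose in addition that $n_0\ge1$; that $n_{\ell-1}\le\rho_G n_\ell$ for all $\ell\ge1$ with a constant $\rho_G<1$; that the matrices $A_\ell$, $I_{\ell-1}^\ell$, $I_\ell^{\ell-1}$ have a number of non-zero entries per row that is bounded independently of $\ell$; and that the smoother is the symmetric Gibbs smoother with low-rank correction, i.e. for $\ell\ge1$ $$M_\ell=(D_\ell+B_\ell\Gamma^{-1}B_\ell^\top+L_\ell)(D_\ell+B_\ell\Gamma^{-1}B_\ell^\top)^{-1}(D_\ell+B_\ell\Gamma^{-1}B_\ell^\top+L_\ell^\top),$$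 where $D_\ell$ and $L_\ell$ are the diagonal and the strictly lower triangular part of $A_\ell$. Then there is a constant $C$ independent of $L$ such that, for every $L$, a new state of the chain can be generated from the current one (that is, a sample of $\mathrm{MGMC}_L(f_L,\theta)$ can be generated from $\theta$) by a straight-line program with at most $C\,n_L$ elementary steps. An elementary step is an arithmetic operation $+,-,\times,/$ on real numbers, the loading of a constant that is fixed before the simulation starts (set-up costs are not counted), or the drawing of an independent standard normal number. 2. *(Autocorrelation.)* There is a constant $C_\tau$ independent of $L$ and $m$ such that, for all $m\ge1$, the integrated autocorrelation time $$\tau^{(m)}_{\mathrm{int},F_L}=1+2\sum_{s=1}^\infty\frac{\mathrm{Cov}(F_L^\top\theta_L^{(m+s)},F_L^\top\theta_L^{(m)})}{\mathrm{Cov}(F_L^\top\theta_L^{(m)},F_L^\top\theta_L^{(m)})}$$ is a convergent series and is bounded by $C_\tau$ in absolute value; the denominator is positive whenever $F_L\ne0$, and for $F_L=0$ the quotients are read as $0$. 3. *(Convergence.)* There are positive constants $C_{1,1},C_{1,2}$ independent of $L$ and $m$ such that, with $C_2=\log(C_A+\nu)-\log(C_A)>0$, for all $m\ge0$ $$\big|\mathbb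 E[F_L^\top\theta_L^{(m)}]-F_L^\top\widetilde A_L^{-1}f_L\big|\le C_{1,1}e^{-C_2m},\qquad \big|\mathrm{Var}(F_L^\top\theta_L^{(m)})-F_L^\top\widetilde A_L^{-1}F_L\big|\le C_{1,2}e^{-2C_2m}.$$ The constants $C_\tau,C_{1,1},C_{1,2}$ may depend on the inverse problem, on $\mathcal F$, the hierarchy, $(M_\ell)$, $\nu$, $C_A$ and $C_0$, but not on $L$, $m$ or the initial distribution. -/

import Mathlib

open MeasureTheory ProbabilityTheory Matrix
open scoped RealInnerProductSpace Matrix.Norms.L2Operator MatrixOrder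

noncomputable section

namespace MGMC

/-- `ℝⁿ` with the Euclidean norm. -/
abbrev E (n : ℕ) : Type := EuclideanSpace ℝ (Fin n)

/-- Matrix-vector product on Euclidean spaces. -/
def app {a b : ℕ} (A : Matrix (Fin a) (Fin b) ℝ) (x : E b) : E a :=
  WithLp.toLp 2 (A *ᵥ x.ofLp)

/-! ### The linear Bayesian inverse problem on a Hilbert space -/

/-- The data of the linear Gaussian inverse problem `y = 𝓑 v + η`, with prior covariance operator
`𝒜⁻¹` (self-adjoint, positive definite, compact; not necessarily of trace class), a bounded
observation operator `𝓑 : H → ℝ^β`, noise covariance `Γ` and observation `y`. -/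
structure BayesProblem (H : Type*) [NormedAddCommGroup H] [InnerProductSpace ℝ H]
    (β : ℕ) where
  /-- the prior covariance operator `𝒜⁻¹` -/
  covOp : H →L[ℝ] H
  covOp_symm : (covOp : H →ₗ[ℝ] H).IsSymmetric
  covOp_pos : ∀ x : H, x ≠ 0 → 0 < ⟪covOp x, x⟫
  covOp_compact : IsCompactOperator covOp
  /-- `𝒜^{-1/2}`, the unique positive square root of `𝒜⁻¹` -/
  covRoot : H →L[ℝ] H
  covRoot_pos : covRoot.IsPositive
  covRoot_sq : covRoot ∘L covRoot = covOp
  /-- the observation operator `𝓑` -/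
  obs : H →L[ℝ] E β
  /-- the covariance matrix of the observation error -/
  Γ : Matrix (Fin β) (Fin β) ℝ
  Γ_posDef : Γ.PosDef
  /-- the observation -/
  y : E β

section Problem

variable {H : Type*} [NormedAddCommGroup H] [InnerProductSpace ℝ H] {β : ℕ}

/-- The unbounded operator `𝒜^{1/2}`, the inverse of `𝒜^{-1/2}`; its domain is the range
of `𝒜^{-1/2}`. -/
def BayesProblem.precRoot (𝔓 : BayesProblem H β) : H →ₗ.[ℝ] H :=
  ((𝔓.covRoot : H →ₗ[ℝ] H).toPMap ⊤).inverse

/-- The bilinear form `a(u, v) = ⟨𝒜^{1/2} u, 𝒜^{1/2} v⟩` on `V = D(𝒜^{1/2})`. -/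
def BayesProblem.form (𝔓 : BayesProblem H β) (u v : 𝔓.precRoot.domain) : ℝ :=
  ⟪𝔓.precRoot u, 𝔓.precRoot v⟫

/-- A nested hierarchy `V₀ ⊆ V₁ ⊆ … ⊆ V = D(𝒜^{1/2})` of finite-dimensional spaces, each with
a basis `φ ℓ` of `n ℓ` elements. -/
structure Hierarchy (𝔓 : BayesProblem H β) where
  /-- the number of unknowns on each level -/
  n : ℕ → ℕ
  /-- the basis functions -/
  φ : (ℓ : ℕ) → Fin (n ℓ) → H
  mem_domain : ∀ ℓ j, φ ℓ j ∈ 𝔓.precRoot.domain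
  linInd : ∀ ℓ, LinearIndependent ℝ (φ ℓ)
  nested : ∀ ℓ, Submodule.span ℝ (Set.range (φ ℓ)) ≤ Submodule.span ℝ (Set.range (φ (ℓ + 1)))

namespace Hierarchy

variable {𝔓 : BayesProblem H β} (𝔥 : Hierarchy 𝔓)

/-- The prior precision matrix `(A_ℓ)_{jk} = a(φ_j, φ_k)`. -/
def A (ℓ : ℕ) : Matrix (Fin (𝔥.n ℓ)) (Fin (𝔥.n ℓ)) ℝ :=
  Matrix.of fun j k => 𝔓.form ⟨𝔥.φ ℓ j, 𝔥.mem_domain ℓ j⟩ ⟨𝔥.φ ℓ k, 𝔥.mem_domain ℓ k⟩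

/-- The observation matrix `(B_ℓ)_{jk} = (𝓑 φ_j)_k`. -/
def B (ℓ : ℕ) : Matrix (Fin (𝔥.n ℓ)) (Fin β) ℝ :=
  Matrix.of fun j k => 𝔓.obs (𝔥.φ ℓ j) k

/-- The low-rank term `B_ℓ Γ⁻¹ B_ℓᵀ`. -/
def lowRank (ℓ : ℕ) : Matrix (Fin (𝔥.n ℓ)) (Fin (𝔥.n ℓ)) ℝ :=
  𝔥.B ℓ * 𝔓.Γ⁻¹ * (𝔥.B ℓ)ᵀ

/-- The posterior precision matrix `Ã_ℓ = A_ℓ + B_ℓ Γ⁻¹ B_ℓᵀ`. -/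
def post (ℓ : ℕ) : Matrix (Fin (𝔥.n ℓ)) (Fin (𝔥.n ℓ)) ℝ :=
  𝔥.A ℓ + 𝔥.lowRank ℓ

/-- The right-hand side `(f_ℓ)_j = yᵀ Γ⁻¹ 𝓑 φ_j`. -/
def f (ℓ : ℕ) : E (𝔥.n ℓ) :=
  WithLp.toLp 2 fun j => 𝔓.y.ofLp ⬝ᵥ (𝔓.Γ⁻¹ *ᵥ (𝔓.obs (𝔥.φ ℓ j)).ofLp)

/-- The representation `(F_ℓ)_j = 𝓕 φ_j` of a bounded linear functional `𝓕`. -/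
def F (𝓕 : H →L[ℝ] ℝ) (ℓ : ℕ) : Fin (𝔥.n ℓ) → ℝ :=
  fun j => 𝓕 (𝔥.φ ℓ j)

/-- The canonical prolongation from level `ℓ` to level `ℓ + 1`: column `k` holds the coordinates
of the coarse basis function `φ ℓ k` in the basis `φ (ℓ + 1)`. -/
def prolong (ℓ : ℕ) : Matrix (Fin (𝔥.n (ℓ + 1))) (Fin (𝔥.n ℓ)) ℝ :=
  Matrix.of fun j k =>
    (Module.Basis.span (𝔥.linInd (ℓ + 1))).repr
      ⟨𝔥.φ ℓ k, 𝔥.nested ℓ (Submodule.subset_span ⟨k, rfl⟩)⟩ j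

/-- `D_ℓ`, the diagonal part of `A_ℓ`. -/
def diagPart (ℓ : ℕ) : Matrix (Fin (𝔥.n ℓ)) (Fin (𝔥.n ℓ)) ℝ :=
  Matrix.diagonal fun i => 𝔥.A ℓ i i

/-- `L_ℓ`, the strictly lower triangular part of `A_ℓ`. -/
def lowerPart (ℓ : ℕ) : Matrix (Fin (𝔥.n ℓ)) (Fin (𝔥.n ℓ)) ℝ :=
  Matrix.of fun i j => if j < i then 𝔥.A ℓ i j else 0

/-- The splitting matrix of the symmetric Gibbs (symmetric Gauss--Seidel) smoother with low-rank
correction. -/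
def sgs (ℓ : ℕ) : Matrix (Fin (𝔥.n ℓ)) (Fin (𝔥.n ℓ)) ℝ :=
  (𝔥.diagPart ℓ + 𝔥.lowRank ℓ + 𝔥.lowerPart ℓ) * (𝔥.diagPart ℓ + 𝔥.lowRank ℓ)⁻¹ *
    (𝔥.diagPart ℓ + 𝔥.lowRank ℓ + (𝔥.lowerPart ℓ)ᵀ)

/-- The prior precision matrices and the prolongation and restriction matrices have at most `s`
non-zero entries per row, on all levels. -/
def Sparse (s : ℕ) : Prop :=
  ∀ ℓ, (∀ i, {j | 𝔥.A ℓ i j ≠ 0}.ncard ≤ s) ∧ (∀ i, {j | 𝔥.prolong ℓ i j ≠ 0}.ncard ≤ s) ∧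
    ∀ j, {i | 𝔥.prolong ℓ i j ≠ 0}.ncard ≤ s

end Hierarchy

end Problem

/-! ### Multigrid Monte Carlo -/

/-- The law of the random smoother `θ' = θ + M⁻¹ (f + ξ - A θ)` with
`ξ ∼ 𝒩(0, M + Mᵀ - A)`. -/
def smootherLaw {n : ℕ} (A M : Matrix (Fin n) (Fin n) ℝ) (f θ : E n) : Measure (E n) :=
  (multivariateGaussian 0 (M + Mᵀ - A)).map fun ξ => θ + app M⁻¹ (f + ξ - app A θ)

/-- The law after `k` independent applications of the random update `T`. -/
def repeatLaw {X : Type*} [MeasurableSpace X] (T : X → Measure X) : ℕ → X → Measure X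
  | 0, x => Measure.dirac x
  | k + 1, x => (T x).bind (repeatLaw T k)

/-- The law of the new state of the Multigrid Monte Carlo update with right-hand side `f` and
current state `θ` on a given level: on level `0` an exact sample of `𝒩(A₀⁻¹ f, A₀⁻¹)`; on level
`ℓ + 1` first `ν₁` pre-smoothing steps, then the coarse-level correction, obtained by
`γ (ℓ + 1)` recursive calls that start from `0`, then `ν₂` post-smoothing steps. -/
def mgmcLaw {n : ℕ → ℕ} (A Mpre Mpost : (ℓ : ℕ) → Matrix (Fin (n ℓ)) (Fin (n ℓ)) ℝ)
    (I : (ℓ : ℕ) → Matrix (Fin (n (ℓ + 1))) (Fin (n ℓ)) ℝ) (ν₁ ν₂ : ℕ) (γ : ℕ → ℕ) :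
    (ℓ : ℕ) → E (n ℓ) → E (n ℓ) → Measure (E (n ℓ))
  | 0, f, _ => multivariateGaussian (app (A 0)⁻¹ f) (A 0)⁻¹
  | ℓ + 1, f, θ =>
    (repeatLaw (smootherLaw (A (ℓ + 1)) (Mpre (ℓ + 1)) f) ν₁ θ).bind fun θ₁ =>
      (repeatLaw (mgmcLaw A Mpre Mpost I ν₁ ν₂ γ ℓ (app (I ℓ)ᵀ (f - app (A (ℓ + 1)) θ₁)))
          (γ (ℓ + 1)) 0).bind fun ψ =>
        repeatLaw (smootherLaw (A (ℓ + 1)) (Mpost (ℓ + 1)) f) ν₂ (θ₁ + app (I ℓ) ψ)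

/-- The MGMC update for the posterior on level `L`, as a V-cycle (one recursive call per level)
with `ν / 2` pre- and `ν / 2` post-smoothing steps, both with the splitting matrices `M`. -/
def Hierarchy.vCycle {H : Type*} [NormedAddCommGroup H] [InnerProductSpace ℝ H] {β : ℕ}
    {𝔓 : BayesProblem H β} (𝔥 : Hierarchy 𝔓)
    (M : (ℓ : ℕ) → Matrix (Fin (𝔥.n ℓ)) (Fin (𝔥.n ℓ)) ℝ) (ν L : ℕ) (θ : E (𝔥.n L)) :
    Measure (E (𝔥.n L)) :=
  mgmcLaw 𝔥.post M M 𝔥.prolong (ν / 2) (ν / 2) (fun _ => 1) L (𝔥.f L) θ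

/-- `X 0, X 1, …` is a Markov chain with transition law `T`: given the past `X 0, …, X m`, the
state `X (m + 1)` has law `T (X m)`. -/
structure IsMarkovChain {S Ω : Type*} [MeasurableSpace S] [MeasurableSpace Ω]
    (T : S → Measure S) (P : Measure Ω) (X : ℕ → Ω → S) : Prop where
  measurable : ∀ m, Measurable (X m)
  transition : ∀ m : ℕ,
    P.map (fun ω => ((fun i : Fin (m + 1) => X i ω), X (m + 1) ω)) =
      (P.map fun ω => fun i : Fin (m + 1) => X i ω).bind
        fun h => (T (h (Fin.last m))).map fun x => (h, x)

/-- The covariance matrix of a random vector. -/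
def covMat {n : ℕ} {Ω : Type*} [MeasurableSpace Ω] (P : Measure Ω) (X : Ω → E n) :
    Matrix (Fin n) (Fin n) ℝ :=
  Matrix.of fun i j => cov[fun ω => X ω i, fun ω => X ω j; P]

/-- The lag-`s` autocorrelation of a scalar process at time `m`. -/
def autocorr {Ω : Type*} [MeasurableSpace Ω] (P : Measure Ω) (Z : ℕ → Ω → ℝ) (m s : ℕ) : ℝ :=
  cov[Z (m + s), Z m; P] / cov[Z m, Z m; P]

/-- The integrated autocorrelation time `1 + 2 ∑_{s ≥ 1} autocorr m s` at time `m`. -/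
def iact {Ω : Type*} [MeasurableSpace Ω] (P : Measure Ω) (Z : ℕ → Ω → ℝ) (m : ℕ) : ℝ :=
  1 + 2 * ∑' s : ℕ, autocorr P Z m (s + 1)

/-! ### Cost model: straight-line randomised programs on a real-number machine -/

/-- The elementary instructions. The first argument is the memory cell that is overwritten. -/
inductive Instr where
  /-- load a constant, fixed before the simulation starts -/
  | const (d : ℕ) (c : ℝ)
  | add (d i j : ℕ)
  | sub (d i j : ℕ)
  | mul (d i j : ℕ)
  | div (d i j : ℕ)
  /-- draw an independent standard normal number -/
  | normal (d : ℕ)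

/-- The law of the memory after one instruction. -/
def Instr.run : Instr → (ℕ → ℝ) → Measure (ℕ → ℝ)
  | .const d c, w => Measure.dirac (Function.update w d c)
  | .add d i j, w => Measure.dirac (Function.update w d (w i + w j))
  | .sub d i j, w => Measure.dirac (Function.update w d (w i - w j))
  | .mul d i j, w => Measure.dirac (Function.update w d (w i * w j))
  | .div d i j, w => Measure.dirac (Function.update w d (w i / w j))
  | .normal d, w => (gaussianReal 0 1).map fun z => Function.update w d z

/-- The law of the memory after a program has been executed. The cost of a program is its length,
the number of executed instructions. -/
def runProgram : List Instr → (ℕ → ℝ) → Measure (ℕ → ℝ)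
  | [], w => Measure.dirac w
  | c :: p, w => (c.run w).bind (runProgram p)

/-- The vector stored in the first `n` memory cells. -/
def readVec (n : ℕ) (w : ℕ → ℝ) : E n := WithLp.toLp 2 fun j => w j

/-- The program `p` carries out the random update `T` on the vector in the first `n` memory cells,
whatever the other cells contain. -/
def Implements {n : ℕ} (p : List Instr) (T : E n → Measure (E n)) : Prop :=
  ∀ w : ℕ → ℝ, (runProgram p w).map (readVec n) = T (readVec n w)

end MGMC

end

open MGMC

/-! Every ingredient of the cycle is a Gaussian correction `θ ↦ θ + T (f - A θ) + ξ` with `ξ ∼ 𝒩(0,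
covT A T)`, where `T` is an approximate inverse of `A` and the noise covariance is exactly the one
that leaves `𝒩(A⁻¹ f, A⁻¹)` invariant. Such corrections are closed under composition and, thanks to
the Galerkin identity `Jᵀ A J = A'`, under prolongation from a coarser level. Hence a whole V-cycle
is one correction with matrix `vCycleT` (`mgmcLaw_eq_corrLaw`), and the random algorithm is governed
by the iteration matrix `1 - T A` of deterministic multigrid.

The classical V-cycle argument, carried out with the Loewner order, gives `0 ≤ A⁻¹ - T ≤ ρ A⁻¹` on
every level with the same `ρ = C_A / (C_A + ν)` (`cycleT_contraction`). Smoothing supplies `Xᵏ (A⁻¹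
+ 2k M⁻¹) (Xᵏ)ᵀ ≤ A⁻¹` for `X = 1 - M⁻¹ A`, the approximation property bounds the part of `A⁻¹`
missed by the coarse space by `C_A M⁻¹`, and `ρ` balances the two. It follows that `(1 - T A)ᵀ`
contracts the dual energy `uᵀ A⁻¹ u` by `ρ²` (`contraction_of_le`).

For a linear functional `u` of the chain, the error of the mean, the error of the variance and the
lagged covariances at time `m` are those of earlier times with `u` replaced by an iterate of `(1 - T
A)ᵀ` (`chain_mean`, `chain_var`, `chain_cov`). Contraction therefore gives exponential convergence
and geometric decay of autocorrelations. Uniformity in the level comes from `F_energy_le`: a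
functional bounded on `H` has dual energy bounded independently of the discretisation.

For the cost, computations are modelled by sets of reachable functions of the input (`Reach`), and a
correction is sampled as `T r + Q z` with `Q Qᵀ = covT A T` (`Sampler`). The Gibbs smoother needs
only sparse triangular solves, low-rank updates and `O(n_ℓ)` normals; the costs of the levels sum
geometrically, and `Sampler.exists_program` compiles the result to machine instructions. -/

set_option linter.unusedSectionVars false

namespace MGMC

/-! ### Algebra of Gaussian corrections and the V-cycle contraction in the Loewner order. -/

section LinearAlgebra

variable {n m : Type*} [Fintype n] [Fintype m] [DecidableEq n] [DecidableEq m]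

lemma PosSemidef.conj_transpose {P : Matrix n n ℝ} (hP : P.PosSemidef) (N : Matrix m n ℝ) :
    (N * P * Nᵀ).PosSemidef := by
  simpa [conjTranspose_eq_transpose_of_trivial] using hP.mul_mul_conjTranspose_same N

lemma PosSemidef.transpose_conj {P : Matrix n n ℝ} (hP : P.PosSemidef) (N : Matrix n m ℝ) :
    (Nᵀ * P * N).PosSemidef := by
  simpa using PosSemidef.conj_transpose hP Nᵀ

lemma PosSemidef.transpose_eq {P : Matrix n n ℝ} (hP : P.PosSemidef) : Pᵀ = P := by
  simpa [conjTranspose_eq_transpose_of_trivial] using hP.isHermitian.eq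

lemma PosDef.transpose_eq {P : Matrix n n ℝ} (hP : P.PosDef) : Pᵀ = P :=
  PosSemidef.transpose_eq hP.posSemidef

lemma PosDef.mul_inv {P : Matrix n n ℝ} (hP : P.PosDef) : P * P⁻¹ = 1 :=
  Matrix.mul_nonsing_inv _ ((Matrix.isUnit_iff_isUnit_det _).1 hP.isUnit)

lemma PosDef.inv_mul {P : Matrix n n ℝ} (hP : P.PosDef) : P⁻¹ * P = 1 :=
  Matrix.nonsing_inv_mul _ ((Matrix.isUnit_iff_isUnit_det _).1 hP.isUnit)

/-- If `0 ≤ A ≤ M` with `M` invertible, then `A M⁻¹ A ≤ A`. -/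
lemma posSemidef_sub_mul_inv_mul {A M : Matrix n n ℝ} (hA : A.PosSemidef) (hM : M.PosDef)
    (h : (M - A).PosSemidef) : (A - A * M⁻¹ * A).PosSemidef := by
  have hA' := PosSemidef.transpose_eq hA
  have hM' : (M⁻¹)ᵀ = M⁻¹ := PosDef.transpose_eq hM.inv
  -- Splitting into congruences of `A` and of `M - A` avoids matrix square roots.
  have e : A - A * M⁻¹ * A = (1 - M⁻¹ * A)ᵀ * A * (1 - M⁻¹ * A) +
      (M⁻¹ * A)ᵀ * (M - A) * (M⁻¹ * A) := by
    have h1 : A * M⁻¹ * M * M⁻¹ * A = A * M⁻¹ * A := by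
      rw [Matrix.mul_assoc A, PosDef.inv_mul hM, Matrix.mul_one]
    simp only [transpose_sub, transpose_one, transpose_mul, hA', hM']
    have h2 : A * M⁻¹ * (M - A) * (M⁻¹ * A) = A * M⁻¹ * A - A * M⁻¹ * A * (M⁻¹ * A) := by
      rw [Matrix.mul_sub, Matrix.sub_mul, ← Matrix.mul_assoc, h1]
    rw [h2]
    noncomm_ring
  rw [e]
  exact (PosSemidef.transpose_conj hA _).add (PosSemidef.transpose_conj h _)

/-- The approximate inverse of two successive corrections: first `T₁`, then `T₂`. -/
def compT (A T₁ T₂ : Matrix n n ℝ) : Matrix n n ℝ := T₁ + T₂ - T₂ * A * T₁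

/-- The noise covariance which makes the correction `θ ↦ θ + T (f - A θ)` preserve
`𝒩(A⁻¹ f, A⁻¹)`. -/
def covT (A T : Matrix n n ℝ) : Matrix n n ℝ := T + Tᵀ - T * A * Tᵀ

/-- The approximate inverse of `k` successive corrections by `T`. -/
def repT (A T : Matrix n n ℝ) : ℕ → Matrix n n ℝ
  | 0 => 0
  | k + 1 => compT A T (repT A T k)

/-- This identity is what dictates the definition of `compT`: error propagators multiply, the later
correction standing on the left. -/
lemma one_sub_compT_mul (A T₁ T₂ : Matrix n n ℝ) :
    1 - compT A T₁ T₂ * A = (1 - T₂ * A) * (1 - T₁ * A) := by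
  unfold compT; noncomm_ring

lemma one_sub_repT_mul (A T : Matrix n n ℝ) (k : ℕ) :
    1 - repT A T k * A = (1 - T * A) ^ k := by
  induction k with
  | zero => simp [repT]
  | succ k ih => rw [repT, one_sub_compT_mul, ih, pow_succ]

/-- The noise of the first correction is transported by the second propagator and the independent
second noise is added; invariance of `𝒩(A⁻¹ f, A⁻¹)` is preserved automatically. -/
lemma covT_compT {A : Matrix n n ℝ} (hA : Aᵀ = A) (T₁ T₂ : Matrix n n ℝ) :
    covT A (compT A T₁ T₂) = (1 - T₂ * A) * covT A T₁ * (1 - T₂ * A)ᵀ + covT A T₂ := by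
  simp only [covT, compT, transpose_sub, transpose_add, transpose_mul, transpose_one, hA]
  noncomm_ring

/-- Because of the Galerkin identity, prolonging a sample of the coarse correction produces exactly
the noise that the fine level requires. -/
lemma covT_coarse {A : Matrix n n ℝ} {A' : Matrix m m ℝ} {J : Matrix n m ℝ}
    (h : Jᵀ * A * J = A') (T : Matrix m m ℝ) :
    covT A (J * T * Jᵀ) = J * covT A' T * Jᵀ := by
  subst h
  simp only [covT, transpose_mul, transpose_transpose]
  simp only [Matrix.mul_add, Matrix.add_mul, Matrix.mul_sub, Matrix.sub_mul, Matrix.mul_assoc]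

lemma covT_posSemidef_compT {A T₁ T₂ : Matrix n n ℝ} (hA : Aᵀ = A)
    (h₁ : (covT A T₁).PosSemidef) (h₂ : (covT A T₂).PosSemidef) :
    (covT A (compT A T₁ T₂)).PosSemidef := by
  rw [covT_compT hA]
  exact (PosSemidef.conj_transpose h₁ _).add h₂

lemma covT_posSemidef_repT {A T : Matrix n n ℝ} (hA : Aᵀ = A)
    (h : (covT A T).PosSemidef) (k : ℕ) : (covT A (repT A T k)).PosSemidef := by
  induction k with
  | zero => simpa [repT, covT] using Matrix.PosSemidef.zero
  | succ k ih => exact covT_posSemidef_compT hA h ih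

/-- Exact sampling on the coarsest level is thus the correction with `T = A⁻¹`, the base case of all
recursions over levels. -/
lemma covT_inv {A : Matrix n n ℝ} (hA : A.PosDef) : covT A A⁻¹ = A⁻¹ := by
  rw [covT, PosDef.transpose_eq hA.inv, PosDef.inv_mul hA, Matrix.one_mul, add_sub_cancel_right]

lemma PosDef.of_sub_posSemidef {A M : Matrix n n ℝ} (hA : A.PosDef) (h : (M - A).PosSemidef) :
    M.PosDef := by
  simpa using hA.add_posSemidef h

lemma covT_smoother {A M : Matrix n n ℝ} (hM : M.PosDef) :
    covT A M⁻¹ = M⁻¹ * (M + Mᵀ - A) * (M⁻¹)ᵀ := by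
  have h := PosDef.transpose_eq hM
  have h' := PosDef.transpose_eq hM.inv
  rw [covT, h, h', Matrix.mul_sub, Matrix.mul_add, PosDef.inv_mul hM, Matrix.sub_mul,
    Matrix.add_mul, Matrix.one_mul]

lemma posSemidef_two_smul_sub {A M : Matrix n n ℝ} (hA : A.PosDef) (h : (M - A).PosSemidef) :
    (M + Mᵀ - A).PosSemidef := by
  have hM := PosDef.of_sub_posSemidef hA h
  rw [PosDef.transpose_eq hM, add_sub_assoc]
  exact hM.posSemidef.add h

lemma covT_smoother_posSemidef {A M : Matrix n n ℝ} (hA : A.PosDef) (h : (M - A).PosSemidef) :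
    (covT A M⁻¹).PosSemidef := by
  rw [covT_smoother (PosDef.of_sub_posSemidef hA h)]
  exact PosSemidef.conj_transpose (posSemidef_two_smul_sub hA h) _

/-- The smoothing bound `(1 - M⁻¹A)ᵏ (A⁻¹ + 2k M⁻¹) ((1 - M⁻¹A)ᵏ)ᵀ ≤ A⁻¹`. -/
lemma smoothing_bound {A M : Matrix n n ℝ} (hA : A.PosDef) (h : (M - A).PosSemidef) (k : ℕ) :
    (A⁻¹ - (1 - M⁻¹ * A) ^ k * (A⁻¹ + (2 * k : ℝ) • M⁻¹) * ((1 - M⁻¹ * A) ^ k)ᵀ).PosSemidef := by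
  have hM := PosDef.of_sub_posSemidef hA h
  have hA' := PosDef.transpose_eq hA
  have hM' : (M⁻¹)ᵀ = M⁻¹ := PosDef.transpose_eq hM.inv
  induction k with
  | zero => simpa using Matrix.PosSemidef.zero
  | succ k ih =>
    set N := (1 - M⁻¹ * A) ^ k with hN
    set X := 1 - M⁻¹ * A with hX
    -- The scalar model is `(1 - x)² (1 + 2 (k + 1) x) ≤ 1 + 2 k x` for `0 ≤ x ≤ 1`. The remainder
    -- is written as a sum of two terms, both nonnegative since `A M⁻¹ A ≤ A`.
    have key : (A⁻¹ + (2 * k : ℝ) • M⁻¹) - X * (A⁻¹ + (2 * (k + 1 : ℕ) : ℝ) • M⁻¹) * Xᵀ =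
        (2 * k + 1 : ℝ) • (M⁻¹ * A * (M⁻¹)ᵀ) +
          (2 * k + 2 : ℝ) • (M⁻¹ * (A - A * M⁻¹ * A) * (M⁻¹)ᵀ) := by
      have e1 : X * A⁻¹ = A⁻¹ - M⁻¹ := by
        rw [hX, Matrix.sub_mul, Matrix.mul_assoc, PosDef.mul_inv hA]; simp
      have e2 : Xᵀ = 1 - A * M⁻¹ := by
        rw [hX, transpose_sub, transpose_mul, hA', hM', transpose_one]
      have e3 : A⁻¹ * (A * M⁻¹) = M⁻¹ := by
        rw [← Matrix.mul_assoc, PosDef.inv_mul hA, Matrix.one_mul]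
      rw [Matrix.mul_add, e1, e2, hM', hX]
      push_cast
      simp only [Matrix.mul_smul, Matrix.smul_mul, Matrix.mul_sub, Matrix.sub_mul, Matrix.add_mul,
        Matrix.one_mul, Matrix.mul_one, Matrix.mul_assoc, e3]
      module
    have e : A⁻¹ - X ^ (k + 1) * (A⁻¹ + (2 * (k + 1 : ℕ) : ℝ) • M⁻¹) * (X ^ (k + 1))ᵀ =
        (A⁻¹ - N * (A⁻¹ + (2 * k : ℝ) • M⁻¹) * Nᵀ) +
          N * ((A⁻¹ + (2 * k : ℝ) • M⁻¹) - X * (A⁻¹ + (2 * (k + 1 : ℕ) : ℝ) • M⁻¹) * Xᵀ) * Nᵀ := by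
      rw [pow_succ, transpose_mul, ← hN]
      noncomm_ring
    rw [e, key]
    refine ih.add (PosSemidef.conj_transpose (.add (.smul ?_ (by positivity))
      (.smul ?_ (by positivity))) _)
    · exact PosSemidef.conj_transpose hA.posSemidef _
    · exact PosSemidef.conj_transpose (posSemidef_sub_mul_inv_mul hA.posSemidef hM h) _

/-- The approximate inverse of one two-grid cycle with `k` pre- and `k` post-smoothing steps. -/
noncomputable def cycleT (A M : Matrix n n ℝ) (J : Matrix n m ℝ) (T : Matrix m m ℝ) (k : ℕ) :
    Matrix n n ℝ :=
  compT A (compT A (repT A M⁻¹ k) (J * T * Jᵀ)) (repT A M⁻¹ k)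

/-- The error propagator is `Xᵏ (1 - J T Jᵀ A) Xᵏ` with `X = 1 - M⁻¹ A`. Multiplying by `A⁻¹` and
moving it to the left through the pre-smoother by `Xᵏ A⁻¹ = A⁻¹ (Xᵏ)ᵀ` turns the cycle into a
congruence; equal numbers of pre- and post-smoothing steps and a symmetric `M` are essential. The
inner term separates the coarse-space defect from the error of the inexact coarse solve. -/
lemma inv_sub_cycleT {A M : Matrix n n ℝ} {A' : Matrix m m ℝ} {J : Matrix n m ℝ}
    (hA : A.PosDef) (h : (M - A).PosSemidef) (T : Matrix m m ℝ) (k : ℕ) :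
    A⁻¹ - cycleT A M J T k = (1 - M⁻¹ * A) ^ k *
      ((A⁻¹ - J * A'⁻¹ * Jᵀ) + J * (A'⁻¹ - T) * Jᵀ) * ((1 - M⁻¹ * A) ^ k)ᵀ := by
  have hM := PosDef.of_sub_posSemidef hA h
  have hA' := PosDef.transpose_eq hA
  have hM' : (M⁻¹)ᵀ = M⁻¹ := PosDef.transpose_eq hM.inv
  have e0 : A⁻¹ - cycleT A M J T k = (1 - cycleT A M J T k * A) * A⁻¹ := by
    rw [Matrix.sub_mul, Matrix.mul_assoc, PosDef.mul_inv hA, Matrix.one_mul, Matrix.mul_one]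
  have e1 : ∀ j : ℕ, (1 - M⁻¹ * A) ^ j * A⁻¹ = A⁻¹ * ((1 - M⁻¹ * A) ^ j)ᵀ := by
    intro j
    induction j with
    | zero => simp
    | succ j ih =>
      have : (1 - M⁻¹ * A) * A⁻¹ = A⁻¹ * (1 - M⁻¹ * A)ᵀ := by
        rw [transpose_sub, transpose_mul, hA', hM', Matrix.sub_mul, Matrix.mul_sub,
          Matrix.mul_assoc, PosDef.mul_inv hA, ← Matrix.mul_assoc, PosDef.inv_mul hA]
        simp
      rw [pow_succ', Matrix.mul_assoc, ih, ← Matrix.mul_assoc, this, Matrix.mul_assoc,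
        ← transpose_mul, ← pow_succ, ← pow_succ']
  rw [e0, cycleT, one_sub_compT_mul, one_sub_compT_mul, one_sub_repT_mul, Matrix.mul_assoc,
    Matrix.mul_assoc, e1, Matrix.mul_assoc _ (A⁻¹ - _ + _)]
  congr 1
  rw [← Matrix.mul_assoc]
  congr 1
  rw [Matrix.sub_mul, Matrix.mul_assoc _ A, PosDef.mul_inv hA, Matrix.mul_one, Matrix.one_mul,
    Matrix.mul_sub, Matrix.sub_mul]
  abel

lemma covT_cycleT_posSemidef {A M : Matrix n n ℝ} {A' : Matrix m m ℝ} {J : Matrix n m ℝ}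
    (hA : A.PosDef) (hJ : Jᵀ * A * J = A') (h : (M - A).PosSemidef) {T : Matrix m m ℝ}
    (hT : (covT A' T).PosSemidef) (k : ℕ) : (covT A (cycleT A M J T k)).PosSemidef := by
  have hA' := PosDef.transpose_eq hA
  have hr := covT_posSemidef_repT hA' (covT_smoother_posSemidef hA h) k
  refine covT_posSemidef_compT hA' (covT_posSemidef_compT hA' hr ?_) hr
  rw [covT_coarse hJ]
  exact PosSemidef.conj_transpose hT _

/-- One step of the V-cycle convergence proof. -/
lemma cycleT_contraction {A M : Matrix n n ℝ} {A' : Matrix m m ℝ} {J : Matrix n m ℝ}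
    (hA : A.PosDef) (hA' : A'.PosDef) (hJ : Jᵀ * A * J = A') (h : (M - A).PosSemidef)
    {C ρ : ℝ} {k : ℕ} (hρ : (1 - ρ) * C = ρ * (2 * k)) (hρ1 : ρ ≤ 1) (hρ0 : 0 ≤ ρ)
    (happ : (C • M⁻¹ - (A⁻¹ - J * A'⁻¹ * Jᵀ)).PosSemidef) {T : Matrix m m ℝ}
    (h0 : (A'⁻¹ - T).PosSemidef) (h1 : (ρ • A'⁻¹ - (A'⁻¹ - T)).PosSemidef) :
    (A⁻¹ - cycleT A M J T k).PosSemidef ∧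
      (ρ • A⁻¹ - (A⁻¹ - cycleT A M J T k)).PosSemidef := by
  have hM := PosDef.of_sub_posSemidef hA h
  have hAt := PosDef.transpose_eq hA
  have hA't : (A'⁻¹)ᵀ = A'⁻¹ := PosDef.transpose_eq hA'.inv
  -- By the Galerkin identity `J A'⁻¹ Jᵀ A` is the `A`-orthogonal projection onto the range of `J`,
  -- so the defect is `A⁻¹` compressed by the complementary projection.
  have hP : (A⁻¹ - J * A'⁻¹ * Jᵀ).PosSemidef := by
    have e : A⁻¹ - J * A'⁻¹ * Jᵀ =
        (1 - J * A'⁻¹ * Jᵀ * A) * A⁻¹ * (1 - J * A'⁻¹ * Jᵀ * A)ᵀ := by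
      have e1 : (1 - J * A'⁻¹ * Jᵀ * A) * A⁻¹ = A⁻¹ - J * A'⁻¹ * Jᵀ := by
        rw [Matrix.sub_mul, Matrix.mul_assoc _ A, PosDef.mul_inv hA, Matrix.mul_one,
          Matrix.one_mul]
      have e2 : (1 - J * A'⁻¹ * Jᵀ * A)ᵀ = 1 - A * (J * A'⁻¹ * Jᵀ) := by
        simp only [transpose_sub, transpose_one, transpose_mul, hAt, hA't, transpose_transpose,
          Matrix.mul_assoc]
      have e3 : J * A'⁻¹ * Jᵀ * (A * (J * A'⁻¹ * Jᵀ)) = J * A'⁻¹ * Jᵀ := by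
        calc _ = J * (A'⁻¹ * (Jᵀ * A * J)) * A'⁻¹ * Jᵀ := by simp only [Matrix.mul_assoc]
          _ = _ := by rw [hJ, PosDef.inv_mul hA', Matrix.mul_one]
      have e4 : A⁻¹ * (A * (J * A'⁻¹ * Jᵀ)) = J * A'⁻¹ * Jᵀ := by
        rw [← Matrix.mul_assoc, PosDef.inv_mul hA, Matrix.one_mul]
      rw [e1, e2, Matrix.mul_sub, Matrix.mul_one, Matrix.sub_mul, e3, e4, sub_self, sub_zero]
    rw [e]
    exact PosSemidef.conj_transpose hA.inv.posSemidef _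
  rw [inv_sub_cycleT (A' := A') hA h]
  constructor
  · exact PosSemidef.conj_transpose (hP.add (PosSemidef.conj_transpose h0 _)) _
  · set N := (1 - M⁻¹ * A) ^ k
    set P := A⁻¹ - J * A'⁻¹ * Jᵀ with hPdef
    -- The relation `hρ` trades `ρ · 2k M⁻¹` for `(1 - ρ) C M⁻¹`, which pays for `(1 - ρ) P`. The
    -- remaining `ρ P` combines with `ρ J A'⁻¹ Jᵀ` to `ρ A⁻¹`, and the coarse hypothesis does the
    -- rest.
    have hmid : (ρ • (A⁻¹ + (2 * k : ℝ) • M⁻¹) - (P + J * (A'⁻¹ - T) * Jᵀ)).PosSemidef := by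
      have e : ρ • (A⁻¹ + (2 * k : ℝ) • M⁻¹) - (P + J * (A'⁻¹ - T) * Jᵀ) =
          (1 - ρ) • (C • M⁻¹ - P) + J * (ρ • A'⁻¹ - (A'⁻¹ - T)) * Jᵀ := by
        have : J * (ρ • A'⁻¹ - (A'⁻¹ - T)) * Jᵀ =
            ρ • (A⁻¹ - P) - J * (A'⁻¹ - T) * Jᵀ := by
          rw [hPdef, Matrix.mul_sub, Matrix.sub_mul, sub_sub_cancel, Matrix.mul_smul,
            Matrix.smul_mul]
        rw [this, smul_sub (1 - ρ), smul_smul, hρ, smul_add, smul_smul]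
        module
      rw [e]
      exact (happ.smul (by linarith)).add (PosSemidef.conj_transpose h1 _)
    have e : ρ • A⁻¹ - N * (P + J * (A'⁻¹ - T) * Jᵀ) * Nᵀ =
        ρ • (A⁻¹ - N * (A⁻¹ + (2 * k : ℝ) • M⁻¹) * Nᵀ) +
          N * (ρ • (A⁻¹ + (2 * k : ℝ) • M⁻¹) - (P + J * (A'⁻¹ - T) * Jᵀ)) * Nᵀ := by
      rw [Matrix.mul_sub N (ρ • _), Matrix.sub_mul, Matrix.mul_smul, Matrix.smul_mul, smul_sub]
      abel
    rw [e]
    exact ((smoothing_bound hA h k).smul hρ0).add (PosSemidef.conj_transpose hmid _)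

lemma inv_smul_of_ne_zero {A : Matrix n n ℝ} (hA : A.PosDef) {ρ : ℝ} (hρ : ρ ≠ 0) :
    (ρ • A⁻¹)⁻¹ = ρ⁻¹ • A := by
  refine Matrix.inv_eq_right_inv ?_
  rw [Matrix.smul_mul, Matrix.mul_smul, smul_smul, mul_inv_cancel₀ hρ, one_smul,
    PosDef.inv_mul hA]

/-- `0 ≤ A⁻¹ - T ≤ ρ A⁻¹` implies that the transposed iteration matrix contracts the
`A⁻¹`-norm by the factor `ρ`. -/
lemma contraction_of_le {A T : Matrix n n ℝ} (hA : A.PosDef) {ρ : ℝ} (hρ : 0 < ρ)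
    (h0 : (A⁻¹ - T).PosSemidef) (h1 : (ρ • A⁻¹ - (A⁻¹ - T)).PosSemidef) (u : n → ℝ) :
    ((1 - T * A)ᵀ *ᵥ u) ⬝ᵥ (A⁻¹ *ᵥ ((1 - T * A)ᵀ *ᵥ u)) ≤ ρ ^ 2 * (u ⬝ᵥ (A⁻¹ *ᵥ u)) := by
  set R := A⁻¹ - T with hR
  have hS : 1 - T * A = R * A := by rw [hR, Matrix.sub_mul, PosDef.inv_mul hA]
  have hRt := PosSemidef.transpose_eq h0
  have hAt := PosDef.transpose_eq hA
  have h2 := posSemidef_sub_mul_inv_mul h0 (hA.inv.smul hρ) h1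
  rw [inv_smul_of_ne_zero hA hρ.ne'] at h2
  -- The chain `R A R ≤ ρ R ≤ ρ² A⁻¹`; its first inequality is `posSemidef_sub_mul_inv_mul` for `R ≤
  -- ρ A⁻¹`.
  have h3 : (ρ ^ 2 • A⁻¹ - R * A * R).PosSemidef := by
    have : ρ ^ 2 • A⁻¹ - R * A * R = ρ • (ρ • A⁻¹ - R) + ρ • (R - R * ρ⁻¹ • A * R) := by
      rw [smul_sub ρ R, Matrix.mul_smul, Matrix.smul_mul, smul_smul ρ ρ⁻¹, mul_inv_cancel₀ hρ.ne',
        smul_sub, smul_smul, pow_two, one_smul]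
      abel
    rw [this]
    exact (h1.smul hρ.le).add (h2.smul hρ.le)
  have h4 := h3.dotProduct_mulVec_nonneg u
  have h5 : ((1 - T * A)ᵀ *ᵥ u) ⬝ᵥ (A⁻¹ *ᵥ ((1 - T * A)ᵀ *ᵥ u)) = u ⬝ᵥ ((R * A * R) *ᵥ u) := by
    rw [hS, transpose_mul, hRt, hAt, mulVec_mulVec, ← Matrix.mul_assoc, PosDef.inv_mul hA,
      Matrix.one_mul, dotProduct_comm, ← mulVec_mulVec, ← mulVec_mulVec, ← mulVec_mulVec,
      dotProduct_mulVec u R, ← mulVec_transpose, hRt, dotProduct_comm]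
  rw [h5]
  simpa [sub_mulVec, smul_mulVec, dotProduct_sub] using h4

end LinearAlgebra

/-- The approximate inverse on level `ℓ` that corresponds to one V-cycle with `k` pre- and `k`
post-smoothing steps. -/
noncomputable def vCycleT {n : ℕ → ℕ} (A M : (ℓ : ℕ) → Matrix (Fin (n ℓ)) (Fin (n ℓ)) ℝ)
    (J : (ℓ : ℕ) → Matrix (Fin (n (ℓ + 1))) (Fin (n ℓ)) ℝ) (k : ℕ) :
    (ℓ : ℕ) → Matrix (Fin (n ℓ)) (Fin (n ℓ)) ℝ
  | 0 => (A 0)⁻¹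
  | ℓ + 1 => cycleT (A (ℓ + 1)) (M (ℓ + 1)) (J ℓ) (vCycleT A M J k ℓ) k

lemma covT_vCycleT_posSemidef {n : ℕ → ℕ} {A M : (ℓ : ℕ) → Matrix (Fin (n ℓ)) (Fin (n ℓ)) ℝ}
    {J : (ℓ : ℕ) → Matrix (Fin (n (ℓ + 1))) (Fin (n ℓ)) ℝ} (hA : ∀ ℓ, (A ℓ).PosDef)
    (hJ : ∀ ℓ, (J ℓ)ᵀ * A (ℓ + 1) * J ℓ = A ℓ)
    (h : ∀ ℓ, (M (ℓ + 1) - A (ℓ + 1)).PosSemidef) (k ℓ : ℕ) :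
    (covT (A ℓ) (vCycleT A M J k ℓ)).PosSemidef := by
  induction ℓ with
  | zero => rw [vCycleT, covT_inv (hA 0)]; exact (hA 0).inv.posSemidef
  | succ ℓ ih => exact covT_cycleT_posSemidef (hA _) (hJ ℓ) (h ℓ) ih k

/-- The coarsest solve is exact, and each further level reproduces the same `ρ`, so the rate does
not deteriorate with the number of levels. -/
lemma vCycleT_contraction {n : ℕ → ℕ} {A M : (ℓ : ℕ) → Matrix (Fin (n ℓ)) (Fin (n ℓ)) ℝ}
    {J : (ℓ : ℕ) → Matrix (Fin (n (ℓ + 1))) (Fin (n ℓ)) ℝ} (hA : ∀ ℓ, (A ℓ).PosDef)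
    (hJ : ∀ ℓ, (J ℓ)ᵀ * A (ℓ + 1) * J ℓ = A ℓ)
    (h : ∀ ℓ, (M (ℓ + 1) - A (ℓ + 1)).PosSemidef)
    {C ρ : ℝ} {k : ℕ} (hρ : (1 - ρ) * C = ρ * (2 * k)) (hρ1 : ρ ≤ 1) (hρ0 : 0 ≤ ρ)
    (happ : ∀ ℓ, (C • (M (ℓ + 1))⁻¹ -
      ((A (ℓ + 1))⁻¹ - J ℓ * (A ℓ)⁻¹ * (J ℓ)ᵀ)).PosSemidef) (ℓ : ℕ) :
    ((A ℓ)⁻¹ - vCycleT A M J k ℓ).PosSemidef ∧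
      (ρ • (A ℓ)⁻¹ - ((A ℓ)⁻¹ - vCycleT A M J k ℓ)).PosSemidef := by
  induction ℓ with
  | zero =>
    simp only [vCycleT, sub_self, sub_zero]
    exact ⟨.zero, (hA 0).inv.posSemidef.smul hρ0⟩
  | succ ℓ ih =>
    exact cycleT_contraction (hA _) (hA _) (hJ ℓ) (h ℓ) hρ hρ1 hρ0 (happ ℓ) ih.1 ih.2

/-! ### From the operator-norm approximation property to a matrix inequality. -/

section Approximation

variable {n : Type*} [Fintype n] [DecidableEq n]

lemma dotProduct_mulVec_le_l2_opNorm (X : Matrix n n ℝ) (x : n → ℝ) :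
    x ⬝ᵥ (X *ᵥ x) ≤ ‖X‖ * (x ⬝ᵥ x) := by
  have h1 := inner_toEuclideanCLM X (WithLp.toLp 2 x) (WithLp.toLp 2 x)
  have h2 : x ⬝ᵥ x = ‖WithLp.toLp 2 x‖ ^ 2 := by
    rw [EuclideanSpace.real_norm_sq_eq]
    simp [dotProduct, pow_two]
  rw [h2]
  calc x ⬝ᵥ (X *ᵥ x) = ⟪WithLp.toLp 2 x, toEuclideanCLM (𝕜 := ℝ) X (WithLp.toLp 2 x)⟫ := h1.symm
    _ ≤ ‖WithLp.toLp 2 x‖ * ‖toEuclideanCLM (𝕜 := ℝ) X (WithLp.toLp 2 x)‖ := real_inner_le_norm _ _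
    _ ≤ ‖WithLp.toLp 2 x‖ * (‖X‖ * ‖WithLp.toLp 2 x‖) := by
      gcongr
      rw [← Matrix.l2_opNorm_toEuclideanCLM]
      exact ContinuousLinearMap.le_opNorm _ _
    _ = ‖X‖ * ‖WithLp.toLp 2 x‖ ^ 2 := by ring

/-- The approximation property in operator-norm form gives `P ≤ C M⁻¹`. -/
lemma posSemidef_of_norm_sqrt_conj_le {M P : Matrix n n ℝ} (hM : M.PosDef) (hP : Pᵀ = P) {C : ℝ}
    (h : ‖CFC.sqrt M * P * CFC.sqrt M‖ ≤ C) : (C • M⁻¹ - P).PosSemidef := by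
  set Q := CFC.sqrt M with hQ
  have hQQ : Q * Q = M := CFC.sqrt_mul_sqrt_self _ hM.posSemidef.nonneg
  have hQt : Qᵀ = Q := PosSemidef.transpose_eq
    (Matrix.nonneg_iff_posSemidef.1 (CFC.sqrt_nonneg M))
  have hunit : IsUnit Q.det := by
    have := (Matrix.isUnit_iff_isUnit_det _).1 hM.isUnit
    rw [← hQQ, Matrix.det_mul] at this
    exact isUnit_of_mul_isUnit_left this
  have h1 : (C • (1 : Matrix n n ℝ) - Q * P * Q).PosSemidef := by
    have hsa : IsSelfAdjoint (Q * P * Q) := by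
      rw [isSelfAdjoint_iff, star_eq_conjTranspose, conjTranspose_eq_transpose_of_trivial]
      simp only [transpose_mul, hQt, hP, Matrix.mul_assoc]
    refine Matrix.PosSemidef.of_dotProduct_mulVec_nonneg ?_ fun x => ?_
    · exact (Matrix.isHermitian_one.smul (IsSelfAdjoint.all C)).sub hsa
    · have h2 := dotProduct_mulVec_le_l2_opNorm (Q * P * Q) x
      have h3 : ‖Q * P * Q‖ * (x ⬝ᵥ x) ≤ C * (x ⬝ᵥ x) :=
        mul_le_mul_of_nonneg_right h (by simpa using dotProduct_star_self_nonneg x)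
      simp only [star_trivial, sub_mulVec, smul_mulVec, one_mulVec, dotProduct_sub,
        dotProduct_smul, smul_eq_mul]
      linarith
  have e : C • M⁻¹ - P = Q⁻¹ * (C • (1 : Matrix n n ℝ) - Q * P * Q) * (Q⁻¹)ᵀ := by
    rw [transpose_nonsing_inv, hQt, Matrix.mul_sub, Matrix.sub_mul, ← hQQ, Matrix.mul_inv_rev,
      Matrix.mul_smul, Matrix.smul_mul, Matrix.mul_one]
    congr 1
    rw [← Matrix.mul_assoc, ← Matrix.mul_assoc, Matrix.nonsing_inv_mul _ hunit, Matrix.one_mul,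
      Matrix.mul_assoc, Matrix.mul_nonsing_inv _ hunit, Matrix.mul_one]
  rw [e]
  exact PosSemidef.conj_transpose h1 _

end Approximation

end MGMC

namespace MGMC

/-! ### Laws of Gaussian corrections and identification of the V-cycle law. -/

section Laws

variable {a b n : ℕ}

@[simp]
lemma app_ofLp (A : Matrix (Fin a) (Fin b) ℝ) (x : E b) : (app A x).ofLp = A *ᵥ x.ofLp := rfl

lemma app_add (A : Matrix (Fin a) (Fin b) ℝ) (x y : E b) : app A (x + y) = app A x + app A y := by
  ext i; simp [mulVec_add]

lemma app_sub (A : Matrix (Fin a) (Fin b) ℝ) (x y : E b) : app A (x - y) = app A x - app A y := by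
  ext i; simp [mulVec_sub]

@[simp]
lemma app_zero (A : Matrix (Fin a) (Fin b) ℝ) : app A 0 = 0 := by
  ext i; simp

@[simp]
lemma zero_app (x : E b) : app (0 : Matrix (Fin a) (Fin b) ℝ) x = 0 := by
  ext i; simp

@[simp]
lemma one_app (x : E b) : app (1 : Matrix (Fin b) (Fin b) ℝ) x = x := by
  ext i; simp

lemma add_app (A B : Matrix (Fin a) (Fin b) ℝ) (x : E b) : app (A + B) x = app A x + app B x := by
  ext i; simp [add_mulVec]

lemma sub_app (A B : Matrix (Fin a) (Fin b) ℝ) (x : E b) : app (A - B) x = app A x - app B x := by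
  ext i; simp [sub_mulVec]

lemma mul_app (A : Matrix (Fin a) (Fin n) ℝ) (B : Matrix (Fin n) (Fin b) ℝ) (x : E b) :
    app (A * B) x = app A (app B x) := by
  ext i; simp [mulVec_mulVec]

/-- `app A` as a continuous linear map. -/
noncomputable def appL (A : Matrix (Fin a) (Fin b) ℝ) : E b →L[ℝ] E a :=
  LinearMap.toContinuousLinearMap
    { toFun := app A
      map_add' := app_add A
      map_smul' := fun c x => by ext i; simp [mulVec_smul] }

@[fun_prop]
lemma continuous_app (A : Matrix (Fin a) (Fin b) ℝ) : Continuous (app A) := (appL A).continuous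

@[fun_prop]
lemma measurable_app (A : Matrix (Fin a) (Fin b) ℝ) : Measurable (app A) :=
  (continuous_app A).measurable

lemma inner_eq_dotProduct (x y : E a) : ⟪x, y⟫ = x.ofLp ⬝ᵥ y.ofLp := by
  simp [PiLp.inner_apply, dotProduct, mul_comm]

lemma inner_app (A : Matrix (Fin a) (Fin b) ℝ) (x : E a) (y : E b) :
    ⟪x, app A y⟫ = ⟪app Aᵀ x, y⟫ := by
  simp [inner_eq_dotProduct, dotProduct_mulVec, mulVec_transpose]

lemma charFun_map_add_app (μ : Measure (E b)) [IsProbabilityMeasure μ]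
    (N : Matrix (Fin a) (Fin b) ℝ) (c t : E a) :
    charFun (μ.map fun x => c + app N x) t =
      Complex.exp (⟪t, c⟫ * Complex.I) * charFun μ (app Nᵀ t) := by
  rw [charFun_apply, charFun_apply, integral_map (by fun_prop) (by fun_prop),
    ← integral_const_mul]
  refine integral_congr_ae (.of_forall fun x => ?_)
  simp only
  rw [← Complex.exp_add, inner_add_left, real_inner_comm t (app N x), inner_app,
    real_inner_comm c t, real_inner_comm (app Nᵀ t) x]
  push_cast
  ring_nf

/-- Characteristic functions are used because the covariances may be singular and need not have
densities. -/
lemma multivariateGaussian_map_add_app {K : Matrix (Fin b) (Fin b) ℝ} (hK : K.PosSemidef)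
    (N : Matrix (Fin a) (Fin b) ℝ) (m : E b) (c : E a) :
    (multivariateGaussian m K).map (fun x => c + app N x) =
      multivariateGaussian (c + app N m) (N * K * Nᵀ) := by
  have : IsProbabilityMeasure ((multivariateGaussian m K).map (fun x => c + app N x)) :=
    Measure.isProbabilityMeasure_map (by fun_prop)
  refine Measure.ext_of_charFun (funext fun t => ?_)
  rw [charFun_map_add_app, charFun_multivariateGaussian hK,
    charFun_multivariateGaussian (PosSemidef.conj_transpose hK N), ← Complex.exp_add,
    inner_add_right, inner_app]
  have : (app Nᵀ t).ofLp ⬝ᵥ K *ᵥ (app Nᵀ t).ofLp = t.ofLp ⬝ᵥ (N * K * Nᵀ) *ᵥ t.ofLp := by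
    rw [app_ofLp, ← mulVec_mulVec, ← mulVec_mulVec, dotProduct_mulVec t.ofLp N, ← mulVec_transpose]
  rw [this]
  push_cast
  ring_nf

lemma multivariateGaussian_zero_cov (m : E a) : multivariateGaussian m 0 = Measure.dirac m := by
  simp [multivariateGaussian]

lemma multivariateGaussian_eq_map {K : Matrix (Fin a) (Fin a) ℝ} (hK : K.PosSemidef) (m : E a) :
    multivariateGaussian m K = (multivariateGaussian 0 K).map (fun x => m + x) := by
  have := multivariateGaussian_map_add_app hK 1 0 m
  simpa using this.symm

lemma measurable_map_prodMk {X Y Z : Type*} [MeasurableSpace X] [MeasurableSpace Y]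
    [MeasurableSpace Z] (ν : Measure Y) [SFinite ν] {g : X → Y → Z}
    (hg : Measurable (Function.uncurry g)) : Measurable fun x => ν.map (g x) := by
  refine Measure.measurable_of_measurable_coe _ fun s hs => ?_
  have : (fun x => (ν.map (g x)) s) = fun x => ν (Prod.mk x ⁻¹' (Function.uncurry g ⁻¹' s)) := by
    ext x
    have hgx : Measurable (g x) := hg.comp measurable_prodMk_left
    rw [Measure.map_apply hgx hs]
    rfl
  rw [this]
  exact measurable_measure_prodMk_left (hg hs)

lemma bind_map_eq_map_prod {X Y Z : Type*} [MeasurableSpace X] [MeasurableSpace Y]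
    [MeasurableSpace Z] (μ : Measure X) [SFinite μ] (ν : Measure Y) [SFinite ν] {g : X → Y → Z}
    (hg : Measurable (Function.uncurry g)) :
    μ.bind (fun x => ν.map (g x)) = (μ.prod ν).map (Function.uncurry g) := by
  have hk := measurable_map_prodMk ν hg
  ext s hs
  rw [Measure.bind_apply hs hk.aemeasurable, Measure.map_apply hg hs,
    Measure.prod_apply (hg hs)]
  refine lintegral_congr fun x => ?_
  have hgx : Measurable (g x) := hg.comp measurable_prodMk_left
  rw [Measure.map_apply hgx hs]
  rfl

lemma map_bind {X Y Z : Type*} [MeasurableSpace X] [MeasurableSpace Y]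
    [MeasurableSpace Z] (μ : Measure X) {h : X → Y} (hh : Measurable h) {G : Y → Measure Z}
    (hG : Measurable G) : (μ.map h).bind G = μ.bind (fun x => G (h x)) := by
  rw [Measure.bind, Measure.bind, Measure.map_map hG hh]
  rfl

/-- A Gaussian kernel with affine mean adds independent noise to an affine image, so the law is a
convolution and the characteristic functions multiply. -/
lemma multivariateGaussian_bind {K₁ : Matrix (Fin b) (Fin b) ℝ} (h₁ : K₁.PosSemidef)
    {K₂ : Matrix (Fin a) (Fin a) ℝ} (h₂ : K₂.PosSemidef) (N : Matrix (Fin a) (Fin b) ℝ)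
    (m : E b) (c : E a) :
    (multivariateGaussian m K₁).bind (fun x => multivariateGaussian (c + app N x) K₂) =
      multivariateGaussian (c + app N m) (N * K₁ * Nᵀ + K₂) := by
  have e1 : (fun x => multivariateGaussian (c + app N x) K₂) =
      fun x => (multivariateGaussian 0 K₂).map (fun y => (c + app N x) + y) :=
    funext fun x => multivariateGaussian_eq_map h₂ _
  have e2 : Function.uncurry (fun (x : E b) (y : E a) => (c + app N x) + y) =
      (fun p : E a × E a => p.1 + p.2) ∘ Prod.map (fun x => c + app N x) id := rfl
  rw [e1, bind_map_eq_map_prod _ _ (by fun_prop), e2, ← Measure.map_map (by fun_prop)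
    (Measurable.prodMap (by fun_prop) measurable_id), ← Measure.map_prod_map _ _ (by fun_prop)
    measurable_id, Measure.map_id, multivariateGaussian_map_add_app h₁]
  have : IsProbabilityMeasure (((multivariateGaussian (c + app N m) (N * K₁ * Nᵀ)).prod
      (multivariateGaussian 0 K₂)).map (fun p : E a × E a => p.1 + p.2)) :=
    Measure.isProbabilityMeasure_map (by fun_prop)
  have h3 := PosSemidef.conj_transpose h₁ N
  refine Measure.ext_of_charFun (funext fun t => ?_)
  rw [charFun_map_add_prod_eq_mul, Pi.mul_apply, charFun_multivariateGaussian h3,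
    charFun_multivariateGaussian h₂, charFun_multivariateGaussian (h3.add h₂), ← Complex.exp_add]
  rw [add_mulVec, dotProduct_add, inner_zero_right]
  push_cast
  ring_nf

/-- The law of the Gaussian correction `θ ↦ θ + T (f - A θ) + 𝒩(0, covT A T)`. -/
noncomputable def corrLaw (A T : Matrix (Fin n) (Fin n) ℝ) (f θ : E n) : Measure (E n) :=
  multivariateGaussian (θ + app T (f - app A θ)) (covT A T)

lemma corrLaw_mean (A T : Matrix (Fin n) (Fin n) ℝ) (f θ : E n) :
    θ + app T (f - app A θ) = app T f + app (1 - T * A) θ := by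
  rw [sub_app, app_sub, one_app, mul_app]; abel

lemma corrLaw_eq_map {A T : Matrix (Fin n) (Fin n) ℝ} (hT : (covT A T).PosSemidef) (f θ : E n) :
    corrLaw A T f θ = (multivariateGaussian 0 (covT A T)).map
      (fun ξ => (app T f + app (1 - T * A) θ) + ξ) := by
  rw [corrLaw, corrLaw_mean, multivariateGaussian_eq_map hT]

/-- Writing the kernel as the image of one fixed Gaussian under a jointly measurable map makes its
measurability visible; `Measure.bind` is only meaningful for measurable kernels. -/
lemma measurable_corrLaw {A T : Matrix (Fin n) (Fin n) ℝ} (hT : (covT A T).PosSemidef) (f : E n) :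
    Measurable (corrLaw A T f) := by
  rw [show corrLaw A T f = _ from funext fun θ => corrLaw_eq_map hT f θ]
  exact measurable_map_prodMk _ (by fun_prop)

lemma corrLaw_bind {A T₁ T₂ : Matrix (Fin n) (Fin n) ℝ} (hA : Aᵀ = A)
    (h₁ : (covT A T₁).PosSemidef) (h₂ : (covT A T₂).PosSemidef) (f θ : E n) :
    (corrLaw A T₁ f θ).bind (corrLaw A T₂ f) = corrLaw A (compT A T₁ T₂) f θ := by
  have e : corrLaw A T₂ f =
      fun x => multivariateGaussian (app T₂ f + app (1 - T₂ * A) x) (covT A T₂) :=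
    funext fun x => by rw [corrLaw, corrLaw_mean]
  rw [e, corrLaw, multivariateGaussian_bind h₁ h₂, corrLaw, covT_compT hA]
  congr 1
  rw [corrLaw_mean, corrLaw_mean, one_sub_compT_mul, mul_app, app_add, ← add_assoc,
    ← mul_app (1 - T₂ * A) T₁, ← add_app,
    show T₂ + (1 - T₂ * A) * T₁ = compT A T₁ T₂ by unfold compT; noncomm_ring]

lemma repeatLaw_corrLaw {A T : Matrix (Fin n) (Fin n) ℝ} (hA : Aᵀ = A)
    (h : (covT A T).PosSemidef) (f : E n) (k : ℕ) :
    repeatLaw (corrLaw A T f) k = corrLaw A (repT A T k) f := by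
  induction k with
  | zero =>
    funext θ
    simp [repeatLaw, corrLaw, repT, covT, multivariateGaussian_zero_cov]
  | succ k ih =>
    funext θ
    rw [repeatLaw, ih, corrLaw_bind hA h (covT_posSemidef_repT hA h k), repT]

lemma smootherLaw_eq {A M : Matrix (Fin n) (Fin n) ℝ} (hA : A.PosDef) (h : (M - A).PosSemidef)
    (f : E n) : smootherLaw A M f = corrLaw A M⁻¹ f := by
  funext θ
  have hM := PosDef.of_sub_posSemidef hA h
  have e : (fun ξ => θ + app M⁻¹ (f + ξ - app A θ)) =
      fun ξ => (θ + app M⁻¹ (f - app A θ)) + app M⁻¹ ξ := by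
    funext ξ
    rw [add_sub_right_comm, app_add, ← add_assoc]
  rw [smootherLaw, e, multivariateGaussian_map_add_app (posSemidef_two_smul_sub hA h), corrLaw,
    covT_smoother hM, app_zero, add_zero]

lemma compT_assoc (A T₁ T₂ T₃ : Matrix (Fin n) (Fin n) ℝ) :
    compT A (compT A T₁ T₂) T₃ = compT A T₁ (compT A T₂ T₃) := by
  unfold compT; noncomm_ring

lemma corrLaw_coarse {A : Matrix (Fin a) (Fin a) ℝ} {A' : Matrix (Fin b) (Fin b) ℝ}
    {J : Matrix (Fin a) (Fin b) ℝ} (hJ : Jᵀ * A * J = A') {T : Matrix (Fin b) (Fin b) ℝ}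
    (hT : (covT A' T).PosSemidef) (f θ : E a) :
    (corrLaw A' T (app Jᵀ (f - app A θ)) 0).map (fun ψ => θ + app J ψ) =
      corrLaw A (J * T * Jᵀ) f θ := by
  rw [corrLaw, multivariateGaussian_map_add_app hT, corrLaw, covT_coarse hJ]
  simp [mul_app]

/-- The V-cycle is a Gaussian correction step. -/
lemma mgmcLaw_eq_corrLaw {n : ℕ → ℕ} {A M : (ℓ : ℕ) → Matrix (Fin (n ℓ)) (Fin (n ℓ)) ℝ}
    {J : (ℓ : ℕ) → Matrix (Fin (n (ℓ + 1))) (Fin (n ℓ)) ℝ} (hA : ∀ ℓ, (A ℓ).PosDef)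
    (hJ : ∀ ℓ, (J ℓ)ᵀ * A (ℓ + 1) * J ℓ = A ℓ)
    (h : ∀ ℓ, (M (ℓ + 1) - A (ℓ + 1)).PosSemidef) (k ℓ : ℕ) (f : E (n ℓ)) :
    mgmcLaw A M M J k k (fun _ => 1) ℓ f = corrLaw (A ℓ) (vCycleT A M J k ℓ) f := by
  induction ℓ with
  | zero =>
    funext θ
    rw [mgmcLaw, corrLaw, corrLaw_mean, vCycleT, covT_inv (hA 0), PosDef.inv_mul (hA 0), sub_self,
      zero_app, add_zero]
  | succ ℓ ih =>
    funext θ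
    have hAt := PosDef.transpose_eq (hA (ℓ + 1))
    have hs := covT_smoother_posSemidef (hA (ℓ + 1)) (h ℓ)
    have hr := covT_posSemidef_repT hAt hs k
    have hT := covT_vCycleT_posSemidef hA hJ h k ℓ
    have hc : (covT (A (ℓ + 1)) (J ℓ * vCycleT A M J k ℓ * (J ℓ)ᵀ)).PosSemidef := by
      rw [covT_coarse (hJ ℓ)]
      exact PosSemidef.conj_transpose hT _
    rw [mgmcLaw, smootherLaw_eq (hA (ℓ + 1)) (h ℓ), repeatLaw_corrLaw hAt hs]
    have e : ∀ θ₁ : E (n (ℓ + 1)),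
        ((repeatLaw (mgmcLaw A M M J k k (fun _ => 1) ℓ (app (J ℓ)ᵀ (f - app (A (ℓ + 1)) θ₁)))
          1 0).bind fun ψ => corrLaw (A (ℓ + 1)) (repT (A (ℓ + 1)) (M (ℓ + 1))⁻¹ k) f
            (θ₁ + app (J ℓ) ψ)) =
        corrLaw (A (ℓ + 1)) (compT (A (ℓ + 1)) (J ℓ * vCycleT A M J k ℓ * (J ℓ)ᵀ)
          (repT (A (ℓ + 1)) (M (ℓ + 1))⁻¹ k)) f θ₁ := by
      intro θ₁
      -- The V-cycle makes a single recursive call, so the repetition of the coarse update collapses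
      -- to one application.
      rw [ih, repeatLaw, show repeatLaw (corrLaw (A ℓ) (vCycleT A M J k ℓ)
        (app (J ℓ)ᵀ (f - app (A (ℓ + 1)) θ₁))) 0 = Measure.dirac from rfl, Measure.bind_dirac,
        ← map_bind _ (h := fun ψ => θ₁ + app (J ℓ) ψ) (by fun_prop) (measurable_corrLaw hr f),
        corrLaw_coarse (hJ ℓ) hT, corrLaw_bind hAt hc hr]
    simp_rw [e]
    rw [corrLaw_bind hAt hr (covT_posSemidef_compT hAt hc hr), vCycleT, cycleT, compT_assoc]

end Laws

end MGMC

namespace MGMC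

/-! ### Galerkin structure of the discretised inverse problem and level-independent energy bounds.
-/

section Bayes

variable {H : Type*} [NormedAddCommGroup H] [InnerProductSpace ℝ H] {β : ℕ}
  {𝔓 : BayesProblem H β}

lemma BayesProblem.covRoot_injective (𝔓 : BayesProblem H β) :
    Function.Injective 𝔓.covRoot := by
  rw [injective_iff_map_eq_zero]
  intro x hx
  by_contra h
  have := 𝔓.covOp_pos x h
  rw [← 𝔓.covRoot_sq, ContinuousLinearMap.comp_apply, hx, map_zero, inner_zero_left] at this
  exact lt_irrefl _ this

/-- `LinearPMap.inverse` is a genuine inverse only for a trivial kernel; positive definiteness of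
`𝒜⁻¹` enters through the injectivity of its root. -/
lemma BayesProblem.covRoot_precRoot (𝔓 : BayesProblem H β) (u : 𝔓.precRoot.domain) :
    𝔓.covRoot (𝔓.precRoot u) = u := by
  have hker : ((𝔓.covRoot : H →ₗ[ℝ] H).toPMap ⊤).toFun.ker = ⊥ := by
    rw [LinearMap.ker_eq_bot']
    intro x hx
    exact Subtype.ext ((injective_iff_map_eq_zero _).1 𝔓.covRoot_injective _ hx)
  have hu : (u : H) ∈ LinearMap.range ((𝔓.covRoot : H →ₗ[ℝ] H).toPMap ⊤).toFun := by
    rw [← LinearPMap.inverse_domain]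
    exact u.2
  obtain ⟨x, hx⟩ := hu
  have := LinearPMap.inverse_apply_eq hker (y := u) (x := x) hx
  have h2 : 𝔓.precRoot u = (x : H) := this
  rw [h2]
  exact hx

namespace Hierarchy

variable (𝔥 : Hierarchy 𝔓)

/-- The image `𝒜^{1/2} φ_j` of a basis function. -/
noncomputable def root (ℓ : ℕ) (j : Fin (𝔥.n ℓ)) : H :=
  𝔓.precRoot ⟨𝔥.φ ℓ j, 𝔥.mem_domain ℓ j⟩

lemma covRoot_root (ℓ : ℕ) (j : Fin (𝔥.n ℓ)) : 𝔓.covRoot (𝔥.root ℓ j) = 𝔥.φ ℓ j :=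
  𝔓.covRoot_precRoot _

lemma A_apply (ℓ : ℕ) (j k : Fin (𝔥.n ℓ)) : 𝔥.A ℓ j k = ⟪𝔥.root ℓ j, 𝔥.root ℓ k⟫ := rfl

/-- The vector `𝒜^{1/2} v` for `v = ∑ x_j φ_j`. -/
noncomputable def rootSum (ℓ : ℕ) (x : Fin (𝔥.n ℓ) → ℝ) : H := ∑ j, x j • 𝔥.root ℓ j

lemma covRoot_rootSum (ℓ : ℕ) (x : Fin (𝔥.n ℓ) → ℝ) :
    𝔓.covRoot (𝔥.rootSum ℓ x) = ∑ j, x j • 𝔥.φ ℓ j := by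
  simp [rootSum, map_sum, covRoot_root]

lemma dotProduct_A_mulVec (ℓ : ℕ) (x : Fin (𝔥.n ℓ) → ℝ) :
    x ⬝ᵥ (𝔥.A ℓ *ᵥ x) = ‖𝔥.rootSum ℓ x‖ ^ 2 := by
  rw [← real_inner_self_eq_norm_sq, rootSum, sum_inner]
  simp only [inner_sum, real_inner_smul_left, real_inner_smul_right, dotProduct, mulVec, A_apply,
    Finset.mul_sum]
  refine Finset.sum_congr rfl fun i _ => Finset.sum_congr rfl fun j _ => by ring

lemma A_transpose (ℓ : ℕ) : (𝔥.A ℓ)ᵀ = 𝔥.A ℓ := by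
  ext i j
  rw [transpose_apply, A_apply, A_apply, real_inner_comm]

lemma A_posDef (ℓ : ℕ) : (𝔥.A ℓ).PosDef := by
  refine Matrix.PosDef.of_dotProduct_mulVec_pos ?_ fun x hx => ?_
  · rw [IsHermitian, conjTranspose_eq_transpose_of_trivial, A_transpose]
  · rw [star_trivial, dotProduct_A_mulVec]
    refine pow_pos (norm_pos_iff.2 fun h0 => hx ?_) 2
    have h1 := 𝔥.covRoot_rootSum ℓ x
    rw [h0, map_zero] at h1
    exact funext (Fintype.linearIndependent_iff.1 (𝔥.linInd ℓ) x h1.symm)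

lemma lowRank_posSemidef (ℓ : ℕ) : (𝔥.lowRank ℓ).PosSemidef := by
  simpa [lowRank, conjTranspose_eq_transpose_of_trivial] using
    𝔓.Γ_posDef.inv.posSemidef.mul_mul_conjTranspose_same (𝔥.B ℓ)

lemma post_posDef (ℓ : ℕ) : (𝔥.post ℓ).PosDef :=
  (𝔥.A_posDef ℓ).add_posSemidef (𝔥.lowRank_posSemidef ℓ)

lemma φ_eq_sum (ℓ : ℕ) (k : Fin (𝔥.n ℓ)) :
    𝔥.φ ℓ k = ∑ j, 𝔥.prolong ℓ j k • 𝔥.φ (ℓ + 1) j := by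
  have h := (Module.Basis.span (𝔥.linInd (ℓ + 1))).sum_repr
    ⟨𝔥.φ ℓ k, 𝔥.nested ℓ (Submodule.subset_span ⟨k, rfl⟩)⟩
  have h' := congrArg Subtype.val h
  simp only [AddSubmonoidClass.coe_finsetSum, Submodule.coe_smul] at h'
  rw [← h']
  refine Finset.sum_congr rfl fun j _ => ?_
  rw [Module.Basis.span_apply]
  rfl

/-- Applying the injective bounded operator `𝒜^{-1/2}` reduces this to the expansion of the basis
functions, without manipulating the domain of `𝒜^{1/2}`. -/
lemma root_eq_sum (ℓ : ℕ) (k : Fin (𝔥.n ℓ)) :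
    𝔥.root ℓ k = ∑ j, 𝔥.prolong ℓ j k • 𝔥.root (ℓ + 1) j := by
  apply 𝔓.covRoot_injective
  rw [covRoot_root, map_sum, φ_eq_sum]
  simp [covRoot_root]

lemma A_galerkin (ℓ : ℕ) : (𝔥.prolong ℓ)ᵀ * 𝔥.A (ℓ + 1) * 𝔥.prolong ℓ = 𝔥.A ℓ := by
  ext i k
  rw [A_apply, root_eq_sum, root_eq_sum, sum_inner]
  simp only [inner_sum, real_inner_smul_left, real_inner_smul_right, Matrix.mul_apply,
    transpose_apply, Finset.sum_mul, A_apply]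
  rw [Finset.sum_comm]
  refine Finset.sum_congr rfl fun i _ => Finset.sum_congr rfl fun j _ => by ring

lemma B_galerkin (ℓ : ℕ) : (𝔥.prolong ℓ)ᵀ * 𝔥.B (ℓ + 1) = 𝔥.B ℓ := by
  ext i k
  simp only [B, Matrix.mul_apply, transpose_apply, of_apply]
  conv_rhs => rw [φ_eq_sum, map_sum]
  simp

lemma post_galerkin (ℓ : ℕ) :
    (𝔥.prolong ℓ)ᵀ * 𝔥.post (ℓ + 1) * 𝔥.prolong ℓ = 𝔥.post ℓ := by
  rw [post, post, Matrix.mul_add, Matrix.add_mul, A_galerkin, lowRank, lowRank, ← 𝔥.B_galerkin ℓ]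
  simp only [transpose_mul, transpose_transpose, Matrix.mul_assoc]

lemma F_dotProduct (𝓕 : H →L[ℝ] ℝ) (ℓ : ℕ) (x : Fin (𝔥.n ℓ) → ℝ) :
    𝔥.F 𝓕 ℓ ⬝ᵥ x = 𝓕 (𝔓.covRoot (𝔥.rootSum ℓ x)) := by
  rw [covRoot_rootSum, map_sum]
  simp [F, dotProduct, mul_comm]

/-- The dual energy norm of a bounded functional is bounded independently of the level. -/
lemma F_energy_le (𝓕 : H →L[ℝ] ℝ) (ℓ : ℕ) :
    𝔥.F 𝓕 ℓ ⬝ᵥ ((𝔥.post ℓ)⁻¹ *ᵥ 𝔥.F 𝓕 ℓ) ≤ (‖𝓕‖ * ‖𝔓.covRoot‖) ^ 2 := by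
  set x := (𝔥.post ℓ)⁻¹ *ᵥ 𝔥.F 𝓕 ℓ with hx
  have h1 : 𝔥.F 𝓕 ℓ = 𝔥.post ℓ *ᵥ x := by
    rw [hx, mulVec_mulVec, PosDef.mul_inv (𝔥.post_posDef ℓ), one_mulVec]
  have h2 : 𝔥.F 𝓕 ℓ ⬝ᵥ x = ‖𝔥.rootSum ℓ x‖ ^ 2 + x ⬝ᵥ (𝔥.lowRank ℓ *ᵥ x) := by
    conv_lhs => rw [h1, dotProduct_comm]
    rw [post, add_mulVec, dotProduct_add, dotProduct_A_mulVec]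
  have h3 : 0 ≤ x ⬝ᵥ (𝔥.lowRank ℓ *ᵥ x) := by
    simpa using (𝔥.lowRank_posSemidef ℓ).dotProduct_mulVec_nonneg x
  have h4 : 𝔥.F 𝓕 ℓ ⬝ᵥ x ≤ (‖𝓕‖ * ‖𝔓.covRoot‖) * ‖𝔥.rootSum ℓ x‖ := by
    rw [F_dotProduct, mul_assoc]
    exact (le_abs_self _).trans ((𝓕.le_opNorm _).trans
      (mul_le_mul_of_nonneg_left (𝔓.covRoot.le_opNorm _) (norm_nonneg _)))
  -- With `q` the dual energy, `r` the norm of `𝒜^{1/2} v` and `c` the product of operator norms,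
  -- `r² ≤ q ≤ c r` forces `q ≤ c²`.
  nlinarith [sq_nonneg (‖𝓕‖ * ‖𝔓.covRoot‖ - ‖𝔥.rootSum ℓ x‖), norm_nonneg (𝔥.rootSum ℓ x)]

/-- The functional `v ↦ yᵀ Γ⁻¹ 𝓑 v`. -/
noncomputable def dataFunctional (𝔓 : BayesProblem H β) : H →L[ℝ] ℝ :=
  (innerSL ℝ (app (𝔓.Γ⁻¹)ᵀ 𝔓.y)) ∘L 𝔓.obs

/-- The right-hand side represents a bounded functional too, so `F_energy_le` also bounds the energy
norm of the posterior mean uniformly. -/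
lemma f_ofLp (ℓ : ℕ) : (𝔥.f ℓ).ofLp = 𝔥.F (dataFunctional 𝔓) ℓ := by
  ext j
  simp [f, F, dataFunctional, inner_eq_dotProduct, dotProduct_mulVec, mulVec_transpose]

end Hierarchy

end Bayes

end MGMC

namespace MGMC

/-! ### Moments of an affine image plus independent noise. -/

section AdditiveNoise

variable {Ω X : Type*} [MeasurableSpace Ω] [MeasurableSpace X] {P : Measure Ω}
  [IsProbabilityMeasure P] {ν : Measure ℝ} [IsProbabilityMeasure ν] {h : Ω → X} {Z : Ω → ℝ}
  {a b : X → ℝ} {c : ℝ}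

/-- Jointly with `h`, the random variable `Z` is `c + a h` plus independent noise with law `ν`. -/
structure IsNoisyImage (P : Measure Ω) (ν : Measure ℝ) (h : Ω → X) (Z : Ω → ℝ) (a : X → ℝ)
    (c : ℝ) : Prop where
  measurable_left : Measurable h
  measurable_right : Measurable Z
  measurable_fun : Measurable a
  map_eq : P.map (fun ω => (h ω, Z ω)) =
    ((P.map h).prod ν).map fun p => (p.1, (c + a p.1) + p.2)
  memLp_fun : MemLp (fun ω => a (h ω)) 2 P
  memLp_noise : MemLp id 2 ν

namespace IsNoisyImage

lemma measurable_map (H : IsNoisyImage P ν h Z a c) :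
    Measurable fun p : X × ℝ => (p.1, (c + a p.1) + p.2) := by
  have := H.measurable_fun
  fun_prop

lemma measurable_pair (H : IsNoisyImage P ν h Z a c) : Measurable fun ω => (h ω, Z ω) :=
  H.measurable_left.prodMk H.measurable_right

lemma isProbabilityMeasure_map (H : IsNoisyImage P ν h Z a c) : IsProbabilityMeasure (P.map h) :=
  Measure.isProbabilityMeasure_map H.measurable_left.aemeasurable

lemma memLp_map (hh : Measurable h) {b : X → ℝ} (hb : Measurable b)
    (hL : MemLp (fun ω => b (h ω)) 2 P) : MemLp b 2 (P.map h) :=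
  (memLp_map_measure_iff hb.aestronglyMeasurable hh.aemeasurable).2 hL

lemma memLp_sum (H : IsNoisyImage P ν h Z a c) :
    MemLp (fun x => c + a x) 2 (P.map h) :=
  have := H.isProbabilityMeasure_map
  (memLp_const c).add (memLp_map H.measurable_left H.measurable_fun H.memLp_fun)

lemma memLp (H : IsNoisyImage P ν h Z a c) : MemLp Z 2 P := by
  have := H.isProbabilityMeasure_map
  have h2 : MemLp (Prod.snd : X × ℝ → ℝ) 2 (P.map fun ω => (h ω, Z ω)) := by
    rw [H.map_eq, memLp_map_measure_iff measurable_snd.aestronglyMeasurable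
      H.measurable_map.aemeasurable]
    exact (H.memLp_sum.comp_fst ν).add (H.memLp_noise.comp_snd (P.map h))
  exact h2.comp_of_map H.measurable_pair.aemeasurable

lemma integral_eq (H : IsNoisyImage P ν h Z a c) :
    ∫ ω, Z ω ∂P = c + ∫ ω, a (h ω) ∂P + ∫ x, x ∂ν := by
  have := H.isProbabilityMeasure_map
  have h2 : ∫ ω, Z ω ∂P = ∫ p : X × ℝ, p.2 ∂(P.map fun ω => (h ω, Z ω)) :=
    (integral_map H.measurable_pair.aemeasurable measurable_snd.aestronglyMeasurable).symm
  rw [h2, H.map_eq, integral_map H.measurable_map.aemeasurable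
    measurable_snd.aestronglyMeasurable]
  have i1 := (H.memLp_sum.comp_fst ν).integrable (by norm_num)
  have i2 := (H.memLp_noise.comp_snd (P.map h)).integrable (by norm_num)
  have i3 := (memLp_map H.measurable_left H.measurable_fun H.memLp_fun).integrable (by norm_num)
  refine (integral_add i1 i2).trans ?_
  rw [integral_fun_fst (fun x => c + a x), integral_fun_snd (fun x : ℝ => id x),
    integral_add (integrable_const _) i3,
    integral_map H.measurable_left.aemeasurable H.measurable_fun.aestronglyMeasurable]
  simp

/-- Under the product law the fresh noise is independent of everything that depends on `h` alone, so
it drops out; `variance_eq` keeps its variance. -/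
lemma covariance_eq (H : IsNoisyImage P ν h Z a c) (hb : Measurable b)
    (hL : MemLp (fun ω => b (h ω)) 2 P) :
    cov[Z, fun ω => b (h ω); P] = cov[fun ω => a (h ω), fun ω => b (h ω); P] := by
  have := H.isProbabilityMeasure_map
  have hb' : Measurable fun p : X × ℝ => b p.1 := hb.comp measurable_fst
  have h2 : cov[Z, fun ω => b (h ω); P] =
      cov[Prod.snd, fun p : X × ℝ => b p.1; P.map fun ω => (h ω, Z ω)] :=
    (covariance_map_fun measurable_snd.aestronglyMeasurable hb'.aestronglyMeasurable
      H.measurable_pair.aemeasurable).symm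
  have hbL := memLp_map H.measurable_left hb hL
  have haL := memLp_map H.measurable_left H.measurable_fun H.memLp_fun
  rw [h2, H.map_eq, covariance_map_fun measurable_snd.aestronglyMeasurable
    hb'.aestronglyMeasurable H.measurable_map.aemeasurable]
  have e1 := covariance_add_left (H.memLp_sum.comp_fst ν) (H.memLp_noise.comp_snd (P.map h))
    (hbL.comp_fst ν)
  have e2 := covariance_fst_snd_prod hbL H.memLp_noise
  rw [covariance_comm] at e2
  refine e1.trans ?_
  rw [e2, add_zero]
  have e4 := covariance_map_fun (μ := (P.map h).prod ν) (Z := Prod.fst) (X := fun x => c + a x)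
    (Y := b) (by rw [Measure.map_fst_prod, measure_univ, one_smul]; exact H.memLp_sum.1)
    (by rw [Measure.map_fst_prod, measure_univ, one_smul]; exact hbL.1) measurable_fst.aemeasurable
  refine e4.symm.trans ?_
  rw [Measure.map_fst_prod, measure_univ, one_smul,
    covariance_const_add_left (haL.integrable (by norm_num)),
    covariance_map_fun haL.1 hbL.1 H.measurable_left.aemeasurable]

lemma variance_eq (H : IsNoisyImage P ν h Z a c) :
    Var[Z; P] = Var[fun ω => a (h ω); P] + Var[id; ν] := by
  have := H.isProbabilityMeasure_map
  have h2 : Var[Z; P] = Var[Prod.snd; P.map fun ω => (h ω, Z ω)] :=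
    (variance_map measurable_snd.aemeasurable H.measurable_pair.aemeasurable).symm
  rw [h2, H.map_eq, variance_map measurable_snd.aemeasurable H.measurable_map.aemeasurable]
  refine (variance_add_prod H.memLp_sum H.memLp_noise).trans ?_
  congr 1
  refine (variance_const_add H.measurable_fun.aestronglyMeasurable _).trans ?_
  exact variance_map H.measurable_fun.aemeasurable H.measurable_left.aemeasurable

end IsNoisyImage

end AdditiveNoise

/-! ### One-step recursions for the moments of the chain. -/

section Chain

variable {n : ℕ} {A T : Matrix (Fin n) (Fin n) ℝ} {f : E n} {Ω : Type*} [MeasurableSpace Ω]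
  {P : Measure Ω} {θ : ℕ → Ω → E n}

/-- The linear functional `x ↦ u ⬝ x`. -/
def lin (u : Fin n → ℝ) (x : E n) : ℝ := u ⬝ᵥ x.ofLp

@[fun_prop]
lemma continuous_lin (u : Fin n → ℝ) : Continuous (lin u) := by
  unfold lin dotProduct; fun_prop

@[fun_prop]
lemma measurable_lin (u : Fin n → ℝ) : Measurable (lin u) := (continuous_lin u).measurable

lemma lin_add (u : Fin n → ℝ) (x y : E n) : lin u (x + y) = lin u x + lin u y := by
  simp [lin, dotProduct_add]

lemma lin_app (u : Fin n → ℝ) (S : Matrix (Fin n) (Fin n) ℝ) (x : E n) :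
    lin u (app S x) = lin (Sᵀ *ᵥ u) x := by
  simp [lin, dotProduct_mulVec, mulVec_transpose]

lemma lin_eq_inner (u : Fin n → ℝ) (x : E n) : lin u x = ⟪WithLp.toLp 2 u, x⟫ := by
  rw [inner_eq_dotProduct]; rfl

lemma memLp_lin {μ : Measure (E n)} (hμ : IsGaussian μ) (u : Fin n → ℝ) : MemLp (lin u) 2 μ := by
  have := IsGaussian.memLp_dual μ (innerSL ℝ (WithLp.toLp 2 u)) 2 (by norm_num)
  refine this.congr_norm (by fun_prop) (.of_forall fun x => ?_)
  rw [lin_eq_inner]; simp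

lemma integral_lin {μ : Measure (E n)} (hμ : IsGaussian μ) (u : Fin n → ℝ) :
    ∫ x, lin u x ∂μ = lin u (∫ x, x ∂μ) := by
  simp_rw [lin_eq_inner]
  exact integral_inner IsGaussian.integrable_id _

lemma variance_lin_multivariateGaussian {K : Matrix (Fin n) (Fin n) ℝ} (hK : K.PosSemidef)
    (m : E n) (u : Fin n → ℝ) :
    cov[lin u, lin u; multivariateGaussian m K] = u ⬝ᵥ (K *ᵥ u) := by
  have h := covarianceBilin_multivariateGaussian (μ := m) hK (WithLp.toLp 2 u) (WithLp.toLp 2 u)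
  rw [covarianceBilin_apply_eq_cov IsGaussian.memLp_two_id] at h
  rw [← h]
  congr 1 <;> exact funext fun x => lin_eq_inner u x

/-- The next state of the chain is, jointly with the history, an affine image of the last state
plus independent Gaussian noise. -/
lemma map_history_eq [IsProbabilityMeasure P] (h : IsMarkovChain (corrLaw A T f) P θ)
    (hT : (covT A T).PosSemidef) (m : ℕ) :
    P.map (fun ω => ((fun i : Fin (m + 1) => θ i ω), θ (m + 1) ω)) =
      ((P.map fun ω => fun i : Fin (m + 1) => θ i ω).prod
        (multivariateGaussian 0 (covT A T))).map
        fun p => (p.1, (app T f + app (1 - T * A) (p.1 (Fin.last m))) + p.2) := by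
  rw [h.transition]
  have e : (fun h : Fin (m + 1) → E n => (corrLaw A T f (h (Fin.last m))).map fun x => (h, x)) =
      fun h => (multivariateGaussian 0 (covT A T)).map
        fun ξ => (h, (app T f + app (1 - T * A) (h (Fin.last m))) + ξ) := by
    funext h
    rw [corrLaw_eq_map hT, Measure.map_map (by fun_prop) (by fun_prop)]
    rfl
  rw [e, bind_map_eq_map_prod _ _ (by fun_prop)]
  rfl

/-- Testing the vector recursion with `u` moves the iteration matrix onto the functional. The whole
history is kept as the reference variable because covariances with earlier states are needed. -/
lemma isNoisyImage_next [IsProbabilityMeasure P] (h : IsMarkovChain (corrLaw A T f) P θ)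
    (hT : (covT A T).PosSemidef) {m : ℕ} (hL : ∀ u, MemLp (fun ω => lin u (θ m ω)) 2 P)
    (u : Fin n → ℝ) :
    IsNoisyImage P ((multivariateGaussian 0 (covT A T)).map (lin u))
      (fun ω => fun i : Fin (m + 1) => θ i ω) (fun ω => lin u (θ (m + 1) ω))
      (fun x => lin ((1 - T * A)ᵀ *ᵥ u) (x (Fin.last m))) (lin u (app T f)) := by
  have hh : Measurable (fun ω => fun i : Fin (m + 1) => θ i ω) :=
    measurable_pi_lambda _ fun i => h.measurable i
  have hlast : Measurable fun x : Fin (m + 1) → E n => x (Fin.last m) := measurable_pi_apply _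
  have hfun : Measurable fun x : Fin (m + 1) → E n =>
      lin ((1 - T * A)ᵀ *ᵥ u) (x (Fin.last m)) := (measurable_lin _).comp hlast
  refine ⟨hh, (measurable_lin u).comp (h.measurable _), hfun, ?_, hL _, ?_⟩
  · have hΨ : Measurable (fun ω => ((fun i : Fin (m + 1) => θ i ω), θ (m + 1) ω)) :=
      hh.prodMk (h.measurable _)
    have hp : Measurable (Prod.map id (lin u) : (Fin (m + 1) → E n) × E n → _) :=
      measurable_id.prodMap (measurable_lin u)
    have hΦ : Measurable fun p : (Fin (m + 1) → E n) × E n =>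
        (p.1, (app T f + app (1 - T * A) (p.1 (Fin.last m))) + p.2) := by fun_prop
    have e := congrArg (Measure.map (Prod.map id (lin u))) (map_history_eq h hT m)
    have hΦ' : Measurable fun p : (Fin (m + 1) → E n) × ℝ =>
        (p.1, lin u (app T f) + lin ((1 - T * A)ᵀ *ᵥ u) (p.1 (Fin.last m)) + p.2) :=
      measurable_fst.prodMk (((hfun.comp measurable_fst).const_add _).add measurable_snd)
    have : IsProbabilityMeasure (P.map (fun ω => fun i : Fin (m + 1) => θ i ω)) :=
      Measure.isProbabilityMeasure_map hh.aemeasurable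
    rw [Measure.map_map hp hΨ, Measure.map_map hp hΦ] at e
    refine e.trans ?_
    have e2 := Measure.map_prod_map (P.map (fun ω => fun i : Fin (m + 1) => θ i ω))
      (multivariateGaussian 0 (covT A T)) measurable_id (measurable_lin u)
    rw [Measure.map_id] at e2
    rw [e2, Measure.map_map hΦ' hp]
    congr 1
    funext p
    simp only [Function.comp_def, Prod.map, id, lin_add, lin_app]
  · rw [memLp_map_measure_iff aestronglyMeasurable_id (measurable_lin u).aemeasurable]
    exact memLp_lin inferInstance u

lemma next_memLp [IsProbabilityMeasure P] (h : IsMarkovChain (corrLaw A T f) P θ)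
    (hT : (covT A T).PosSemidef) {m : ℕ} (hL : ∀ u, MemLp (fun ω => lin u (θ m ω)) 2 P)
    (u : Fin n → ℝ) : MemLp (fun ω => lin u (θ (m + 1) ω)) 2 P :=
  have : IsProbabilityMeasure ((multivariateGaussian 0 (covT A T)).map (lin u)) :=
    Measure.isProbabilityMeasure_map (measurable_lin u).aemeasurable
  (isNoisyImage_next h hT hL u).memLp

lemma next_mean [IsProbabilityMeasure P] (h : IsMarkovChain (corrLaw A T f) P θ)
    (hT : (covT A T).PosSemidef) {m : ℕ} (hL : ∀ u, MemLp (fun ω => lin u (θ m ω)) 2 P)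
    (u : Fin n → ℝ) : ∫ ω, lin u (θ (m + 1) ω) ∂P =
      lin u (app T f) + ∫ ω, lin ((1 - T * A)ᵀ *ᵥ u) (θ m ω) ∂P := by
  have : IsProbabilityMeasure ((multivariateGaussian 0 (covT A T)).map (lin u)) :=
    Measure.isProbabilityMeasure_map (measurable_lin u).aemeasurable
  have e : ∫ x, x ∂((multivariateGaussian 0 (covT A T)).map (lin u)) = 0 := by
    refine (integral_map (measurable_lin u).aemeasurable (f := fun x : ℝ => x)
      measurable_id.aestronglyMeasurable).trans ?_
    rw [integral_lin inferInstance]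
    simp [lin]
  rw [(isNoisyImage_next h hT hL u).integral_eq, e, add_zero]
  rfl

lemma next_cov [IsProbabilityMeasure P] (h : IsMarkovChain (corrLaw A T f) P θ)
    (hT : (covT A T).PosSemidef) {m j : ℕ} (hj : j ≤ m)
    (hL : ∀ i u, MemLp (fun ω => lin u (θ i ω)) 2 P) (u v : Fin n → ℝ) :
    cov[fun ω => lin u (θ (m + 1) ω), fun ω => lin v (θ j ω); P] =
      cov[fun ω => lin ((1 - T * A)ᵀ *ᵥ u) (θ m ω), fun ω => lin v (θ j ω); P] := by
  have : IsProbabilityMeasure ((multivariateGaussian 0 (covT A T)).map (lin u)) :=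
    Measure.isProbabilityMeasure_map (measurable_lin u).aemeasurable
  have hj' : Measurable fun x : Fin (m + 1) → E n => lin v (x ⟨j, Nat.lt_succ_of_le hj⟩) :=
    (measurable_lin v).comp (f := fun x : Fin (m + 1) → E n => x ⟨j, Nat.lt_succ_of_le hj⟩)
      (measurable_pi_apply _)
  exact (isNoisyImage_next h hT (hL m) u).covariance_eq
    (b := fun x => lin v (x ⟨j, Nat.lt_succ_of_le hj⟩))
    hj' (hL j v)

lemma next_var [IsProbabilityMeasure P] (h : IsMarkovChain (corrLaw A T f) P θ)
    (hT : (covT A T).PosSemidef) {m : ℕ}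
    (hL : ∀ u, MemLp (fun ω => lin u (θ m ω)) 2 P) (u : Fin n → ℝ) :
    Var[fun ω => lin u (θ (m + 1) ω); P] =
      Var[fun ω => lin ((1 - T * A)ᵀ *ᵥ u) (θ m ω); P] + u ⬝ᵥ (covT A T *ᵥ u) := by
  have : IsProbabilityMeasure ((multivariateGaussian 0 (covT A T)).map (lin u)) :=
    Measure.isProbabilityMeasure_map (measurable_lin u).aemeasurable
  rw [(isNoisyImage_next h hT hL u).variance_eq, variance_map aemeasurable_id
    (measurable_lin u).aemeasurable, ← variance_lin_multivariateGaussian hT 0,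
    covariance_self (measurable_lin u).aemeasurable]
  rfl

end Chain

end MGMC

namespace MGMC

/-! ### The dual energy norm. -/

section Energy

variable {n : ℕ} {A : Matrix (Fin n) (Fin n) ℝ}

/-- The squared dual energy norm `uᵀ A⁻¹ u`. -/
noncomputable def dualEnergy (A : Matrix (Fin n) (Fin n) ℝ) (u : Fin n → ℝ) : ℝ :=
  u ⬝ᵥ (A⁻¹ *ᵥ u)

lemma dualEnergy_nonneg (hA : A.PosDef) (u : Fin n → ℝ) : 0 ≤ dualEnergy A u := by
  simpa [dualEnergy] using hA.inv.posSemidef.dotProduct_mulVec_nonneg u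

lemma dualEnergy_pos (hA : A.PosDef) {u : Fin n → ℝ} (hu : u ≠ 0) : 0 < dualEnergy A u := by
  simpa [dualEnergy] using hA.inv.dotProduct_mulVec_pos hu

lemma sqrt_mul_sqrt (hA : A.PosDef) : CFC.sqrt A * CFC.sqrt A = A :=
  CFC.sqrt_mul_sqrt_self _ hA.posSemidef.nonneg

lemma sqrt_transpose (A : Matrix (Fin n) (Fin n) ℝ) : (CFC.sqrt A)ᵀ = CFC.sqrt A :=
  PosSemidef.transpose_eq (Matrix.nonneg_iff_posSemidef.1 (CFC.sqrt_nonneg A))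

lemma isUnit_det_sqrt (hA : A.PosDef) : IsUnit (CFC.sqrt A).det := by
  have := (Matrix.isUnit_iff_isUnit_det _).1 hA.isUnit
  rw [← sqrt_mul_sqrt hA, Matrix.det_mul] at this
  exact isUnit_of_mul_isUnit_left this

/-- `A^{-1/2} u` as a Euclidean vector. -/
noncomputable def dualRoot (A : Matrix (Fin n) (Fin n) ℝ) (u : Fin n → ℝ) : E n :=
  app (CFC.sqrt A)⁻¹ (WithLp.toLp 2 u)

lemma sqrt_mulVec_dualRoot (hA : A.PosDef) (u : Fin n → ℝ) :
    CFC.sqrt A *ᵥ (dualRoot A u).ofLp = u := by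
  simp [dualRoot, mulVec_mulVec, Matrix.mul_nonsing_inv _ (isUnit_det_sqrt hA)]

lemma dualRoot_dotProduct_self (hA : A.PosDef) (u : Fin n → ℝ) :
    (dualRoot A u).ofLp ⬝ᵥ (dualRoot A u).ofLp = dualEnergy A u := by
  have h1 : A⁻¹ = ((CFC.sqrt A)⁻¹)ᵀ * (CFC.sqrt A)⁻¹ := by
    rw [transpose_nonsing_inv, sqrt_transpose, ← Matrix.mul_inv_rev, sqrt_mul_sqrt hA]
  rw [dualEnergy, h1, ← mulVec_mulVec, dotProduct_mulVec, vecMul_transpose]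
  rfl

lemma norm_dualRoot (hA : A.PosDef) (u : Fin n → ℝ) :
    ‖dualRoot A u‖ = Real.sqrt (dualEnergy A u) := by
  rw [← dualRoot_dotProduct_self hA, ← inner_eq_dotProduct, real_inner_self_eq_norm_sq,
    Real.sqrt_sq (norm_nonneg _)]

lemma abs_lin_le (hA : A.PosDef) (u : Fin n → ℝ) (x : E n) :
    |lin u x| ≤ Real.sqrt (dualEnergy A u) * ‖app (CFC.sqrt A) x‖ := by
  have h : lin u x = ⟪dualRoot A u, app (CFC.sqrt A) x⟫ := by
    rw [inner_app, sqrt_transpose, inner_eq_dotProduct, app_ofLp, sqrt_mulVec_dualRoot hA]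
    rfl
  rw [h, ← norm_dualRoot hA]
  exact abs_real_inner_le_norm _ _

lemma norm_sqrt_app_inv (hA : A.PosDef) (f : E n) :
    ‖app (CFC.sqrt A) (app A⁻¹ f)‖ = Real.sqrt (dualEnergy A f.ofLp) := by
  rw [← norm_dualRoot hA, dualRoot, ← mul_app]
  congr 2
  have h1 : A⁻¹ = (CFC.sqrt A)⁻¹ * (CFC.sqrt A)⁻¹ := by
    rw [← Matrix.mul_inv_rev, sqrt_mul_sqrt hA]
  rw [h1, ← Matrix.mul_assoc, Matrix.mul_nonsing_inv _ (isUnit_det_sqrt hA), Matrix.one_mul]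

lemma dotProduct_mulVec_le_dualEnergy (hA : A.PosDef) (K : Matrix (Fin n) (Fin n) ℝ)
    (u : Fin n → ℝ) :
    u ⬝ᵥ (K *ᵥ u) ≤ ‖CFC.sqrt A * K * CFC.sqrt A‖ * dualEnergy A u := by
  rw [← dualRoot_dotProduct_self hA]
  refine le_trans (le_of_eq ?_) (dotProduct_mulVec_le_l2_opNorm _ _)
  rw [← mulVec_mulVec, ← mulVec_mulVec, sqrt_mulVec_dualRoot hA, dotProduct_mulVec _ (CFC.sqrt A),
    ← mulVec_transpose, sqrt_transpose, sqrt_mulVec_dualRoot hA]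

end Energy

section CovarianceBound

variable {Ω : Type*} [MeasurableSpace Ω] {P : Measure Ω} [IsProbabilityMeasure P]

/-- Expand `0 ≤ Var[X ± t Y]`; the weight `t` balances the two variances and no division by a
variance occurs. -/
lemma abs_covariance_le {X Y : Ω → ℝ} (hX : MemLp X 2 P) (hY : MemLp Y 2 P) {t K : ℝ}
    (ht : 0 < t) (h₁ : Var[X; P] ≤ t ^ 2 * K) (h₂ : Var[Y; P] ≤ K) : |cov[X, Y; P]| ≤ t * K := by
  have h3 : ∀ s : ℝ, 0 ≤ Var[X; P] + 2 * (s * cov[X, Y; P]) + s ^ 2 * Var[Y; P] := by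
    intro s
    have := variance_add hX (hY.const_mul s)
    rw [covariance_const_mul_right, variance_const_mul] at this
    rw [← this]
    exact variance_nonneg _ _
  have h4 := h3 t
  have h5 := h3 (-t)
  have h6 : t ^ 2 * Var[Y; P] ≤ t ^ 2 * K := by gcongr
  rw [abs_le]
  constructor
  · have : 0 ≤ t * (cov[X, Y; P] + t * K) := by nlinarith
    linarith [nonneg_of_mul_nonneg_right this ht]
  · have : 0 ≤ t * (t * K - cov[X, Y; P]) := by nlinarith
    linarith [nonneg_of_mul_nonneg_right this ht]

end CovarianceBound

/-! ### Convergence and decay of correlations. -/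

section ChainBounds

variable {n : ℕ} {A T : Matrix (Fin n) (Fin n) ℝ} {f : E n} {Ω : Type*} [MeasurableSpace Ω]
  {P : Measure Ω} [IsProbabilityMeasure P] {θ : ℕ → Ω → E n}

/-- `m` steps of the adjoint iteration. -/
def adj (A T : Matrix (Fin n) (Fin n) ℝ) (m : ℕ) (u : Fin n → ℝ) : Fin n → ℝ :=
  (fun v => (1 - T * A)ᵀ *ᵥ v)^[m] u

lemma adj_succ (A T : Matrix (Fin n) (Fin n) ℝ) (m : ℕ) (u : Fin n → ℝ) :
    adj A T (m + 1) u = adj A T m ((1 - T * A)ᵀ *ᵥ u) := rfl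

lemma dualEnergy_adj_le {ρ : ℝ}
    (hc : ∀ u, dualEnergy A ((1 - T * A)ᵀ *ᵥ u) ≤ ρ ^ 2 * dualEnergy A u) (m : ℕ)
    (u : Fin n → ℝ) : dualEnergy A (adj A T m u) ≤ (ρ ^ m) ^ 2 * dualEnergy A u := by
  induction m generalizing u with
  | zero => simp [adj]
  | succ m ih =>
    rw [adj_succ]
    calc _ ≤ (ρ ^ m) ^ 2 * dualEnergy A ((1 - T * A)ᵀ *ᵥ u) := ih _
      _ ≤ (ρ ^ m) ^ 2 * (ρ ^ 2 * dualEnergy A u) := by gcongr; exact hc u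
      _ = _ := by ring

lemma chain_memLp (h : IsMarkovChain (corrLaw A T f) P θ)
    (hT : (covT A T).PosSemidef) (h0 : ∀ u, MemLp (fun ω => lin u (θ 0 ω)) 2 P) (m : ℕ) :
    ∀ u, MemLp (fun ω => lin u (θ m ω)) 2 P := by
  induction m with
  | zero => exact h0
  | succ m ih => exact next_memLp h hT ih

/-- The posterior mean `A⁻¹ f` is a fixed point of the mean recursion, so deviations are transported
by the adjoint iteration without source term. -/
lemma chain_mean (hA : A.PosDef) (h : IsMarkovChain (corrLaw A T f) P θ)
    (hT : (covT A T).PosSemidef) (h0 : ∀ u, MemLp (fun ω => lin u (θ 0 ω)) 2 P) (m : ℕ)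
    (u : Fin n → ℝ) : ∫ ω, lin u (θ m ω) ∂P - lin u (app A⁻¹ f) =
      ∫ ω, lin (adj A T m u) (θ 0 ω) ∂P - lin (adj A T m u) (app A⁻¹ f) := by
  induction m generalizing u with
  | zero => rfl
  | succ m ih =>
    rw [next_mean h hT (chain_memLp h hT h0 m), adj_succ, ← ih]
    have : lin u (app T f) + lin ((1 - T * A)ᵀ *ᵥ u) (app A⁻¹ f) = lin u (app A⁻¹ f) := by
      rw [← lin_app, ← lin_add, ← mul_app, ← add_app, Matrix.sub_mul, Matrix.mul_assoc,
        PosDef.mul_inv hA, Matrix.one_mul, Matrix.mul_one, add_sub_cancel]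
    linarith

lemma chain_var (hA : A.PosDef) (h : IsMarkovChain (corrLaw A T f) P θ)
    (hT : (covT A T).PosSemidef) (h0 : ∀ u, MemLp (fun ω => lin u (θ 0 ω)) 2 P) (m : ℕ)
    (u : Fin n → ℝ) : Var[fun ω => lin u (θ m ω); P] - dualEnergy A u =
      Var[fun ω => lin (adj A T m u) (θ 0 ω); P] - dualEnergy A (adj A T m u) := by
  induction m generalizing u with
  | zero => rfl
  | succ m ih =>
    rw [next_var h hT (chain_memLp h hT h0 m), adj_succ, ← ih]
    -- Stationarity of the posterior covariance; subtracting it from the variance recursion cancels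
    -- the noise term.
    have e : A⁻¹ = covT A T + (1 - T * A) * A⁻¹ * (1 - T * A)ᵀ := by
      have h1 : (1 - T * A) * A⁻¹ = A⁻¹ - T := by
        rw [Matrix.sub_mul, Matrix.mul_assoc, PosDef.mul_inv hA, Matrix.one_mul, Matrix.mul_one]
      rw [h1, covT, transpose_sub, transpose_one, transpose_mul, PosDef.transpose_eq hA,
        Matrix.mul_sub, Matrix.mul_one, Matrix.sub_mul, ← Matrix.mul_assoc, PosDef.inv_mul hA,
        Matrix.one_mul, ← Matrix.mul_assoc]
      abel
    have : dualEnergy A u = u ⬝ᵥ (covT A T *ᵥ u) + dualEnergy A ((1 - T * A)ᵀ *ᵥ u) := by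
      conv_lhs => rw [dualEnergy, e, add_mulVec, dotProduct_add]
      congr 1
      rw [← mulVec_mulVec, ← mulVec_mulVec, dotProduct_mulVec, ← mulVec_transpose]
      rfl
    linarith

lemma chain_cov (h : IsMarkovChain (corrLaw A T f) P θ)
    (hT : (covT A T).PosSemidef) (h0 : ∀ u, MemLp (fun ω => lin u (θ 0 ω)) 2 P) (m s : ℕ)
    (u v : Fin n → ℝ) : cov[fun ω => lin u (θ (m + s) ω), fun ω => lin v (θ m ω); P] =
      cov[fun ω => lin (adj A T s u) (θ m ω), fun ω => lin v (θ m ω); P] := by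
  induction s generalizing u with
  | zero => rfl
  | succ s ih =>
    rw [← add_assoc, next_cov h hT (Nat.le_add_right m s) (chain_memLp h hT h0), ih, adj_succ]

lemma var_lin_eq_covMat {X : Ω → E n} (hX : Measurable X)
    (hL : ∀ u, MemLp (fun ω => lin u (X ω)) 2 P) (u : Fin n → ℝ) :
    Var[fun ω => lin u (X ω); P] = u ⬝ᵥ (covMat P X *ᵥ u) := by
  have hi : ∀ i, MemLp (fun ω => u i * X ω i) 2 P := fun i => by
    have := (hL (Pi.single i 1)).const_mul (u i)
    simpa [lin] using this
  have e : (fun ω => lin u (X ω)) = fun ω => ∑ i, u i * X ω i := rfl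
  have hm : AEMeasurable (fun ω => lin u (X ω)) P := ((measurable_lin u).comp hX).aemeasurable
  rw [← covariance_self hm, e, covariance_fun_sum_fun_sum hi hi]
  simp only [covariance_const_mul_left, covariance_const_mul_right, dotProduct, mulVec, covMat,
    of_apply, Finset.mul_sum]
  refine Finset.sum_congr rfl fun i _ => Finset.sum_congr rfl fun j _ => by ring

/-- Convergence of mean and variance. -/
lemma chain_convergence (hA : A.PosDef) (h : IsMarkovChain (corrLaw A T f) P θ)
    (hT : (covT A T).PosSemidef) (hG : IsGaussian (P.map (θ 0))) {ρ : ℝ} (hρ : 0 ≤ ρ)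
    (hc : ∀ u, dualEnergy A ((1 - T * A)ᵀ *ᵥ u) ≤ ρ ^ 2 * dualEnergy A u) {C₀ cF cf : ℝ}
    (hC₁ : ‖app (CFC.sqrt A) (∫ ω, θ 0 ω ∂P)‖ ≤ C₀)
    (hC₂ : ‖CFC.sqrt A * covMat P (θ 0) * CFC.sqrt A‖ ≤ C₀)
    {u : Fin n → ℝ} (hcF : 0 ≤ cF) (hcf : 0 ≤ cf) (hF : dualEnergy A u ≤ cF ^ 2)
    (hf : dualEnergy A f.ofLp ≤ cf ^ 2) (m : ℕ) :
    |∫ ω, lin u (θ m ω) ∂P - lin u (app A⁻¹ f)| ≤ cF * (C₀ + cf) * ρ ^ m ∧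
    |Var[fun ω => lin u (θ m ω); P] - dualEnergy A u| ≤ cF ^ 2 * (C₀ + 1) * (ρ ^ m) ^ 2 := by
  have hm := h.measurable 0
  have h0 : ∀ u, MemLp (fun ω => lin u (θ 0 ω)) 2 P := fun u =>
    (memLp_map_measure_iff (by fun_prop) hm.aemeasurable).1 (memLp_lin hG u)
  have hC₀ : 0 ≤ C₀ := (norm_nonneg _).trans hC₁
  have hq := dualEnergy_adj_le hc m u
  have hq2 : dualEnergy A (adj A T m u) ≤ (ρ ^ m * cF) ^ 2 := by
    rw [mul_pow]
    exact hq.trans (by gcongr)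
  have hq0 := dualEnergy_nonneg hA (adj A T m u)
  have hρm : 0 ≤ ρ ^ m := pow_nonneg hρ m
  constructor
  · rw [chain_mean hA h hT h0]
    have e1 : ∫ ω, lin (adj A T m u) (θ 0 ω) ∂P = lin (adj A T m u) (∫ ω, θ 0 ω ∂P) := by
      have h1 := integral_lin hG (adj A T m u)
      rw [integral_map hm.aemeasurable (by fun_prop),
        integral_map hm.aemeasurable (by fun_prop)] at h1
      exact h1
    have h2 := abs_lin_le hA (adj A T m u) (∫ ω, θ 0 ω ∂P)
    have h3 := abs_lin_le hA (adj A T m u) (app A⁻¹ f)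
    rw [norm_sqrt_app_inv hA] at h3
    have h4 : Real.sqrt (dualEnergy A (adj A T m u)) ≤ ρ ^ m * cF :=
      Real.sqrt_le_iff.2 ⟨by positivity, hq2⟩
    have h5 : Real.sqrt (dualEnergy A f.ofLp) ≤ cf := Real.sqrt_le_iff.2 ⟨hcf, hf⟩
    rw [e1]
    calc _ ≤ |lin (adj A T m u) (∫ ω, θ 0 ω ∂P)| + |lin (adj A T m u) (app A⁻¹ f)| := abs_sub _ _
      _ ≤ ρ ^ m * cF * C₀ + ρ ^ m * cF * cf := by
        refine add_le_add (h2.trans ?_) (h3.trans ?_) <;> gcongr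
      _ = _ := by ring
  · rw [chain_var hA h hT h0]
    have h2 := dotProduct_mulVec_le_dualEnergy hA (covMat P (θ 0)) (adj A T m u)
    rw [← var_lin_eq_covMat hm h0] at h2
    have h3 := variance_nonneg (fun ω => lin (adj A T m u) (θ 0 ω)) P
    have h4 : Var[fun ω => lin (adj A T m u) (θ 0 ω); P] ≤ C₀ * (ρ ^ m * cF) ^ 2 :=
      h2.trans (by gcongr)
    have h6 : 0 ≤ C₀ * (ρ ^ m * cF) ^ 2 := by positivity
    -- The error is a difference of two nonnegative numbers, at most `C₀ (ρᵐ cF)²` and `(ρᵐ cF)²`.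
    rw [abs_le]
    constructor <;> nlinarith

/-- Bound for the integrated autocorrelation time. -/
lemma chain_autocorrelation (hA : A.PosDef) (h : IsMarkovChain (corrLaw A T f) P θ)
    (hT : (covT A T).PosSemidef) (hG : IsGaussian (P.map (θ 0))) {ρ : ℝ} (hρ : 0 < ρ)
    (hρ1 : ρ < 1)
    (hc : ∀ u, dualEnergy A ((1 - T * A)ᵀ *ᵥ u) ≤ ρ ^ 2 * dualEnergy A u) {C₀ : ℝ}
    (hC₂ : ‖CFC.sqrt A * covMat P (θ 0) * CFC.sqrt A‖ ≤ C₀)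
    (u : Fin n → ℝ) (m : ℕ) (hm1 : 1 ≤ m) :
    (u ≠ 0 → 0 < Var[fun ω => lin u (θ m ω); P]) ∧
    Summable (fun s => autocorr P (fun k ω => lin u (θ k ω)) m (s + 1)) ∧
    |iact P (fun k ω => lin u (θ k ω)) m| ≤ 1 + 2 * ((1 + C₀) / (1 - ρ ^ 2) * (1 - ρ)⁻¹) := by
  have hm := h.measurable 0
  have h0 : ∀ u, MemLp (fun ω => lin u (θ 0 ω)) 2 P := fun u =>
    (memLp_map_measure_iff (by fun_prop) hm.aemeasurable).1 (memLp_lin hG u)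
  have hC₀ : 0 ≤ C₀ := (norm_nonneg _).trans hC₂
  have hρ2 : 0 < 1 - ρ ^ 2 := by nlinarith
  have hρm : (ρ ^ m) ^ 2 ≤ ρ ^ 2 := by
    gcongr
    exact pow_le_of_le_one hρ.le hρ1.le (by omega)
  have hρm1 : (ρ ^ m) ^ 2 ≤ 1 := by nlinarith
  -- This is where `1 ≤ m` matters: the initial law may be degenerate, but after one step the
  -- injected noise keeps the variance away from zero.
  have lower : ∀ u, (1 - ρ ^ 2) * dualEnergy A u ≤ Var[fun ω => lin u (θ m ω); P] := by
    intro u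
    have h1 := chain_var hA h hT h0 m u
    have h2 := dualEnergy_adj_le hc m u
    have h3 := variance_nonneg (fun ω => lin (adj A T m u) (θ 0 ω)) P
    have h4 := mul_le_mul_of_nonneg_right hρm (dualEnergy_nonneg hA u)
    linarith
  have upper : ∀ u, Var[fun ω => lin u (θ m ω); P] ≤ (1 + C₀) * dualEnergy A u := by
    intro u
    have h1 := chain_var hA h hT h0 m u
    have h2 := dotProduct_mulVec_le_dualEnergy hA (covMat P (θ 0)) (adj A T m u)
    rw [← var_lin_eq_covMat hm h0] at h2
    have h3 := dualEnergy_nonneg hA (adj A T m u)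
    have h4 := dualEnergy_adj_le hc m u
    have h5 := mul_le_mul_of_nonneg_right hρm1 (dualEnergy_nonneg hA u)
    have h6 := mul_le_mul_of_nonneg_right hC₂ h3
    have h7 := mul_le_mul_of_nonneg_left (h4.trans h5) hC₀
    linarith
  have hpos : u ≠ 0 → 0 < Var[fun ω => lin u (θ m ω); P] := fun hu =>
    (mul_pos hρ2 (dualEnergy_pos hA hu)).trans_le (lower u)
  -- The ratio of the upper to the lower variance bound. It compensates for the chain not being
  -- stationary at time `m`.
  set K := (1 + C₀) / (1 - ρ ^ 2) with hK
  have hK0 : 0 ≤ K := by positivity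
  have hbound : ∀ s, |autocorr P (fun k ω => lin u (θ k ω)) m (s + 1)| ≤ K * ρ ^ s := by
    intro s
    -- For `u = 0` the quotient is `0 / 0 = 0`.
    by_cases hu : u = 0
    · have : (fun ω => lin u (θ m ω)) = 0 := by
        funext ω; simp [lin, hu]
      have e : autocorr P (fun k ω => lin u (θ k ω)) m (s + 1) = 0 := by
        simp only [autocorr, this]; simp
      rw [e, abs_zero]
      positivity
    · have hV := hpos hu
      have hq := dualEnergy_pos hA hu
      have hmm : AEMeasurable (fun ω => lin u (θ m ω)) P :=
        ((measurable_lin u).comp (h.measurable m)).aemeasurable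
      simp only [autocorr]
      rw [covariance_self hmm, chain_cov h hT h0, abs_div, abs_of_pos hV, div_le_iff₀ hV]
      have hL := chain_memLp h hT h0 m
      have h1 : Var[fun ω => lin (adj A T (s + 1) u) (θ m ω); P] ≤
          (ρ ^ (s + 1)) ^ 2 * ((1 + C₀) * dualEnergy A u) := by
        refine (upper _).trans ?_
        have := mul_le_mul_of_nonneg_left (dualEnergy_adj_le hc (s + 1) u)
          (by linarith : 0 ≤ 1 + C₀)
        linarith
      refine (abs_covariance_le (hL _) (hL u) (pow_pos hρ (s + 1)) h1 (upper u)).trans ?_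
      have h2 : (1 + C₀) * dualEnergy A u ≤ K * Var[fun ω => lin u (θ m ω); P] := by
        have := mul_le_mul_of_nonneg_left (lower u) hK0
        rw [← mul_assoc, hK, div_mul_cancel₀ _ hρ2.ne'] at this
        exact this
      have h3 : ρ ^ (s + 1) ≤ ρ ^ s := pow_le_pow_of_le_one hρ.le hρ1.le (Nat.le_succ s)
      calc ρ ^ (s + 1) * ((1 + C₀) * dualEnergy A u)
          ≤ ρ ^ s * (K * Var[fun ω => lin u (θ m ω); P]) := by gcongr
        _ = _ := by ring
  have hgeom : HasSum (fun s : ℕ => K * ρ ^ s) (K * (1 - ρ)⁻¹) :=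
    (hasSum_geometric_of_lt_one hρ.le hρ1).mul_left K
  refine ⟨hpos, Summable.of_norm_bounded hgeom.summable hbound, ?_⟩
  have hsum := tsum_of_norm_bounded
    (f := fun s => autocorr P (fun k ω => lin u (θ k ω)) m (s + 1)) hgeom hbound
  rw [Real.norm_eq_abs] at hsum
  rw [iact]
  refine (abs_add_le _ _).trans ?_
  rw [abs_one, abs_mul, abs_two]
  linarith

end ChainBounds

end MGMC

namespace MGMC

/-! ### Cost calculus for matrix-vector products and triangular solves. -/

section Reach

/-- The memory of the machine. -/
abbrev Mem : Type := ℕ → ℝ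

/-- The functions of the input that one arithmetic instruction computes from those in `X`. -/
inductive Elementary (X : Set (Mem → ℝ)) : (Mem → ℝ) → Prop
  | const (c : ℝ) : Elementary X fun _ => c
  | add {f g : Mem → ℝ} : f ∈ X → g ∈ X → Elementary X fun v => f v + g v
  | sub {f g : Mem → ℝ} : f ∈ X → g ∈ X → Elementary X fun v => f v - g v
  | mul {f g : Mem → ℝ} : f ∈ X → g ∈ X → Elementary X fun v => f v * g v

/-- From the functions in `X`, all functions in `Y` can be computed with at most `c` operations. -/
inductive Reach : Set (Mem → ℝ) → ℕ → Set (Mem → ℝ) → Prop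
  | done {X Y : Set (Mem → ℝ)} {c : ℕ} : Y ⊆ X → Reach X c Y
  | step {X Y : Set (Mem → ℝ)} {c : ℕ} {f : Mem → ℝ} :
      Elementary X f → Reach (insert f X) c Y → Reach X (c + 1) Y

variable {X X' Y Z W : Set (Mem → ℝ)} {c d : ℕ}

lemma Elementary.mono (h : X ⊆ X') {f : Mem → ℝ} (hf : Elementary X f) : Elementary X' f := by
  cases hf with
  | const c => exact .const c
  | add a b => exact .add (h a) (h b)
  | sub a b => exact .sub (h a) (h b)
  | mul a b => exact .mul (h a) (h b)

lemma Reach.mono (h : Reach X c Y) (hX : X ⊆ X') (hZ : Z ⊆ Y) (hd : c ≤ d) :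
    Reach X' d Z := by
  induction h generalizing X' d with
  | done h => exact .done (hZ.trans (h.trans hX))
  | step hf _ ih =>
    obtain ⟨e, rfl⟩ : ∃ e, d = e + 1 := ⟨d - 1, by omega⟩
    exact .step (hf.mono hX) (ih (Set.insert_subset_insert hX) hZ (by omega))

/-- Computed values are only added, never overwritten, so intermediate results stay available for
later stages. -/
lemma Reach.keep (h : Reach X c Y) (hW : W ⊆ X) : Reach X c (W ∪ Y) := by
  induction h with
  | done h => exact .done (Set.union_subset hW h)
  | step hf _ ih => exact .step hf (ih (hW.trans (Set.subset_insert _ _)))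

lemma Reach.trans (h : Reach X c Y) (h' : Reach (X ∪ Y) d Z) : Reach X (c + d) Z := by
  induction h with
  | done h => exact h'.mono (Set.union_subset subset_rfl h) subset_rfl (by omega)
  | @step X Y c f hf _ ih =>
    have := ih (h'.mono (Set.union_subset_union (Set.subset_insert _ _) subset_rfl) subset_rfl
      le_rfl)
    rw [Nat.add_right_comm]
    exact .step hf this

lemma Reach.trans_keep (h : Reach X c Y) (h' : Reach (X ∪ Y) d Z) : Reach X (c + d) (Y ∪ Z) :=
  h.trans (h'.keep Set.subset_union_right)

lemma Elementary.reach {f : Mem → ℝ} (hf : Elementary X f) : Reach X 1 {f} :=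
  .step hf (.done (by simp))

lemma Reach.range {κ : Type*} [Fintype κ] {g : κ → Mem → ℝ} (h : ∀ k, Reach X c {g k}) :
    Reach X (Fintype.card κ * c) (Set.range g) := by
  classical
  have : ∀ s : Finset κ, Reach X (s.card * c) (g '' s) := by
    intro s
    induction s using Finset.induction_on with
    | empty => exact .done (by simp)
    | insert a s ha ih =>
      have := ih.trans_keep ((h a).mono Set.subset_union_left subset_rfl le_rfl)
      rw [Finset.card_insert_of_notMem ha, add_mul, one_mul]
      refine this.mono subset_rfl ?_ le_rfl
      rw [Finset.coe_insert, Set.image_insert_eq, Set.union_singleton]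
  simpa using this Finset.univ

/-- Each term costs a load, a multiplication and an addition; the extra operation loads the initial
zero. -/
lemma Reach.sum {ι : Type*} (t : Finset ι) (a : ι → ℝ) {x : ι → Mem → ℝ}
    (hx : ∀ i ∈ t, x i ∈ X) : Reach X (3 * t.card + 1) {fun v => ∑ i ∈ t, a i * x i v} := by
  classical
  induction t using Finset.induction_on with
  | empty => simpa using (Elementary.const (X := X) 0).reach
  | insert j t hj ih =>
    have h1 := ih fun i hi => hx i (Finset.mem_insert_of_mem hi)
    rw [Finset.card_insert_of_notMem hj,
      show 3 * (t.card + 1) + 1 = 3 * t.card + 1 + 3 by ring]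
    refine h1.trans ?_
    refine .step (.const (a j)) (.step (.mul (f := fun _ => a j) (g := x j) ?_ ?_)
      (.step (.add (f := fun v => a j * x j v) (g := fun v => ∑ i ∈ t, a i * x i v) ?_ ?_)
        (.done ?_)))
    · simp
    · exact Set.mem_insert_of_mem _ (.inl (hx j (Finset.mem_insert_self _ _)))
    · exact Set.mem_insert _ _
    · exact Set.mem_insert_of_mem _ (Set.mem_insert_of_mem _ (.inr rfl))
    · simp only [Finset.sum_insert hj]
      rw [Set.singleton_subset_iff]
      exact Set.mem_insert _ _

/-- The coordinate functions of a vector-valued function. -/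
def coords {a : Type*} (x : Mem → a → ℝ) : Set (Mem → ℝ) := Set.range fun i v => x v i

variable {a b n : Type*} [Fintype a] [Fintype b] [Fintype n]

lemma Reach.add {x y : Mem → a → ℝ} (hx : coords x ⊆ X) (hy : coords y ⊆ X) :
    Reach X (Fintype.card a) (coords fun v => x v + y v) := by
  have := Reach.range (X := X) (c := 1) (g := fun i v => x v i + y v i)
    fun i => (Elementary.add (hx ⟨i, rfl⟩) (hy ⟨i, rfl⟩)).reach
  rwa [mul_one] at this

lemma Reach.sub {x y : Mem → a → ℝ} (hx : coords x ⊆ X) (hy : coords y ⊆ X) :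
    Reach X (Fintype.card a) (coords fun v => x v - y v) := by
  have := Reach.range (X := X) (c := 1) (g := fun i v => x v i - y v i)
    fun i => (Elementary.sub (hx ⟨i, rfl⟩) (hy ⟨i, rfl⟩)).reach
  rwa [mul_one] at this

lemma Reach.const (x : a → ℝ) : Reach X (Fintype.card a) (coords fun _ => x) := by
  have := Reach.range (X := X) (c := 1) (g := fun i _ => x i)
    fun i => (Elementary.const (x i)).reach
  rwa [mul_one] at this

/-- The matrix-vector product with `N` can be computed with at most `c` operations. -/
def MatCost (N : Matrix a b ℝ) (c : ℕ) : Prop :=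
  ∀ x : Mem → b → ℝ, Reach (coords x) c (coords fun v => N *ᵥ x v)

lemma MatCost.mono {N : Matrix a b ℝ} (h : MatCost N c) (hcd : c ≤ d) : MatCost N d :=
  fun x => (h x).mono subset_rfl subset_rfl hcd

lemma MatCost.reach {N : Matrix a b ℝ} (h : MatCost N c) {x : Mem → b → ℝ} (hx : coords x ⊆ X) :
    Reach X c (coords fun v => N *ᵥ x v) :=
  (h x).mono hx subset_rfl le_rfl

lemma matCost_one [DecidableEq a] : MatCost (1 : Matrix a a ℝ) 0 :=
  fun x => .done (by simp)

lemma MatCost.mul {N : Matrix a n ℝ} {N' : Matrix n b ℝ} (h : MatCost N c) (h' : MatCost N' d) :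
    MatCost (N * N') (c + d) := by
  intro x
  rw [add_comm]
  refine (h' x).trans ?_
  have := h.reach (X := coords x ∪ coords fun v => N' *ᵥ x v) Set.subset_union_right
  simpa [mulVec_mulVec] using this

lemma MatCost.add {N N' : Matrix a b ℝ} (h : MatCost N c) (h' : MatCost N' d) :
    MatCost (N + N') (c + d + Fintype.card a) := by
  intro x
  refine ((h x).trans_keep (h'.reach Set.subset_union_left)).trans ?_
  simp only [add_mulVec]
  exact Reach.add (Set.subset_union_left.trans Set.subset_union_right)
    (Set.subset_union_right.trans Set.subset_union_right)

lemma MatCost.sub {N N' : Matrix a b ℝ} (h : MatCost N c) (h' : MatCost N' d) :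
    MatCost (N - N') (c + d + Fintype.card a) := by
  intro x
  refine ((h x).trans_keep (h'.reach Set.subset_union_left)).trans ?_
  simp only [sub_mulVec]
  exact Reach.sub (Set.subset_union_left.trans Set.subset_union_right)
    (Set.subset_union_right.trans Set.subset_union_right)

lemma coords_comp_subset {a b : Type*} (x : Mem → a → ℝ) (e : b → a) :
    coords (fun v => x v ∘ e) ⊆ coords x := by
  rintro _ ⟨i, rfl⟩
  exact ⟨e i, rfl⟩

lemma MatCost.fromCols {N : Matrix a n ℝ} {N' : Matrix a b ℝ} (h : MatCost N c)
    (h' : MatCost N' d) : MatCost (Matrix.fromCols N N') (c + d + Fintype.card a) := by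
  intro x
  have h1 := h.reach (coords_comp_subset x Sum.inl)
  have h2 := h'.reach (X := coords x ∪ coords fun v => N *ᵥ (x v ∘ Sum.inl))
    ((coords_comp_subset x Sum.inr).trans Set.subset_union_left)
  refine (h1.trans_keep h2).trans ?_
  simp only [fromCols_mulVec]
  exact Reach.add (Set.subset_union_left.trans Set.subset_union_right)
    (Set.subset_union_right.trans Set.subset_union_right)

lemma matCost_of_sparse {N : Matrix a b ℝ} {s : ℕ} (h : ∀ i, {j | N i j ≠ 0}.ncard ≤ s) :
    MatCost N (Fintype.card a * (3 * s + 1)) := by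
  classical
  intro x
  refine Reach.range fun i => ?_
  have h1 := Reach.sum (X := coords x) (Finset.univ.filter fun j => N i j ≠ 0) (N i)
    (x := fun j v => x v j) fun j _ => ⟨j, rfl⟩
  have h2 : (Finset.univ.filter fun j => N i j ≠ 0).card ≤ s := by
    rw [← Set.ncard_coe_finset]
    simpa using h i
  have h3 : (fun v => (N *ᵥ x v) i) =
      fun v => ∑ j ∈ Finset.univ.filter (fun j => N i j ≠ 0), N i j * x v j := by
    funext v
    rw [Finset.sum_filter_of_ne]
    · rfl
    · intro j _ hj h0
      simp [h0] at hj
  rw [h3]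
  exact h1.mono subset_rfl subset_rfl (by omega)

lemma matCost_dense (N : Matrix a b ℝ) :
    MatCost N (Fintype.card a * (3 * Fintype.card b + 1)) :=
  matCost_of_sparse fun i => by
    rw [← Nat.card_eq_fintype_card, ← Set.ncard_univ]
    exact Set.ncard_le_ncard (Set.subset_univ _)

/-- Solving a sparse triangular system by substitution. The elimination order is `ord`. -/
lemma matCost_inv_of_triangular {m s : ℕ} {Λ : Matrix (Fin m) (Fin m) ℝ} (ord : Fin m → ℕ)
    (hord : ∀ i, ord i < m) (hinj : Function.Injective ord)
    (htri : ∀ i j, Λ i j ≠ 0 → i ≠ j → ord j < ord i) (hdiag : ∀ i, Λ i i ≠ 0)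
    (hunit : IsUnit Λ.det) (h : ∀ i, {j | Λ i j ≠ 0}.ncard ≤ s) :
    MatCost Λ⁻¹ (m * (3 * s + 4)) := by
  classical
  intro b
  set x : Mem → Fin m → ℝ := fun v => Λ⁻¹ *ᵥ b v with hx
  have hsol : ∀ v, Λ *ᵥ x v = b v := fun v => by
    rw [hx, mulVec_mulVec, Matrix.mul_nonsing_inv _ hunit, one_mulVec]
  let t : Fin m → Finset (Fin m) := fun i => Finset.univ.filter fun j => Λ i j ≠ 0 ∧ i ≠ j
  -- Forward substitution. The reciprocal pivot is a preloaded constant, so no division is needed at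
  -- run time; a row costs `3s + 1` for the sum and three more operations.
  have hrow : ∀ i v, x v i = (Λ i i)⁻¹ * (b v i - ∑ j ∈ t i, Λ i j * x v j) := by
    intro i v
    have h1 : ∑ j, Λ i j * x v j = b v i := congrFun (hsol v) i
    rw [← Finset.add_sum_erase _ _ (Finset.mem_univ i)] at h1
    have h2 : ∑ j ∈ Finset.univ.erase i, Λ i j * x v j = ∑ j ∈ t i, Λ i j * x v j := by
      symm
      refine Finset.sum_subset (fun j hj => ?_) fun j hj hj' => ?_
      · have := (Finset.mem_filter.1 hj).2.2
        exact Finset.mem_erase.2 ⟨this.symm, Finset.mem_univ _⟩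
      · have h3 := (Finset.mem_erase.1 hj).1
        have : Λ i j = 0 := by
          by_contra h0
          exact hj' (Finset.mem_filter.2 ⟨Finset.mem_univ _, h0, h3.symm⟩)
        rw [this, zero_mul]
    rw [h2] at h1
    rw [← h1, add_sub_cancel_right, inv_mul_cancel_left₀ (hdiag i)]
  have hcard : ∀ i, (t i).card ≤ s := fun i => by
    rw [← Set.ncard_coe_finset]
    refine le_trans (Set.ncard_le_ncard ?_) (h i)
    intro j hj
    exact (Finset.mem_filter.1 hj).2.1
  have key : ∀ k ≤ m, Reach (coords b) (k * (3 * s + 4))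
      {g | ∃ i, ord i < k ∧ g = fun v => x v i} := by
    intro k
    induction k with
    | zero => exact fun _ => .done (by rintro g ⟨i, hi, _⟩; omega)
    | succ k ih =>
      intro hk
      have ih' := ih (by omega)
      by_cases hi : ∃ i, ord i = k
      · obtain ⟨i, hi⟩ := hi
        rw [add_mul, one_mul]
        set S := {g | ∃ i, ord i < k ∧ g = fun v => x v i} with hS
        have hsum := Reach.sum (X := coords b ∪ S) (t i) (Λ i) (x := fun j v => x v j) fun j hj => by
          obtain ⟨h1, h2⟩ := (Finset.mem_filter.1 hj).2
          exact .inr ⟨j, hi ▸ htri i j h1 h2, rfl⟩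
        have hnew : Reach (coords b ∪ S) (3 * s + 4) {fun v => x v i} := by
          refine (hsum.trans (d := 3) ?_).mono subset_rfl subset_rfl
            (by have := hcard i; omega)
          refine .step (.sub (f := fun v => b v i) (g := fun v => ∑ j ∈ t i, Λ i j * x v j)
            (.inl (.inl ⟨i, rfl⟩)) (.inr rfl)) (.step (.const (Λ i i)⁻¹) (.step (.mul
              (f := fun _ => (Λ i i)⁻¹) (g := fun v => b v i - ∑ j ∈ t i, Λ i j * x v j)
              (Set.mem_insert _ _) (Set.mem_insert_of_mem _ (Set.mem_insert _ _))) (.done ?_)))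
          rw [Set.singleton_subset_iff, show (fun v => x v i) = _ from funext fun v => hrow i v]
          exact Set.mem_insert _ _
        refine (ih'.trans_keep hnew).mono subset_rfl ?_ le_rfl
        rintro g ⟨j, hj, rfl⟩
        rcases Nat.lt_succ_iff_lt_or_eq.1 hj with hj | hj
        · exact .inl ⟨j, hj, rfl⟩
        · exact .inr (by rw [hinj (hj.trans hi.symm)]; rfl)
      · refine ih'.mono subset_rfl ?_ (by gcongr; omega)
        rintro g ⟨j, hj, rfl⟩
        have : ord j ≠ k := fun h => hi ⟨j, h⟩
        have hj' : ord j < k + 1 := hj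
        exact ⟨j, by omega, rfl⟩
  refine (key m le_rfl).mono subset_rfl ?_ le_rfl
  rintro _ ⟨i, rfl⟩
  exact ⟨i, hord i, rfl⟩

/-- A product with an inner dimension `q` independent of the size. -/
lemma matCost_lowRank {m q : ℕ} (hm : 0 < m) (U : Matrix (Fin m) (Fin q) ℝ)
    (N : Matrix (Fin q) (Fin m) ℝ) : MatCost (U * N) ((7 * q + 1) * m) := by
  refine ((matCost_dense U).mul (matCost_dense N)).mono ?_
  simp only [Fintype.card_fin]
  have : q ≤ q * m := Nat.le_mul_of_pos_right q hm
  nlinarith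

/-- A low-rank update of an efficiently invertible matrix is efficiently invertible. -/
lemma matCost_inv_add_lowRank {m q : ℕ} (hm : 0 < m) {Λ : Matrix (Fin m) (Fin m) ℝ}
    {U : Matrix (Fin m) (Fin q) ℝ} {N : Matrix (Fin q) (Fin m) ℝ} (hΛ : IsUnit Λ.det)
    (hΛ' : IsUnit (Λ + U * N).det) (hc : MatCost Λ⁻¹ (c * m)) :
    MatCost (Λ + U * N)⁻¹ ((7 * q + 2 + c) * m) := by
  -- A Woodbury-type identity in which `(Λ + U N)⁻¹ U` is a fixed tall matrix with `q` columns,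
  -- prepared at set-up. Applying the inverse then costs one `Λ`-solve and one low-rank product.
  have e : (Λ + U * N)⁻¹ = (1 - ((Λ + U * N)⁻¹ * U) * N) * Λ⁻¹ := by
    have h1 : (Λ + U * N)⁻¹ * (Λ + U * N) = 1 := Matrix.nonsing_inv_mul _ hΛ'
    have h2 : 1 - ((Λ + U * N)⁻¹ * U) * N = (Λ + U * N)⁻¹ * Λ := by
      conv_lhs => rw [← h1]
      rw [Matrix.mul_add, Matrix.mul_assoc _ U]
      abel
    rw [h2, Matrix.mul_assoc, Matrix.mul_nonsing_inv _ hΛ, Matrix.mul_one]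
  rw [e]
  refine ((matCost_one.sub (matCost_lowRank hm _ _)).mul hc).mono (le_of_eq ?_)
  rw [Fintype.card_fin]
  ring

end Reach

/-! ### Samplers for Gaussian corrections and their composition. -/

section Sampler

variable {a b : ℕ}

/-- The Gaussian correction with approximate inverse `T` for the precision matrix `A` can be
computed from the residual with at most `c` operations and `k` independent standard normals. -/
def Sampler (A T : Matrix (Fin a) (Fin a) ℝ) (c k : ℕ) : Prop :=
  ∃ (κ : Type) (_ : Fintype κ) (Q : Matrix (Fin a) κ ℝ), Fintype.card κ ≤ k ∧
    Q * Qᵀ = covT A T ∧ ∀ (r : Mem → Fin a → ℝ) (z : Mem → κ → ℝ),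
      Reach (coords r ∪ coords z) c (coords fun v => T *ᵥ r v + Q *ᵥ z v)

lemma sampler_of_matCost {A T : Matrix (Fin a) (Fin a) ℝ} {κ : Type} [Fintype κ]
    {Ξ : Matrix (Fin a) κ ℝ} {c d : ℕ} (hΞ : T * (Ξ * Ξᵀ) * Tᵀ = covT A T) (h : MatCost T c)
    (h' : MatCost Ξ d) : Sampler A T (d + a + c) (Fintype.card κ) := by
  refine ⟨κ, inferInstance, T * Ξ, le_rfl, ?_, fun r z => ?_⟩
  · rw [← hΞ, transpose_mul]
    simp only [Matrix.mul_assoc]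
  · have h1 := h'.reach (X := coords r ∪ coords z) Set.subset_union_right
    have h2 := h1.trans (Reach.add (Set.subset_union_left.trans Set.subset_union_left)
      Set.subset_union_right)
    rw [Fintype.card_fin] at h2
    have h3 := h2.trans (h.reach Set.subset_union_right)
    simpa only [mulVec_add, mulVec_mulVec] using h3

/-- After the increment `d₁` the residual is `r - A d₁`; only this update (one product with `A`) and
two vector operations are added. Separate blocks of normals keep the two noises independent, and the
block matrix realises `covT_compT`. -/
lemma Sampler.comp {A T₁ T₂ : Matrix (Fin a) (Fin a) ℝ} {c₁ c₂ k₁ k₂ cA : ℕ} (hA : Aᵀ = A)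
    (hcA : MatCost A cA) (h₁ : Sampler A T₁ c₁ k₁) (h₂ : Sampler A T₂ c₂ k₂) :
    Sampler A (compT A T₁ T₂) (c₁ + c₂ + cA + 2 * a) (k₁ + k₂) := by
  obtain ⟨κ₁, i₁, Q₁, hk₁, hQ₁, hr₁⟩ := h₁
  obtain ⟨κ₂, i₂, Q₂, hk₂, hQ₂, hr₂⟩ := h₂
  refine ⟨κ₁ ⊕ κ₂, inferInstance, Matrix.fromCols ((1 - T₂ * A) * Q₁) Q₂, ?_, ?_, fun r z => ?_⟩
  · rw [Fintype.card_sum]; omega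
  · rw [transpose_fromCols, fromCols_mul_fromRows, covT_compT hA, ← hQ₁, ← hQ₂, transpose_mul]
    simp only [Matrix.mul_assoc]
  · set X := coords r ∪ coords z with hX
    set d₁ : Mem → Fin a → ℝ := fun v => T₁ *ᵥ r v + Q₁ *ᵥ (z v ∘ Sum.inl) with hd₁
    have s1 : Reach X c₁ (coords d₁) := (hr₁ r fun v => z v ∘ Sum.inl).mono
      (Set.union_subset_union subset_rfl (coords_comp_subset _ _)) subset_rfl le_rfl
    have s2 : Reach (X ∪ coords d₁) cA (coords fun v => A *ᵥ d₁ v) :=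
      hcA.reach Set.subset_union_right
    set r' : Mem → Fin a → ℝ := fun v => r v - A *ᵥ d₁ v with hr'
    have s3 : Reach (X ∪ coords d₁ ∪ coords fun v => A *ᵥ d₁ v) a (coords r') := by
      have := Reach.sub (X := X ∪ coords d₁ ∪ coords fun v => A *ᵥ d₁ v) (x := r)
        (y := fun v => A *ᵥ d₁ v) (by intro g hg; simp [hX, hg]) Set.subset_union_right
      rwa [Fintype.card_fin] at this
    have s23 := s2.trans s3
    set d₂ : Mem → Fin a → ℝ := fun v => T₂ *ᵥ r' v + Q₂ *ᵥ (z v ∘ Sum.inr) with hd₂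
    have s4 : Reach (X ∪ coords d₁ ∪ coords r') c₂ (coords d₂) :=
      (hr₂ r' fun v => z v ∘ Sum.inr).mono (Set.union_subset Set.subset_union_right
        (fun g hg => .inl (.inl (.inr (coords_comp_subset _ _ hg))))) subset_rfl le_rfl
    have s234 := s23.trans s4
    have s5 : Reach (X ∪ coords d₁ ∪ coords d₂) a (coords fun v => d₁ v + d₂ v) := by
      have := Reach.add (X := X ∪ coords d₁ ∪ coords d₂) (x := d₁) (y := d₂)
        (fun g hg => .inl (.inr hg)) Set.subset_union_right
      rwa [Fintype.card_fin] at this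
    have s := s1.trans (s234.trans s5)
    have e : (fun v => compT A T₁ T₂ *ᵥ r v + Matrix.fromCols ((1 - T₂ * A) * Q₁) Q₂ *ᵥ z v) =
        fun v => d₁ v + d₂ v := by
      funext v
      rw [fromCols_mulVec, hd₂, hr', hd₁, compT]
      simp only [sub_mulVec, add_mulVec, mulVec_sub, mulVec_add, Matrix.sub_mul, Matrix.one_mul,
        ← mulVec_mulVec]
      abel
    rw [e]
    exact s.mono subset_rfl subset_rfl (by omega)

lemma sampler_zero (A : Matrix (Fin a) (Fin a) ℝ) : Sampler A 0 a 0 := by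
  refine ⟨Fin 0, inferInstance, 0, by simp, by simp [covT], fun r z => ?_⟩
  simpa using Reach.const (X := coords r ∪ coords z) (0 : Fin a → ℝ)

lemma Sampler.mono {A T : Matrix (Fin a) (Fin a) ℝ} {c k c' k' : ℕ} (h : Sampler A T c k)
    (hc : c ≤ c') (hk : k ≤ k') : Sampler A T c' k' := by
  obtain ⟨κ, i, Q, h1, h2, h3⟩ := h
  exact ⟨κ, i, Q, h1.trans hk, h2, fun r z => (h3 r z).mono subset_rfl subset_rfl hc⟩

lemma Sampler.rep {A T : Matrix (Fin a) (Fin a) ℝ} {c k cA : ℕ} (hA : Aᵀ = A)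
    (hcA : MatCost A cA) (h : Sampler A T c k) (j : ℕ) :
    Sampler A (repT A T j) (j * (c + cA + 2 * a) + a) (j * k) := by
  induction j with
  | zero => simpa [repT] using sampler_zero A
  | succ j ih => exact (Sampler.comp hA hcA h ih).mono (by ring_nf; rfl) (by ring_nf; rfl)

lemma Sampler.coarse {A : Matrix (Fin a) (Fin a) ℝ} {A' T : Matrix (Fin b) (Fin b) ℝ}
    {J : Matrix (Fin a) (Fin b) ℝ} (hJ : Jᵀ * A * J = A') {c k cJ cJ' : ℕ}
    (hcJ : MatCost J cJ) (hcJ' : MatCost Jᵀ cJ') (h : Sampler A' T c k) :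
    Sampler A (J * T * Jᵀ) (cJ' + c + cJ) k := by
  obtain ⟨κ, i, Q, hk, hQ, hr⟩ := h
  refine ⟨κ, i, J * Q, hk, ?_, fun r z => ?_⟩
  · rw [covT_coarse hJ, ← hQ, transpose_mul]
    simp only [Matrix.mul_assoc]
  · have h1 := hcJ'.reach (X := coords r ∪ coords z) Set.subset_union_left
    have h2 := h1.trans ((hr (fun v => Jᵀ *ᵥ r v) z).mono (Set.union_subset
      Set.subset_union_right (Set.subset_union_right.trans Set.subset_union_left)) subset_rfl
      le_rfl)
    have h3 := h2.trans (hcJ.reach Set.subset_union_right)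
    simpa only [mulVec_add, mulVec_mulVec, Matrix.mul_assoc] using h3

end Sampler

end MGMC

namespace MGMC

/-! ### Compilation to straight-line programs. -/

section Machine

lemma measurable_update_cell (d : ℕ) :
    Measurable fun p : Mem × ℝ => Function.update p.1 d p.2 := by
  refine measurable_pi_lambda _ fun i => ?_
  by_cases h : i = d
  · subst h; simpa using measurable_snd
  · simp only [Function.update_of_ne h]
    fun_prop

lemma measurable_instr_run (c : Instr) : Measurable c.run := by
  have hupd : ∀ (d : ℕ) {g : (ℕ → ℝ) → ℝ}, Measurable g →
      Measurable fun w : ℕ → ℝ => Function.update w d (g w) := by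
    intro d g hg
    refine measurable_pi_lambda _ fun i => ?_
    by_cases h : i = d
    · subst h; simpa using hg
    · simpa [Function.update_of_ne h] using measurable_pi_apply i
  cases c with
  | const d c => exact Measure.measurable_dirac.comp (hupd d measurable_const)
  | add d i j => exact Measure.measurable_dirac.comp (hupd d (by fun_prop))
  | sub d i j => exact Measure.measurable_dirac.comp (hupd d (by fun_prop))
  | mul d i j => exact Measure.measurable_dirac.comp (hupd d (by fun_prop))
  | div d i j => exact Measure.measurable_dirac.comp (hupd d (by fun_prop))
  | normal d =>
    exact measurable_map_prodMk (g := fun (w : ℕ → ℝ) z => Function.update w d z) _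
      (measurable_update_cell d)

lemma measurable_runProgram (p : List Instr) : Measurable (runProgram p) := by
  induction p with
  | nil => exact Measure.measurable_dirac
  | cons c p ih => exact (Measure.measurable_bind' ih).comp (measurable_instr_run c)

lemma runProgram_append (p q : List Instr) (w : ℕ → ℝ) :
    runProgram (p ++ q) w = (runProgram p w).bind (runProgram q) := by
  induction p generalizing w with
  | nil => exact (Measure.dirac_bind (measurable_runProgram q) w).symm
  | cons c p ih =>
    have e : runProgram (c :: p ++ q) w = (c.run w).bind (runProgram (p ++ q)) := rfl
    have e' : runProgram (c :: p) w = (c.run w).bind (runProgram p) := rfl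
    rw [e, e', Measure.bind_bind (measurable_runProgram p).aemeasurable
      (measurable_runProgram q).aemeasurable]
    congr 1
    exact funext ih

lemma runProgram_append_of_dirac {p q : List Instr} {w w' : ℕ → ℝ}
    (h : runProgram p w = Measure.dirac w') : runProgram (p ++ q) w = runProgram q w' := by
  rw [runProgram_append, h, Measure.dirac_bind (measurable_runProgram q)]

lemma runProgram_cons_of_dirac {c : Instr} {p : List Instr} {w w' : ℕ → ℝ}
    (h : c.run w = Measure.dirac w') : runProgram (c :: p) w = runProgram p w' := by
  have e : runProgram (c :: p) w = (c.run w).bind (runProgram p) := rfl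
  rw [e, h, Measure.dirac_bind (measurable_runProgram p)]

/-- An elementary function of cells can be computed by one instruction. -/
lemma Elementary.exists_instr {X : Set (Mem → ℝ)} {f : Mem → ℝ} (hf : Elementary X f) {N : ℕ}
    {e : Mem → Mem} (hX : ∀ g ∈ X, ∃ d < N, ∀ v, e v d = g v) :
    ∃ c : Instr, ∀ v, c.run (e v) = Measure.dirac (Function.update (e v) N (f v)) := by
  cases hf with
  | const c => exact ⟨.const N c, fun v => rfl⟩
  | add hf hg =>
    obtain ⟨i, -, hi⟩ := hX _ hf
    obtain ⟨j, -, hj⟩ := hX _ hg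
    exact ⟨.add N i j, fun v => by simp only [Instr.run, hi, hj]⟩
  | sub hf hg =>
    obtain ⟨i, -, hi⟩ := hX _ hf
    obtain ⟨j, -, hj⟩ := hX _ hg
    exact ⟨.sub N i j, fun v => by simp only [Instr.run, hi, hj]⟩
  | mul hf hg =>
    obtain ⟨i, -, hi⟩ := hX _ hf
    obtain ⟨j, -, hj⟩ := hX _ hg
    exact ⟨.mul N i j, fun v => by simp only [Instr.run, hi, hj]⟩

/-- Compilation of a computation to a straight-line program that leaves the first `n` cells
untouched. -/
lemma Reach.compile {X Y : Set (Mem → ℝ)} {c : ℕ} (h : Reach X c Y) {n N : ℕ} (hnN : n ≤ N)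
    {e : Mem → Mem} (hX : ∀ g ∈ X, ∃ d, n ≤ d ∧ d < N ∧ ∀ v, e v d = g v) :
    ∃ (p : List Instr) (e' : Mem → Mem), p.length ≤ c ∧
      (∀ v, runProgram p (e v) = Measure.dirac (e' v)) ∧
      ∀ g ∈ Y, ∃ d, n ≤ d ∧ ∀ v, e' v d = g v := by
  induction h generalizing N e with
  | done h =>
    refine ⟨[], e, by simp, fun v => rfl, fun g hg => ?_⟩
    obtain ⟨d, h1, -, h2⟩ := hX g (h hg)
    exact ⟨d, h1, h2⟩
  | @step X Y c f hf _ ih =>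
    obtain ⟨i, hi⟩ := hf.exists_instr (N := N) (e := e) fun g hg => by
      obtain ⟨d, -, h1, h2⟩ := hX g hg
      exact ⟨d, h1, h2⟩
    obtain ⟨p, e', hp, hrun, hY⟩ := ih (N := N + 1) (by omega)
      (e := fun v => Function.update (e v) N (f v)) (by
        rintro g (rfl | hg)
        · exact ⟨N, hnN, by omega, fun v => by simp⟩
        · obtain ⟨d, h1, h2, h3⟩ := hX g hg
          exact ⟨d, h1, by omega, fun v => by
            rw [Function.update_of_ne h2.ne, h3]⟩)
    exact ⟨i :: p, e', by simpa using hp,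
      fun v => (runProgram_cons_of_dirac (hi v)).trans (hrun v), hY⟩

/-- The program that copies `n` cells, provided that the cell `o` contains `0`. -/
def copyProgram (o : ℕ) (src dst : ℕ → ℕ) (n : ℕ) : List Instr :=
  (List.range n).map fun i => Instr.add (dst i) (src i) o

/-- There is no move instruction, so a cell is copied by adding the zero stored in cell `o`. The
disjointness conditions ensure that neither sources nor the zero are overwritten. -/
lemma exists_run_copyProgram {o : ℕ} {src dst : ℕ → ℕ} (hinj : Function.Injective dst) (n : ℕ)
    (hsrc : ∀ i < n, ∀ j < n, dst i ≠ src j) (ho : ∀ i < n, dst i ≠ o) (w : Mem) (hw : w o = 0) :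
    ∃ w' : Mem, runProgram (copyProgram o src dst n) w = Measure.dirac w' ∧
      (∀ i < n, w' (dst i) = w (src i)) ∧ ∀ d, (∀ i < n, dst i ≠ d) → w' d = w d := by
  induction n with
  | zero => exact ⟨w, rfl, by simp, by simp⟩
  | succ n ih =>
    obtain ⟨w', h1, h2, h3⟩ := ih (fun i hi j hj => hsrc i (by omega) j (by omega))
      (fun i hi => ho i (by omega))
    have h4 : w' (src n) = w (src n) := h3 _ fun i hi => hsrc i (by omega) n (by omega)
    have h5 : w' o = 0 := (h3 _ fun i hi => ho i (by omega)).trans hw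
    refine ⟨Function.update w' (dst n) (w (src n)), ?_, fun i hi => ?_, fun d hd => ?_⟩
    · have hs : copyProgram o src dst (n + 1) =
          copyProgram o src dst n ++ [Instr.add (dst n) (src n) o] := by
        simp [copyProgram, List.range_succ]
      rw [hs, runProgram_append_of_dirac h1]
      have e : (Instr.add (dst n) (src n) o).run w' =
          Measure.dirac (Function.update w' (dst n) (w (src n))) := by
        simp only [Instr.run, h4, h5, add_zero]
      exact runProgram_cons_of_dirac e
    · rcases Nat.lt_succ_iff_lt_or_eq.1 hi with hi | rfl
      · rw [Function.update_of_ne (fun h => hi.ne (hinj h)), h2 i hi]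
      · simp
    · rw [Function.update_of_ne (hd n (by omega)).symm, h3 d fun i hi => hd i (by omega)]

/-- The program that draws `k` standard normals into the cells `n, …, n + k - 1`. -/
def normalsProgram (n k : ℕ) : List Instr := (List.range' n k).map Instr.normal

/-- Drawing all the noise first isolates the randomness in one product measure; what follows in a
program can then be deterministic. -/
lemma exists_run_normalsProgram (k n : ℕ) :
    ∃ F : Mem → (Fin k → ℝ) → Mem, Measurable (Function.uncurry F) ∧
      (∀ w, runProgram (normalsProgram n k) w =
        (Measure.pi fun _ : Fin k => gaussianReal 0 1).map (F w)) ∧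
      (∀ w z d, d < n → F w z d = w d) ∧ ∀ w z (i : Fin k), F w z (n + i) = z i := by
  induction k generalizing n with
  | zero =>
    refine ⟨fun w _ => w, measurable_fst, fun w => ?_, fun _ _ _ _ => rfl, fun _ _ i => i.elim0⟩
    rw [Measure.map_const, measure_univ, one_smul]
    rfl
  | succ k ih =>
    obtain ⟨F, hF, hrun, hlow, hval⟩ := ih (n + 1)
    have hupd := measurable_update_cell n
    have hG : Measurable fun q : Mem × (Fin (k + 1) → ℝ) =>
        F (Function.update q.1 n (q.2 0)) (fun i => q.2 i.succ) := by
      refine hF.comp (f := fun q : Mem × (Fin (k + 1) → ℝ) =>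
        (Function.update q.1 n (q.2 0), fun i : Fin k => q.2 i.succ)) (Measurable.prodMk ?_ ?_)
      · exact hupd.comp (f := fun q : Mem × (Fin (k + 1) → ℝ) => (q.1, q.2 0)) (by fun_prop)
      · fun_prop
    refine ⟨fun w z => F (Function.update w n (z 0)) (fun i => z i.succ), hG, fun w => ?_,
      fun w z d hd => ?_, fun w z i => ?_⟩
    · have hw : Measurable fun x : ℝ => Function.update w n x :=
        hupd.comp measurable_prodMk_left
      have e : runProgram (normalsProgram n (k + 1)) w =
          ((gaussianReal 0 1).map fun z => Function.update w n z).bind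
            (runProgram (normalsProgram (n + 1) k)) := rfl
      have hF' : Measurable (Function.uncurry fun (x : ℝ) => F (Function.update w n x)) :=
        hF.comp (f := fun p : ℝ × (Fin k → ℝ) => (Function.update w n p.1, p.2))
          ((hw.comp measurable_fst).prodMk measurable_snd)
      rw [e, map_bind _ hw (measurable_runProgram _)]
      simp_rw [hrun]
      rw [bind_map_eq_map_prod _ _ hF']
      have hmp := measurePreserving_piFinSuccAbove (fun _ : Fin (k + 1) => gaussianReal 0 1) 0
      rw [← hmp.map_eq, Measure.map_map hF' (MeasurableEquiv.measurable _)]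
      rfl
    · exact (hlow _ _ _ (by omega)).trans (Function.update_of_ne hd.ne _ _)
    · refine Fin.cases ?_ (fun j => ?_) i
      · exact (hlow _ _ n (by omega)).trans (Function.update_self _ _ _)
      · have := hval (Function.update w n (z 0)) (fun i => z i.succ) j
        rw [← this]
        congr 1
        simp only [Fin.val_succ]; omega

lemma bind_map_eq {X Y Z : Type*} [MeasurableSpace X] [MeasurableSpace Y] [MeasurableSpace Z]
    (μ : Measure X) {κ : X → Measure Y} (hκ : Measurable κ) {h : Y → Z} (hh : Measurable h) :
    (μ.bind κ).map h = μ.bind fun x => (κ x).map h := by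
  rw [Measure.bind, ← Measure.join_map_map hh, Measure.map_map (Measure.measurable_map h hh) hκ]
  rfl

lemma multivariateGaussian_eq_map_pi {n k : ℕ} (m : E n) (Q : Matrix (Fin n) (Fin k) ℝ) :
    (Measure.pi fun _ : Fin k => gaussianReal 0 1).map
      (fun z => m + app Q (WithLp.toLp 2 z)) = multivariateGaussian m (Q * Qᵀ) := by
  have h := multivariateGaussian_map_add_app (K := (1 : Matrix (Fin k) (Fin k) ℝ))
    Matrix.PosSemidef.one Q 0 m
  rw [multivariateGaussian_zero_one, ← map_pi_eq_stdGaussian, Measure.map_map (by fun_prop)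
    (by fun_prop), app_zero, add_zero, Matrix.mul_one] at h
  exact h

/-- A sampler gives a straight-line program. -/
lemma Sampler.exists_program {n : ℕ} {A T : Matrix (Fin n) (Fin n) ℝ} {c k cA : ℕ}
    (h : Sampler A T c k) (hA : MatCost A cA) (f : E n) :
    ∃ p : List Instr, Implements p (corrLaw A T f) ∧ p.length ≤ k + c + cA + 5 * n + 2 := by
  obtain ⟨κ, hκ, Q, hk, hQ, hr⟩ := h
  set k' := Fintype.card κ with hk'
  let eκ : κ ≃ Fin k' := Fintype.equivFin κ
  obtain ⟨F, hF, hFrun, hFlow, hFval⟩ := exists_run_normalsProgram k' n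
  -- Memory layout: the state in cells below `n`, then the `k'` normals, a zero in cell `o`, a copy
  -- of the state, and scratch space.
  set o := n + k' with ho
  let th : Mem → Fin n → ℝ := fun v i => v i
  let z : Mem → κ → ℝ := fun v i => v (n + eκ i)
  let r : Mem → Fin n → ℝ := fun v => f.ofLp - A *ᵥ th v
  let out : Mem → Fin n → ℝ := fun v => th v + (T *ᵥ r v + Q *ᵥ z v)
  let X : Set (Mem → ℝ) := coords th ∪ coords z ∪ {fun _ => 0}
  -- The zero function is carried along because the final copy needs a zero cell. The `3n`
  -- operations load `f`, form the residual and add the increment.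
  have hreach : Reach X (c + cA + 3 * n) ({fun _ => 0} ∪ coords out) := by
    refine Reach.keep ?_ Set.subset_union_right
    have s1 : Reach X n (coords fun _ : Mem => f.ofLp) := by
      have := Reach.const (X := X) f.ofLp
      rwa [Fintype.card_fin] at this
    have s2 : Reach (X ∪ coords fun _ : Mem => f.ofLp) cA (coords fun v => A *ᵥ th v) :=
      hA.reach (fun g hg => .inl (.inl (.inl hg)))
    have s3 : Reach (X ∪ ((coords fun _ : Mem => f.ofLp) ∪ coords fun v => A *ᵥ th v)) n
        (coords r) := by
      have := Reach.sub (X := X ∪ ((coords fun _ : Mem => f.ofLp) ∪ coords fun v => A *ᵥ th v))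
        (x := fun _ => f.ofLp) (y := fun v => A *ᵥ th v) (fun g hg => .inr (.inl hg))
        (fun g hg => .inr (.inr hg))
      rwa [Fintype.card_fin] at this
    have s4 := (s1.trans_keep s2).trans s3
    have s5 := s4.trans ((hr r z).mono (Set.union_subset Set.subset_union_right
      (fun g hg => .inl (.inl (.inr hg)))) subset_rfl le_rfl)
    have s6 := s5.trans (Z := coords out) (d := n) (by
      have := Reach.add (X := X ∪ coords fun v => T *ᵥ r v + Q *ᵥ z v) (x := th)
        (y := fun v => T *ᵥ r v + Q *ᵥ z v) (fun g hg => .inl (.inl (.inl hg)))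
        Set.subset_union_right
      rwa [Fintype.card_fin] at this)
    exact s6.mono subset_rfl subset_rfl (by omega)
  -- the memory after zeroing cell `o` and copying the input
  have hcopy : ∀ v : Mem, ∃ w' : Mem,
      runProgram (Instr.const o 0 :: copyProgram o id (fun i => o + 1 + i) n) v =
        Measure.dirac w' ∧ (∀ i < n, w' (o + 1 + i) = v i) ∧ w' o = 0 ∧
        ∀ d < o, w' d = v d := by
    intro v
    obtain ⟨w', h1, h2, h3⟩ := exists_run_copyProgram (o := o) (src := id)
      (dst := fun i => o + 1 + i) (fun i j h => by simpa using h) n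
      (fun i hi j hj => by simp only [id]; omega) (fun i hi => by omega)
      (Function.update v o 0) (by simp)
    refine ⟨w', (runProgram_cons_of_dirac rfl).trans h1, fun i hi => ?_, ?_, fun d hd => ?_⟩
    · rw [h2 i hi, id, Function.update_of_ne (by omega)]
    · rw [h3 o fun i hi => by omega]; simp
    · rw [h3 d fun i hi => by omega, Function.update_of_ne hd.ne]
  choose e he1 he2 he3 he4 using hcopy
  -- Working from the copied state keeps all sources at cells `≥ n`, so the result can be copied
  -- back into the first `n` cells without overwriting one of its own sources.
  obtain ⟨p, e', hp, hprun, hY⟩ := hreach.compile (n := n) (N := o + 1 + n) (by omega) (e := e) (by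
    rintro g ((⟨i, rfl⟩ | ⟨i, rfl⟩) | rfl)
    · exact ⟨o + 1 + i, by omega, by omega, fun v => he2 v i i.2⟩
    · have := (eκ i).2
      exact ⟨n + eκ i, by omega, by omega, fun v => he4 v _ (by omega)⟩
    · exact ⟨o, by omega, by omega, he3⟩)
  obtain ⟨d₀, hd₀, hzero⟩ := hY _ (.inl rfl)
  have hsrc : ∀ i : ℕ, ∃ d, n ≤ d ∧ ∀ hi : i < n, ∀ v, e' v d = out v ⟨i, hi⟩ := by
    intro i
    by_cases hi : i < n
    · obtain ⟨d, h1, h2⟩ := hY _ (.inr ⟨⟨i, hi⟩, rfl⟩)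
      exact ⟨d, h1, fun _ => h2⟩
    · exact ⟨n, le_rfl, fun h => absurd h hi⟩
  choose src hsrc1 hsrc2 using hsrc
  have hdet : ∀ v : Mem, (runProgram ((Instr.const o 0 :: copyProgram o id (fun i => o + 1 + i) n)
      ++ (p ++ copyProgram d₀ src id n)) v).map (readVec n) =
      Measure.dirac (WithLp.toLp 2 (out v)) := by
    intro v
    obtain ⟨w', h1, h2, -⟩ := exists_run_copyProgram (o := d₀) (src := src) (dst := id)
      Function.injective_id n (fun i hi j hj => by have := hsrc1 j; simp only [id]; omega)
      (fun i hi => by simp only [id]; omega) (e' v) (hzero v)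
    have hread : Measurable (readVec n) := by
      unfold readVec
      fun_prop
    rw [runProgram_append_of_dirac (he1 v), runProgram_append_of_dirac (hprun v), h1,
      Measure.map_dirac' hread]
    congr 1
    ext i
    exact (h2 i i.2).trans (hsrc2 i i.2 v)
  refine ⟨normalsProgram n k' ++ ((Instr.const o 0 :: copyProgram o id (fun i => o + 1 + i) n)
      ++ (p ++ copyProgram d₀ src id n)), fun w => ?_, ?_⟩
  · have hread : Measurable (readVec n) := by
      unfold readVec
      fun_prop
    have hout : Measurable fun v => (WithLp.toLp 2 (out v) : E n) := by
      have hth : Measurable th := by fun_prop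
      have hz : Measurable z := by fun_prop
      have h1 : ∀ {a b : Type} [Fintype a] [Fintype b] (N : Matrix a b ℝ) {g : Mem → b → ℝ},
          Measurable g → Measurable fun v => N *ᵥ g v := by
        intro a b _ _ N g hg
        refine measurable_pi_lambda _ fun i => ?_
        simp only [mulVec, dotProduct]
        fun_prop
      have hr' : Measurable r := measurable_const.sub (h1 A hth)
      have := hth.add ((h1 T hr').add (h1 Q hz))
      fun_prop
    rw [runProgram_append, bind_map_eq _ (measurable_runProgram _) hread]
    simp_rw [hdet]
    have hFw : Measurable (F w) := hF.comp measurable_prodMk_left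
    rw [Measure.bind_dirac_eq_map _ hout, hFrun, Measure.map_map hout hFw]
    set Q' : Matrix (Fin n) (Fin k') ℝ := Q.submatrix id eκ.symm with hQ'
    have hQQ : Q' * Q'ᵀ = covT A T := by
      rw [← hQ, hQ', transpose_submatrix, submatrix_mul_equiv, submatrix_id_id]
    rw [corrLaw, ← hQQ, ← multivariateGaussian_eq_map_pi]
    congr 1
    funext x
    have e1 : th (F w x) = (readVec n w).ofLp := funext fun i => hFlow w x i i.2
    have e2 : z (F w x) = x ∘ eκ := funext fun i => hFval w x (eκ i)
    have e3 : Q' *ᵥ x = Q *ᵥ (x ∘ eκ) := by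
      rw [hQ', submatrix_mulVec_equiv]; rfl
    ext i
    simp only [Function.comp_def, out, r, e1, PiLp.add_apply, app_ofLp, e3, WithLp.ofLp_sub]
    rw [e2]
    simp only [Pi.add_apply, Function.comp_def]
    ring
  · simp only [normalsProgram, copyProgram, List.length_append, List.length_map,
      List.length_range', List.length_range, List.length_cons]
    omega

end Machine

end MGMC

namespace MGMC

/-! ### Linear cost of the symmetric Gibbs smoother and of the V-cycle. -/

section Gibbs

variable {H : Type*} [NormedAddCommGroup H] [InnerProductSpace ℝ H] {β : ℕ}
  {𝔓 : BayesProblem H β} (𝔥 : Hierarchy 𝔓)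

lemma isUnit_det_of_dotProduct_mulVec_pos {m : ℕ} {N : Matrix (Fin m) (Fin m) ℝ}
    (h : ∀ x ≠ 0, 0 < x ⬝ᵥ (N *ᵥ x)) : IsUnit N.det := by
  rw [isUnit_iff_ne_zero]
  intro h0
  obtain ⟨x, hx, hx0⟩ := Matrix.exists_mulVec_eq_zero_iff.2 h0
  have := h x hx
  rw [hx0, dotProduct_zero] at this
  exact lt_irrefl _ this

namespace Hierarchy

lemma A_eq_split (ℓ : ℕ) : 𝔥.A ℓ = 𝔥.diagPart ℓ + 𝔥.lowerPart ℓ + (𝔥.lowerPart ℓ)ᵀ := by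
  ext i j
  have hs : 𝔥.A ℓ j i = 𝔥.A ℓ i j := congrFun (congrFun (𝔥.A_transpose ℓ) i) j
  simp only [diagPart, lowerPart, Matrix.add_apply, transpose_apply, of_apply, diagonal_apply]
  rcases lt_trichotomy i j with h | h | h
  · simp [h, h.ne, h.not_gt, hs]
  · subst h; simp
  · simp [h, h.ne', h.not_gt]

lemma diagPart_posDef (ℓ : ℕ) : (𝔥.diagPart ℓ).PosDef :=
  Matrix.PosDef.diagonal fun _ => (𝔥.A_posDef ℓ).diag_pos

/-- The block-diagonal part `D + B Γ⁻¹ Bᵀ` of the Gibbs splitting. -/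
noncomputable def gibbsDiag (ℓ : ℕ) : Matrix (Fin (𝔥.n ℓ)) (Fin (𝔥.n ℓ)) ℝ :=
  𝔥.diagPart ℓ + 𝔥.lowRank ℓ

lemma gibbsDiag_posDef (ℓ : ℕ) : (𝔥.gibbsDiag ℓ).PosDef :=
  (𝔥.diagPart_posDef ℓ).add_posSemidef (𝔥.lowRank_posSemidef ℓ)

lemma dotProduct_diag_add_lower_pos (ℓ : ℕ) (x : Fin (𝔥.n ℓ) → ℝ) (hx : x ≠ 0) :
    0 < x ⬝ᵥ ((𝔥.diagPart ℓ + 𝔥.lowerPart ℓ) *ᵥ x) := by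
  have h1 : 0 < x ⬝ᵥ (𝔥.A ℓ *ᵥ x) := by simpa using (𝔥.A_posDef ℓ).dotProduct_mulVec_pos hx
  have h2 : 0 < x ⬝ᵥ (𝔥.diagPart ℓ *ᵥ x) := by
    simpa using (𝔥.diagPart_posDef ℓ).dotProduct_mulVec_pos hx
  have h3 : x ⬝ᵥ ((𝔥.lowerPart ℓ)ᵀ *ᵥ x) = x ⬝ᵥ (𝔥.lowerPart ℓ *ᵥ x) := by
    rw [dotProduct_mulVec, vecMul_transpose, dotProduct_comm]
  rw [A_eq_split, add_mulVec, add_mulVec, dotProduct_add, dotProduct_add, h3] at h1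
  rw [add_mulVec, dotProduct_add]
  linarith

lemma isUnit_det_diag_add_lower (ℓ : ℕ) : IsUnit (𝔥.diagPart ℓ + 𝔥.lowerPart ℓ).det :=
  isUnit_det_of_dotProduct_mulVec_pos (𝔥.dotProduct_diag_add_lower_pos ℓ)

lemma isUnit_det_gibbs_lower (ℓ : ℕ) : IsUnit (𝔥.gibbsDiag ℓ + 𝔥.lowerPart ℓ).det := by
  refine isUnit_det_of_dotProduct_mulVec_pos fun x hx => ?_
  have h1 := 𝔥.dotProduct_diag_add_lower_pos ℓ x hx
  have h2 : 0 ≤ x ⬝ᵥ (𝔥.lowRank ℓ *ᵥ x) := by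
    simpa using (𝔥.lowRank_posSemidef ℓ).dotProduct_mulVec_nonneg x
  rw [gibbsDiag, add_right_comm, add_mulVec, dotProduct_add]
  linarith

lemma transpose_gibbs_lower (ℓ : ℕ) :
    (𝔥.gibbsDiag ℓ + 𝔥.lowerPart ℓ)ᵀ = 𝔥.gibbsDiag ℓ + (𝔥.lowerPart ℓ)ᵀ := by
  rw [transpose_add, PosDef.transpose_eq (𝔥.gibbsDiag_posDef ℓ)]

lemma transpose_diag_add_lower (ℓ : ℕ) :
    (𝔥.diagPart ℓ + 𝔥.lowerPart ℓ)ᵀ = 𝔥.diagPart ℓ + (𝔥.lowerPart ℓ)ᵀ := by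
  rw [transpose_add, PosDef.transpose_eq (𝔥.diagPart_posDef ℓ)]

lemma sgs_eq (ℓ : ℕ) : 𝔥.sgs ℓ = (𝔥.gibbsDiag ℓ + 𝔥.lowerPart ℓ) * (𝔥.gibbsDiag ℓ)⁻¹ *
    (𝔥.gibbsDiag ℓ + (𝔥.lowerPart ℓ)ᵀ) := rfl

lemma sgs_eq_post_add (ℓ : ℕ) : 𝔥.sgs ℓ =
    𝔥.post ℓ + 𝔥.lowerPart ℓ * (𝔥.gibbsDiag ℓ)⁻¹ * (𝔥.lowerPart ℓ)ᵀ := by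
  have h1 := PosDef.mul_inv (𝔥.gibbsDiag_posDef ℓ)
  have h2 := PosDef.inv_mul (𝔥.gibbsDiag_posDef ℓ)
  have h3 : 𝔥.post ℓ = 𝔥.gibbsDiag ℓ + 𝔥.lowerPart ℓ + (𝔥.lowerPart ℓ)ᵀ := by
    rw [post, A_eq_split, gibbsDiag]; abel
  rw [sgs_eq, h3, Matrix.add_mul, h1, Matrix.add_mul, Matrix.one_mul, Matrix.mul_add,
    Matrix.mul_assoc _ _ (𝔥.gibbsDiag ℓ), h2, Matrix.mul_one]
  abel

/-- Applying the smoother is a lower and an upper triangular solve, each with a low-rank update,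
around one product with the block diagonal. -/
lemma sgs_inv (ℓ : ℕ) : (𝔥.sgs ℓ)⁻¹ = (𝔥.gibbsDiag ℓ + (𝔥.lowerPart ℓ)ᵀ)⁻¹ *
    (𝔥.gibbsDiag ℓ * (𝔥.gibbsDiag ℓ + 𝔥.lowerPart ℓ)⁻¹) := by
  rw [sgs_eq, Matrix.mul_inv_rev, Matrix.mul_inv_rev, Matrix.nonsing_inv_nonsing_inv]
  exact (Matrix.isUnit_iff_isUnit_det _).1 (𝔥.gibbsDiag_posDef ℓ).isUnit

/-- A square root of `D + B Γ⁻¹ Bᵀ` with `n + β` columns. -/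
noncomputable def gibbsRoot (ℓ : ℕ) : Matrix (Fin (𝔥.n ℓ)) (Fin (𝔥.n ℓ) ⊕ Fin β) ℝ :=
  Matrix.fromCols (Matrix.diagonal fun i => Real.sqrt (𝔥.A ℓ i i)) (𝔥.B ℓ * CFC.sqrt 𝔓.Γ⁻¹)

lemma gibbsRoot_mul_transpose (ℓ : ℕ) :
    𝔥.gibbsRoot ℓ * (𝔥.gibbsRoot ℓ)ᵀ = 𝔥.gibbsDiag ℓ := by
  rw [gibbsRoot, transpose_fromCols, fromCols_mul_fromRows, diagonal_transpose,
    diagonal_mul_diagonal, transpose_mul, sqrt_transpose, gibbsDiag, lowRank, diagPart]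
  congr 1
  · congr 1
    funext i
    exact Real.mul_self_sqrt (𝔥.A_posDef ℓ).diag_pos.le
  · rw [Matrix.mul_assoc (𝔥.B ℓ), ← Matrix.mul_assoc (CFC.sqrt _),
      sqrt_mul_sqrt 𝔓.Γ_posDef.inv, Matrix.mul_assoc (𝔥.B ℓ)]

/-- The noise of the symmetric Gibbs smoother as an image of standard normals. -/
noncomputable def gibbsNoise (ℓ : ℕ) : Matrix (Fin (𝔥.n ℓ))
    ((Fin (𝔥.n ℓ) ⊕ Fin β) ⊕ (Fin (𝔥.n ℓ) ⊕ Fin β)) ℝ :=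
  Matrix.fromCols
    ((𝔥.gibbsDiag ℓ + 𝔥.lowerPart ℓ) * ((𝔥.gibbsDiag ℓ)⁻¹ * 𝔥.gibbsRoot ℓ))
    (𝔥.lowerPart ℓ * ((𝔥.gibbsDiag ℓ)⁻¹ * 𝔥.gibbsRoot ℓ))

/-- With `G` the block diagonal, `2M - Ã = M + L G⁻¹ Lᵀ` by `sgs_eq_post_add`. Both summands are
congruences of `G⁻¹`, and `G⁻¹` times the explicit root of `G` is a root of `G⁻¹`, so no
factorisation with fill-in is needed. -/
lemma gibbsNoise_mul_transpose (ℓ : ℕ) (hs : (𝔥.sgs ℓ)ᵀ = 𝔥.sgs ℓ) :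
    𝔥.gibbsNoise ℓ * (𝔥.gibbsNoise ℓ)ᵀ = 𝔥.sgs ℓ + (𝔥.sgs ℓ)ᵀ - 𝔥.post ℓ := by
  have h1 : ((𝔥.gibbsDiag ℓ)⁻¹ * 𝔥.gibbsRoot ℓ) * ((𝔥.gibbsDiag ℓ)⁻¹ * 𝔥.gibbsRoot ℓ)ᵀ =
      (𝔥.gibbsDiag ℓ)⁻¹ := by
    rw [transpose_mul, Matrix.mul_assoc, ← Matrix.mul_assoc (𝔥.gibbsRoot ℓ),
      gibbsRoot_mul_transpose, PosDef.transpose_eq (𝔥.gibbsDiag_posDef ℓ).inv,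
      PosDef.mul_inv (𝔥.gibbsDiag_posDef ℓ), Matrix.mul_one]
  have h2 : ∀ N : Matrix (Fin (𝔥.n ℓ)) (Fin (𝔥.n ℓ)) ℝ,
      (N * ((𝔥.gibbsDiag ℓ)⁻¹ * 𝔥.gibbsRoot ℓ)) *
        (N * ((𝔥.gibbsDiag ℓ)⁻¹ * 𝔥.gibbsRoot ℓ))ᵀ = N * (𝔥.gibbsDiag ℓ)⁻¹ * Nᵀ := by
    intro N
    rw [transpose_mul N, Matrix.mul_assoc N, ← Matrix.mul_assoc _ _ Nᵀ, h1, Matrix.mul_assoc]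
  rw [gibbsNoise, transpose_fromCols, fromCols_mul_fromRows, h2, h2, transpose_gibbs_lower,
    ← sgs_eq, hs, add_sub_assoc]
  congr 1
  rw [eq_sub_iff_add_eq, sgs_eq_post_add, add_comm]

variable {s : ℕ}

lemma lowRank_eq (ℓ : ℕ) : 𝔥.lowRank ℓ = (𝔥.B ℓ * 𝔓.Γ⁻¹) * (𝔥.B ℓ)ᵀ := rfl

lemma matCost_A (hs : 𝔥.Sparse s) (ℓ : ℕ) : MatCost (𝔥.A ℓ) (𝔥.n ℓ * (3 * s + 1)) := by
  simpa using matCost_of_sparse (hs ℓ).1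

lemma matCost_post (hs : 𝔥.Sparse s) {ℓ : ℕ} (hn : 0 < 𝔥.n ℓ) :
    MatCost (𝔥.post ℓ) ((3 * s + 7 * β + 3) * 𝔥.n ℓ) := by
  refine ((𝔥.matCost_A hs ℓ).add (matCost_lowRank hn (𝔥.B ℓ * 𝔓.Γ⁻¹) (𝔥.B ℓ)ᵀ)).mono
    (le_of_eq ?_)
  rw [Fintype.card_fin]
  ring

lemma matCost_diagonal {m : ℕ} (d : Fin m → ℝ) : MatCost (Matrix.diagonal d) (4 * m) := by
  have h : ∀ i, {j | Matrix.diagonal d i j ≠ 0}.ncard ≤ 1 := fun i => by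
    rw [← Set.ncard_singleton i]
    refine Set.ncard_le_ncard fun j hj => ?_
    by_contra hij
    exact hj (Matrix.diagonal_apply_ne' _ hij)
  refine (matCost_of_sparse h).mono (le_of_eq ?_)
  rw [Fintype.card_fin]
  ring

lemma matCost_diagPart_inv (ℓ : ℕ) : MatCost (𝔥.diagPart ℓ)⁻¹ (4 * 𝔥.n ℓ) := by
  rw [diagPart, Matrix.inv_diagonal]
  exact matCost_diagonal _

lemma matCost_gibbsDiag_inv {ℓ : ℕ} (hn : 0 < 𝔥.n ℓ) :
    MatCost (𝔥.gibbsDiag ℓ)⁻¹ ((7 * β + 2 + 4) * 𝔥.n ℓ) := by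
  have h := (Matrix.isUnit_iff_isUnit_det _).1 (𝔥.gibbsDiag_posDef ℓ).isUnit
  rw [gibbsDiag, lowRank_eq] at h ⊢
  exact matCost_inv_add_lowRank hn ((Matrix.isUnit_iff_isUnit_det _).1
    (𝔥.diagPart_posDef ℓ).isUnit) h (𝔥.matCost_diagPart_inv ℓ)

lemma ncard_lowerPart_le (hs : 𝔥.Sparse s) (ℓ : ℕ) (i : Fin (𝔥.n ℓ)) :
    {j | 𝔥.lowerPart ℓ i j ≠ 0}.ncard ≤ s := by
  refine le_trans (Set.ncard_le_ncard (t := {j | 𝔥.A ℓ i j ≠ 0}) fun j hj h0 => hj ?_) ((hs ℓ).1 i)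
  simp [lowerPart, h0]

lemma matCost_lowerPart (hs : 𝔥.Sparse s) (ℓ : ℕ) :
    MatCost (𝔥.lowerPart ℓ) ((3 * s + 1) * 𝔥.n ℓ) := by
  refine (matCost_of_sparse (𝔥.ncard_lowerPart_le hs ℓ)).mono (le_of_eq ?_)
  rw [Fintype.card_fin, mul_comm]

lemma diag_add_lower_apply (ℓ : ℕ) (i j : Fin (𝔥.n ℓ)) :
    (𝔥.diagPart ℓ + 𝔥.lowerPart ℓ) i j = if j ≤ i then 𝔥.A ℓ i j else 0 := by
  simp only [diagPart, lowerPart, Matrix.add_apply, of_apply, diagonal_apply]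
  rcases lt_trichotomy i j with h | h | h
  · simp [h.ne, h.not_gt, h.not_ge]
  · subst h; simp
  · simp [h, h.ne', h.le]

lemma matCost_diag_add_lower_inv (hs : 𝔥.Sparse s) (ℓ : ℕ) :
    MatCost (𝔥.diagPart ℓ + 𝔥.lowerPart ℓ)⁻¹ ((3 * s + 4) * 𝔥.n ℓ) := by
  rw [mul_comm]
  refine matCost_inv_of_triangular (fun i => (i : ℕ)) (fun i => i.2) Fin.val_injective
    (fun i j h hij => ?_) (fun i => ?_) (𝔥.isUnit_det_diag_add_lower ℓ) fun i => ?_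
  · rw [diag_add_lower_apply] at h
    have : j ≤ i := by
      by_contra h0
      simp [h0] at h
    exact lt_of_le_of_ne this (fun h => hij (Fin.ext h.symm))
  · rw [diag_add_lower_apply]
    simpa using (𝔥.A_posDef ℓ).diag_pos.ne'
  · refine le_trans (Set.ncard_le_ncard (t := {j | 𝔥.A ℓ i j ≠ 0}) fun j hj h0 => hj ?_) ((hs ℓ).1 i)
    rw [diag_add_lower_apply, h0, ite_self]

lemma matCost_diag_add_upper_inv (hs : 𝔥.Sparse s) (ℓ : ℕ) :
    MatCost (𝔥.diagPart ℓ + (𝔥.lowerPart ℓ)ᵀ)⁻¹ ((3 * s + 4) * 𝔥.n ℓ) := by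
  rw [mul_comm, ← transpose_diag_add_lower]
  have happ : ∀ i j, (𝔥.diagPart ℓ + 𝔥.lowerPart ℓ)ᵀ i j = if i ≤ j then 𝔥.A ℓ i j else 0 := by
    intro i j
    rw [transpose_apply, diag_add_lower_apply]
    have : 𝔥.A ℓ j i = 𝔥.A ℓ i j := congrFun (congrFun (𝔥.A_transpose ℓ) i) j
    rw [this]
  -- An upper triangular system is solved from the last unknown upwards, hence the reversed
  -- elimination order.
  refine matCost_inv_of_triangular (fun i => ((Fin.rev i : Fin _) : ℕ)) (fun i => (Fin.rev i).2)
    (fun i j h => Fin.rev_injective (Fin.ext h)) (fun i j h hij => ?_) (fun i => ?_)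
    (by rw [det_transpose]; exact 𝔥.isUnit_det_diag_add_lower ℓ) fun i => ?_
  · rw [happ] at h
    have : i ≤ j := by
      by_contra h0
      simp [h0] at h
    exact Fin.rev_lt_rev.2 (lt_of_le_of_ne this hij)
  · rw [happ]
    simpa using (𝔥.A_posDef ℓ).diag_pos.ne'
  · refine le_trans (Set.ncard_le_ncard (t := {j | 𝔥.A ℓ i j ≠ 0}) fun j hj h0 => hj ?_) ((hs ℓ).1 i)
    rw [happ, h0, ite_self]

lemma matCost_gibbs_lower_inv (hs : 𝔥.Sparse s) {ℓ : ℕ} (hn : 0 < 𝔥.n ℓ) :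
    MatCost (𝔥.gibbsDiag ℓ + 𝔥.lowerPart ℓ)⁻¹ ((7 * β + 2 + (3 * s + 4)) * 𝔥.n ℓ) := by
  have h := 𝔥.isUnit_det_gibbs_lower ℓ
  rw [gibbsDiag, add_right_comm, lowRank_eq] at h ⊢
  exact matCost_inv_add_lowRank hn (𝔥.isUnit_det_diag_add_lower ℓ) h
    (𝔥.matCost_diag_add_lower_inv hs ℓ)

lemma matCost_gibbs_upper_inv (hs : 𝔥.Sparse s) {ℓ : ℕ} (hn : 0 < 𝔥.n ℓ) :
    MatCost (𝔥.gibbsDiag ℓ + (𝔥.lowerPart ℓ)ᵀ)⁻¹ ((7 * β + 2 + (3 * s + 4)) * 𝔥.n ℓ) := by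
  have h := 𝔥.isUnit_det_gibbs_lower ℓ
  have h' := 𝔥.isUnit_det_diag_add_lower ℓ
  rw [← det_transpose, transpose_gibbs_lower] at h
  rw [← det_transpose, transpose_diag_add_lower] at h'
  rw [gibbsDiag, add_right_comm, lowRank_eq] at h ⊢
  exact matCost_inv_add_lowRank hn h' h (𝔥.matCost_diag_add_upper_inv hs ℓ)

lemma matCost_gibbsDiag {ℓ : ℕ} (hn : 0 < 𝔥.n ℓ) :
    MatCost (𝔥.gibbsDiag ℓ) ((7 * β + 6) * 𝔥.n ℓ) := by
  refine ((matCost_diagonal _).add (matCost_lowRank hn (𝔥.B ℓ * 𝔓.Γ⁻¹) (𝔥.B ℓ)ᵀ)).mono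
    (le_of_eq ?_)
  rw [Fintype.card_fin]
  ring

lemma matCost_gibbsRoot (ℓ : ℕ) : MatCost (𝔥.gibbsRoot ℓ) ((3 * β + 6) * 𝔥.n ℓ) := by
  refine ((matCost_diagonal _).fromCols (matCost_dense _)).mono (le_of_eq ?_)
  simp only [Fintype.card_fin]
  ring

lemma matCost_sgs_inv (hs : 𝔥.Sparse s) {ℓ : ℕ} (hn : 0 < 𝔥.n ℓ) :
    MatCost (𝔥.sgs ℓ)⁻¹ ((21 * β + 6 * s + 18) * 𝔥.n ℓ) := by
  rw [sgs_inv]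
  refine ((𝔥.matCost_gibbs_upper_inv hs hn).mul
    ((𝔥.matCost_gibbsDiag hn).mul (𝔥.matCost_gibbs_lower_inv hs hn))).mono (le_of_eq ?_)
  ring

lemma matCost_gibbsNoise (hs : 𝔥.Sparse s) {ℓ : ℕ} (hn : 0 < 𝔥.n ℓ) :
    MatCost (𝔥.gibbsNoise ℓ) ((27 * β + 6 * s + 34) * 𝔥.n ℓ) := by
  have h1 := (𝔥.matCost_gibbsDiag_inv hn).mul (𝔥.matCost_gibbsRoot ℓ)
  have h2 := (𝔥.matCost_gibbsDiag hn).add (𝔥.matCost_lowerPart hs ℓ)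
  refine ((h2.mul h1).fromCols ((𝔥.matCost_lowerPart hs ℓ).mul h1)).mono (le_of_eq ?_)
  simp only [Fintype.card_fin]
  ring

lemma sampler_sgs (hs : 𝔥.Sparse s) {ℓ : ℕ} (hn : 0 < 𝔥.n ℓ)
    (hM : (𝔥.sgs ℓ - 𝔥.post ℓ).PosSemidef) :
    Sampler (𝔥.post ℓ) (𝔥.sgs ℓ)⁻¹ ((48 * β + 12 * s + 53) * 𝔥.n ℓ)
      ((2 * β + 2) * 𝔥.n ℓ) := by
  have hMp := PosDef.of_sub_posSemidef (𝔥.post_posDef ℓ) hM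
  refine (sampler_of_matCost ?_ (𝔥.matCost_sgs_inv hs hn)
    (𝔥.matCost_gibbsNoise hs hn)).mono (le_of_eq ?_) ?_
  · rw [gibbsNoise_mul_transpose _ _ (PosDef.transpose_eq hMp), covT_smoother hMp]
  · ring
  · simp only [Fintype.card_sum, Fintype.card_fin]
    have : β ≤ β * 𝔥.n ℓ := Nat.le_mul_of_pos_right β hn
    nlinarith

lemma matCost_prolong (hs : 𝔥.Sparse s) (ℓ : ℕ) :
    MatCost (𝔥.prolong ℓ) ((3 * s + 1) * 𝔥.n (ℓ + 1)) := by
  refine (matCost_of_sparse (hs ℓ).2.1).mono (le_of_eq ?_)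
  rw [Fintype.card_fin, mul_comm]

lemma matCost_prolong_transpose (hs : 𝔥.Sparse s) (ℓ : ℕ) :
    MatCost (𝔥.prolong ℓ)ᵀ ((3 * s + 1) * 𝔥.n ℓ) := by
  refine (matCost_of_sparse (N := (𝔥.prolong ℓ)ᵀ) (hs ℓ).2.2).mono (le_of_eq ?_)
  rw [Fintype.card_fin, mul_comm]

/-- One more level of the V-cycle costs a multiple of the number of unknowns on that level. -/
lemma exists_sampler_cycle (hs : 𝔥.Sparse s) (k : ℕ) : ∃ K : ℕ, ∀ (ℓ : ℕ)
    {M T c d}, 0 < 𝔥.n (ℓ + 1) → 𝔥.n ℓ ≤ 𝔥.n (ℓ + 1) →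
      (𝔥.sgs (ℓ + 1) - 𝔥.post (ℓ + 1)).PosSemidef → M = 𝔥.sgs (ℓ + 1) →
      Sampler (𝔥.post ℓ) T c d →
      Sampler (𝔥.post (ℓ + 1)) (cycleT (𝔥.post (ℓ + 1)) M (𝔥.prolong ℓ) T k)
        (c + K * 𝔥.n (ℓ + 1)) (d + K * 𝔥.n (ℓ + 1)) := by
  -- The summands account for the two smoothing blocks, prolongation and restriction, the two
  -- compositions, and the normals; one constant bounds both operations and draws.
  refine ⟨2 * (k * ((48 * β + 12 * s + 53) + (3 * s + 7 * β + 3) + 2) + 1) +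
    2 * (3 * s + 1) + 2 * ((3 * s + 7 * β + 3) + 2) + 2 * (k * (2 * β + 2)),
    fun ℓ M T c d hn hle hM hMe h => ?_⟩
  subst hMe
  have hA := PosDef.transpose_eq (𝔥.post_posDef (ℓ + 1))
  have hcA := 𝔥.matCost_post hs hn
  have h1 := (𝔥.sampler_sgs hs hn hM).rep hA hcA k
  have h2 := h.coarse (𝔥.post_galerkin ℓ) (𝔥.matCost_prolong hs ℓ)
    ((𝔥.matCost_prolong_transpose hs ℓ).mono (Nat.mul_le_mul_left _ hle))
  refine (Sampler.comp hA hcA (Sampler.comp hA hcA h1 h2) h1).mono ?_ ?_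
  · have : 0 ≤ 2 * (k * (2 * β + 2)) * 𝔥.n (ℓ + 1) := Nat.zero_le _
    nlinarith
  · have : 0 ≤ (2 * (k * ((48 * β + 12 * s + 53) + (3 * s + 7 * β + 3) + 2) + 1) +
      2 * (3 * s + 1) + 2 * ((3 * s + 7 * β + 3) + 2)) * 𝔥.n (ℓ + 1) := Nat.zero_le _
    nlinarith

/-- Dense products with `A⁻¹` and `A^{1/2}` suffice: the quadratic cost occurs only on the coarsest
level, whose size is fixed. -/
lemma sampler_exact {m : ℕ} {A : Matrix (Fin m) (Fin m) ℝ} (hA : A.PosDef) :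
    Sampler A A⁻¹ (m * (3 * m + 1) + m + m * (3 * m + 1)) m := by
  have h1 : MatCost A⁻¹ (m * (3 * m + 1)) := by simpa using matCost_dense A⁻¹
  have h2 : MatCost (CFC.sqrt A) (m * (3 * m + 1)) := by simpa using matCost_dense (CFC.sqrt A)
  refine (sampler_of_matCost ?_ h1 h2).mono le_rfl (by simp)
  rw [sqrt_transpose, sqrt_mul_sqrt hA, PosDef.inv_mul hA, covT_inv hA, Matrix.one_mul,
    PosDef.transpose_eq hA.inv]

/-- The cost of one V-cycle step is proportional to the number of unknowns. -/
theorem exists_program_vCycle (M : (ℓ : ℕ) → Matrix (Fin (𝔥.n ℓ)) (Fin (𝔥.n ℓ)) ℝ) (ν : ℕ)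
    (h_smooth : ∀ ℓ, (M (ℓ + 1) - 𝔥.post (ℓ + 1)).PosSemidef) (hn : 0 < 𝔥.n 0)
    (hs : 𝔥.Sparse s) {ρ : ℝ} (hρ : ρ < 1)
    (hρn : ∀ ℓ, (𝔥.n ℓ : ℝ) ≤ ρ * 𝔥.n (ℓ + 1)) (hM : ∀ ℓ, 1 ≤ ℓ → M ℓ = 𝔥.sgs ℓ) :
    ∃ C : ℝ, ∀ L : ℕ, ∃ p : List Instr,
      Implements p (𝔥.vCycle M ν L) ∧ (p.length : ℝ) ≤ C * 𝔥.n L := by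
  have hmono : ∀ ℓ, 𝔥.n ℓ ≤ 𝔥.n (ℓ + 1) := fun ℓ => by
    have h1 := hρn ℓ
    have h2 : (0 : ℝ) ≤ 𝔥.n (ℓ + 1) := Nat.cast_nonneg _
    have h3 : (𝔥.n ℓ : ℝ) ≤ 𝔥.n (ℓ + 1) := by nlinarith
    exact_mod_cast h3
  have hpos : ∀ ℓ, 0 < 𝔥.n ℓ := fun ℓ => by
    induction ℓ with
    | zero => exact hn
    | succ ℓ ih => exact ih.trans_le (hmono ℓ)
  obtain ⟨K, hK⟩ := 𝔥.exists_sampler_cycle hs (ν / 2)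
  set m := 𝔥.n 0 with hm
  set c₀ : ℕ := m * (3 * m + 1) + m + m * (3 * m + 1) with hc₀
  -- Chosen to absorb the coarsest solve and satisfy `C ρ + K ≤ C`, the induction step for
  -- geometrically growing levels.
  set C : ℝ := c₀ + K / (1 - ρ) with hC
  have hρ' : 0 < 1 - ρ := by linarith
  have hC0 : 0 ≤ C := by positivity
  have hCK : C * ρ + K ≤ C := by
    have h1 : (K : ℝ) / (1 - ρ) * (1 - ρ) = K := div_mul_cancel₀ _ hρ'.ne'
    have h2 : 0 ≤ (c₀ : ℝ) * (1 - ρ) := by positivity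
    have h3 : C * (1 - ρ) = c₀ * (1 - ρ) + K := by rw [hC, add_mul, h1]
    linarith
  have key : ∀ ℓ, ∃ c d : ℕ, Sampler (𝔥.post ℓ) (vCycleT 𝔥.post M 𝔥.prolong (ν / 2) ℓ) c d ∧
      (c : ℝ) ≤ C * 𝔥.n ℓ ∧ (d : ℝ) ≤ C * 𝔥.n ℓ := by
    intro ℓ
    induction ℓ with
    | zero =>
      have h1 : (1 : ℝ) ≤ 𝔥.n 0 := by exact_mod_cast hn
      have h2 : (c₀ : ℝ) ≤ C * 𝔥.n 0 := by
        have h3 : (c₀ : ℝ) ≤ C := by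
          rw [hC]
          have : 0 ≤ (K : ℝ) / (1 - ρ) := by positivity
          linarith
        exact h3.trans (le_mul_of_one_le_right hC0 h1)
      refine ⟨c₀, m, sampler_exact (𝔥.post_posDef 0), h2, le_trans ?_ h2⟩
      have : m ≤ c₀ := by rw [hc₀]; omega
      exact_mod_cast this
    | succ ℓ ih =>
      obtain ⟨c, d, h1, h2, h3⟩ := ih
      have hMe := hM (ℓ + 1) (by omega)
      refine ⟨_, _, hK ℓ (hpos _) (hmono ℓ) (hMe ▸ h_smooth ℓ) hMe h1, ?_, ?_⟩
      all_goals
        push_cast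
        have h4 := mul_le_mul_of_nonneg_left (hρn ℓ) hC0
        have h5 := mul_le_mul_of_nonneg_right hCK (Nat.cast_nonneg (α := ℝ) (𝔥.n (ℓ + 1)))
        linarith
  -- Operations and normals contribute `C` each, followed by the product with the posterior matrix;
  -- `7 = 5 + 2` covers the copying overhead, using `1 ≤ n_L`.
  refine ⟨2 * C + (3 * s + 7 * β + 3 + 7), fun L => ?_⟩
  obtain ⟨c, d, h1, h2, h3⟩ := key L
  obtain ⟨p, hp, hlen⟩ := h1.exists_program (𝔥.matCost_post hs (hpos L)) (𝔥.f L)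
  refine ⟨p, ?_, ?_⟩
  · have : 𝔥.vCycle M ν L = corrLaw (𝔥.post L) (vCycleT 𝔥.post M 𝔥.prolong (ν / 2) L) (𝔥.f L) :=
      mgmcLaw_eq_corrLaw 𝔥.post_posDef 𝔥.post_galerkin h_smooth _ _ _
    rwa [this]
  · have h4 : (p.length : ℝ) ≤ d + c + (3 * s + 7 * β + 3) * 𝔥.n L + 5 * 𝔥.n L + 2 := by
      exact_mod_cast hlen
    have h5 : (1 : ℝ) ≤ 𝔥.n L := by exact_mod_cast hpos L
    linarith

end Hierarchy

end Gibbs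

end MGMC

/-! ### Assembly of cost, autocorrelation and convergence. -/

theorem mainTheorem1 {H : Type*} [NormedAddCommGroup H] [InnerProductSpace ℝ H]
    [CompleteSpace H] [TopologicalSpace.SeparableSpace H] {β : ℕ}
    (𝔓 : BayesProblem H β) (𝔥 : Hierarchy 𝔓) (𝓕 : H →L[ℝ] ℝ)
    (M : (ℓ : ℕ) → Matrix (Fin (𝔥.n ℓ)) (Fin (𝔥.n ℓ)) ℝ)
    (ν : ℕ) (hν : 0 < ν) (hν_even : Even ν) (C_A : ℝ) (hC_A : 0 < C_A)
    -- the symmetric splitting matrices have the smoothing property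
    (hM_symm : ∀ ℓ, 1 ≤ ℓ → (M ℓ).IsSymm)
    (h_smooth : ∀ ℓ, 1 ≤ ℓ → (𝔥.post ℓ).PosDef ∧ (M ℓ - 𝔥.post ℓ).PosSemidef)
    -- the approximation property
    (h_approx : ∀ ℓ, ‖CFC.sqrt (M (ℓ + 1)) *
        ((𝔥.post (ℓ + 1))⁻¹ - 𝔥.prolong ℓ * (𝔥.post ℓ)⁻¹ * (𝔥.prolong ℓ)ᵀ) *
        CFC.sqrt (M (ℓ + 1))‖ ≤ C_A) :
    -- cost of one step
    ((0 < 𝔥.n 0) → (∃ s : ℕ, 𝔥.Sparse s) →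
      (∃ ρ : ℝ, ρ < 1 ∧ ∀ ℓ, (𝔥.n ℓ : ℝ) ≤ ρ * 𝔥.n (ℓ + 1)) →
      (∀ ℓ, 1 ≤ ℓ → M ℓ = 𝔥.sgs ℓ) →
      ∃ C : ℝ, ∀ L : ℕ, ∃ p : List Instr,
        Implements p (𝔥.vCycle M ν L) ∧ (p.length : ℝ) ≤ C * 𝔥.n L) ∧
    0 < Real.log (C_A + ν) - Real.log C_A ∧
    ∀ C₀ : ℝ, ∃ C_τ C₁₁ C₁₂ : ℝ, 0 < C_τ ∧ 0 < C₁₁ ∧ 0 < C₁₂ ∧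
      ∀ (L : ℕ) {Ω : Type*} [MeasurableSpace Ω] (P : Measure Ω) [IsProbabilityMeasure P]
        (θ : ℕ → Ω → E (𝔥.n L)),
        IsMarkovChain (𝔥.vCycle M ν L) P θ →
        IsGaussian (P.map (θ 0)) →
        max ‖app (CFC.sqrt (𝔥.post L)) (∫ ω, θ 0 ω ∂P)‖
          ‖CFC.sqrt (𝔥.post L) * covMat P (θ 0) * CFC.sqrt (𝔥.post L)‖ ≤ C₀ →
        -- all first and second moments of the quantity of interest exist
        (∀ m, MemLp (fun ω => 𝔥.F 𝓕 L ⬝ᵥ (θ m ω).ofLp) 2 P) ∧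
        -- the integrated autocorrelation time is bounded
        (∀ m, 1 ≤ m →
          (𝔥.F 𝓕 L ≠ 0 → 0 < Var[fun ω => 𝔥.F 𝓕 L ⬝ᵥ (θ m ω).ofLp; P]) ∧
          Summable (fun s => autocorr P (fun k ω => 𝔥.F 𝓕 L ⬝ᵥ (θ k ω).ofLp) m (s + 1)) ∧
          |iact P (fun k ω => 𝔥.F 𝓕 L ⬝ᵥ (θ k ω).ofLp) m| ≤ C_τ) ∧
        -- exponential convergence of mean and variance
        ∀ m : ℕ,
          |(∫ ω, 𝔥.F 𝓕 L ⬝ᵥ (θ m ω).ofLp ∂P) -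
              𝔥.F 𝓕 L ⬝ᵥ ((𝔥.post L)⁻¹ *ᵥ (𝔥.f L).ofLp)| ≤
            C₁₁ * Real.exp (-(Real.log (C_A + ν) - Real.log C_A) * m) ∧
          |Var[fun ω => 𝔥.F 𝓕 L ⬝ᵥ (θ m ω).ofLp; P] -
              𝔥.F 𝓕 L ⬝ᵥ ((𝔥.post L)⁻¹ *ᵥ 𝔥.F 𝓕 L)| ≤
            C₁₂ * Real.exp (-2 * (Real.log (C_A + ν) - Real.log C_A) * m) := by
  have hA := 𝔥.post_posDef
  have hJ := 𝔥.post_galerkin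
  have hsm : ∀ ℓ, (M (ℓ + 1) - 𝔥.post (ℓ + 1)).PosSemidef := fun ℓ => (h_smooth _ (by omega)).2
  have hν' : (0 : ℝ) < ν := by exact_mod_cast hν
  -- Evenness of `ν` makes the truncated division exact, so no smoothing step is lost from the rate.
  have hν2 : (2 * (ν / 2 : ℕ) : ℝ) = ν := by exact_mod_cast Nat.two_mul_div_two_of_even hν_even
  -- The solution of `(1 - ρ) C_A = ρ ν`; its negative logarithm is the exponent `C₂` of the
  -- theorem.
  set ρ : ℝ := C_A / (C_A + ν) with hρ
  have hρ0 : 0 < ρ := by positivity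
  have hρ1 : ρ < 1 := (div_lt_one (by positivity)).2 (by linarith)
  have hlog : Real.log (C_A + ν) - Real.log C_A = -Real.log ρ := by
    rw [hρ, Real.log_div hC_A.ne' (by positivity)]; ring
  have hexp : ∀ m : ℕ, Real.exp (-(Real.log (C_A + ν) - Real.log C_A) * m) = ρ ^ m := fun m => by
    rw [hlog, neg_neg, mul_comm, ← Real.log_pow, Real.exp_log (pow_pos hρ0 m)]
  have hexp2 : ∀ m : ℕ, Real.exp (-2 * (Real.log (C_A + ν) - Real.log C_A) * m) = (ρ ^ m) ^ 2 := by
    intro m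
    rw [← hexp, ← Real.exp_nat_mul]
    push_cast
    ring_nf
  refine ⟨fun hn ⟨s, hs⟩ ⟨r, hr, hrn⟩ hM => 𝔥.exists_program_vCycle M ν hsm hn hs hr hrn hM,
    ?_, fun C₀ => ?_⟩
  · rw [hlog, neg_pos]
    exact Real.log_neg hρ0 hρ1
  have happ : ∀ ℓ, (C_A • (M (ℓ + 1))⁻¹ - ((𝔥.post (ℓ + 1))⁻¹ -
      𝔥.prolong ℓ * (𝔥.post ℓ)⁻¹ * (𝔥.prolong ℓ)ᵀ)).PosSemidef := fun ℓ => by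
    refine posSemidef_of_norm_sqrt_conj_le (PosDef.of_sub_posSemidef (hA _) (hsm ℓ)) ?_
      (h_approx ℓ)
    rw [transpose_sub, PosDef.transpose_eq (hA _).inv, transpose_mul, transpose_mul,
      transpose_transpose, PosDef.transpose_eq (hA _).inv, Matrix.mul_assoc]
  have hρeq : (1 - ρ) * C_A = ρ * (2 * (ν / 2 : ℕ)) := by
    rw [hν2, hρ]
    field_simp
    ring
  have hcontr := vCycleT_contraction hA hJ hsm hρeq hρ1.le hρ0.le happ
  set cF := ‖𝓕‖ * ‖𝔓.covRoot‖ with hcF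
  set cf := ‖Hierarchy.dataFunctional 𝔓‖ * ‖𝔓.covRoot‖ with hcf
  have hcF0 : 0 ≤ cF := by positivity
  have hcf0 : 0 ≤ cf := by positivity
  have hρ2 : 0 < 1 - ρ ^ 2 := by nlinarith
  have hρ3 : 0 < 1 - ρ := by linarith
  -- The absolute value handles an arbitrary real `C₀`, and the added `1` keeps the constants
  -- positive when `cF = 0`.
  refine ⟨1 + 2 * ((1 + |C₀|) / (1 - ρ ^ 2) * (1 - ρ)⁻¹), cF * (|C₀| + cf) + 1,
    cF ^ 2 * (|C₀| + 1) + 1, by positivity, by positivity, by positivity, ?_⟩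
  intro L Ω _ P _ θ hchain hG hmax
  have hlaw : 𝔥.vCycle M ν L =
      corrLaw (𝔥.post L) (vCycleT 𝔥.post M 𝔥.prolong (ν / 2) L) (𝔥.f L) :=
    mgmcLaw_eq_corrLaw hA hJ hsm _ _ _
  rw [hlaw] at hchain
  have hT := covT_vCycleT_posSemidef hA hJ hsm (ν / 2) L
  have hc := contraction_of_le (hA L) hρ0 (hcontr L).1 (hcontr L).2
  have hC₁ := ((le_max_left _ _).trans hmax).trans (le_abs_self C₀)
  have hC₂ := ((le_max_right _ _).trans hmax).trans (le_abs_self C₀)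
  refine ⟨fun m => ?_, fun m hm => ?_, fun m => ?_⟩
  · exact chain_memLp hchain hT (fun u => (memLp_map_measure_iff (by fun_prop)
      (hchain.measurable 0).aemeasurable).1 (memLp_lin hG u)) m _
  · exact chain_autocorrelation (hA L) hchain hT hG hρ0 hρ1 hc hC₂ (𝔥.F 𝓕 L) m hm
  · have hf : dualEnergy (𝔥.post L) (𝔥.f L).ofLp ≤ cf ^ 2 := by
      rw [Hierarchy.f_ofLp]
      exact 𝔥.F_energy_le _ L
    obtain ⟨h1, h2⟩ := chain_convergence (hA L) hchain hT hG hρ0.le hc hC₁ hC₂ hcF0 hcf0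
      (𝔥.F_energy_le 𝓕 L) hf m
    rw [hexp, hexp2]
    have hρm : 0 ≤ ρ ^ m := by positivity
    exact ⟨h1.trans (by gcongr; linarith), h2.trans (by gcongr; linarith)⟩
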